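/- Let $p$ be a prime number. *Frames.* A frame $\underline S=(S,\mathrm{Fil}\,S,R,\varphi,\varphi_1,\varpi)$ consists of a commutative ring $S$, an ideal $\mathrm{Fil}\,S$, the quotient $R=S/\mathrm{Fil}\,S$, a ring endomorphism $\varphi$ of $S$ with $\varphi(x)\equiv x^p \bmod pS$, a $\varphi$-linear map $\varphi_1:\mathrm{Fil}\,S\to S$ and an element $\varpi\in S$ with $\varphi=\varpi\varphi_1$ on $\mathrm{Fil}\,S$, such that $\mathrm{Fil}\,S+pS$ lies in the Jacobson radical of $S$. A window over $\underline S$ is a tuple $(M,\mathrm{Fil}\,M,\Phi,\Phi_1)$ where $M$ is a finite projective $S$-module, $\mathrm{Fil}\,M\subseteq M$ a submodule, and $\Phi:M\to M$, $\Phi_1:\mathrm{Fil}\,M\to M$ are $\varphi$-linear maps such that: (1) there is a decomposition $M=L\oplus N$ with $\mathrm{Fil}\,M=L\oplus(\mathrm{Fil}\,S)N$; (2) $\Phi_1(sm)=\varphi_1(s)\Phi(m)$ for $s\in\mathrm{Fil}\,S$, $m\in M$; (3) $\Phi=\varpi\Phi_1$ on $\mathrm{Fil}\,M$; (4) $\Phi_1(\mathrm{Fil}\,M)\cup\Phi(M)$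 generates $M$. Homomorphisms of windows are the $S$-linear maps that preserve the filtrations and commute with $\Phi$ and $\Phi_1$. A homomorphism of frames $\alpha:\underline S\to\underline S'$ is a ring homomorphism $\alpha:S\to S'$ with $\varphi'\alpha=\alpha\varphi$ and $\alpha(\mathrm{Fil}\,S)\subseteq\mathrm{Fil}\,S'$, together with a unit $c\in S'$ such that $\varphi_1'\alpha=c\cdot\alpha\varphi_1$ on $\mathrm{Fil}\,S$ and $\alpha(\varpi)=c\varpi'$. Its base change functor $\alpha^*$ from windows over $\underline S$ to windows over $\underline S'$ sends $(M,\mathrm{Fil}\,M,\Phi,\Phi_1)$ to $M'=S'\otimes_SM$, with $\mathrm{Fil}\,M'$ the submodule generated by $(\mathrm{Fil}\,S')M'$ and the image of $\mathrm{Fil}\,M$, and with the unique $\varphi'$-linear maps $\Phi',\Phi_1'$ such that $\Phi'(1\otimes m)=1\otimes\Phi(m)$ for $m\in M$, $\Phi_1'(1\otimes x)=c\otimes\Phi_1(x)$ for $x\in\mathrm{Fil}\,M$, and $\Phi_1'(am')=\varphi_1'(a)\Phi'(m')$ for $a\in\mathrm{Fil}\,S'$, $m'\in M'$. The homomorphism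 $\alpha$ is called crystalline if $\alpha^*$ is an equivalence of categories. *Setting.* Let $\mathfrak S$ be a commutative ring with an element $E$ such that $(p,E)$ is a regular sequence in $\mathfrak S$ and $\mathfrak S$ is complete (and separated) for the $(p,E)$-adic topology, and let $\varphi:\mathfrak S\to\mathfrak S$ be a ring endomorphism that lifts the $p$-power map of $\mathfrak S/p\mathfrak S$. Let $R=\mathfrak S/E\mathfrak S$, and let $\underline{\mathfrak S}=(\mathfrak S,E\mathfrak S,R,\varphi,\varphi_1',\varphi(E))$ be the frame with $\varphi_1'(Ex)=\varphi(x)$. Let $S$ be the $p$-adic completion of the divided power envelope of the ideal $E\mathfrak S\subseteq\mathfrak S$, let $\mathrm{Fil}\,S$ be the kernel of the natural map $S\to R$, let $\varphi:S\to S$ be the natural extension of $\varphi$, and let $\underline S=(S,\mathrm{Fil}\,S,R,\varphi,\varphi_1,p)$ be the frame with $\varphi_1=p^{-1}\varphi$ on $\mathrm{Fil}\,S$ (the ring $S$ has no $p$-torsion). Assume that $c=\varphi_1(E)$ is a unit of $S$. Then the natural map $\mathfrak S\to S$ together with $c$ is a homomorphism of frames $\lambda:\underline{\mathfrak S}\to\underline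 S$. For $n\ge1$ let $\lambda_n:\underline{\mathfrak S}_n\to\underline S_n$ be its reduction modulo $p^n$, obtained by applying $-\otimes\mathbf Z/p^n\mathbf Z$ to all components of the frames. **Proposition.** If $p\ge3$, then the homomorphisms of frames $\lambda$ and $\lambda_n$ for all $n\ge1$ are crystalline. -/

import Mathlib

universe u

set_option linter.unusedSectionVars false

open CategoryTheory TensorProduct

namespace WindowTheory

/-- A frame with underlying ring `S`.  The quotient ring of the frame is `S ⧸ Fil`. -/
structure Frame (p : ℕ) (S : Type u) [CommRing S] where
  /-- the ideal `Fil¹ S` -/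
  Fil : Ideal S
  /-- the Frobenius lift -/
  φ : S →+* S
  φ_frob : ∀ x : S, φ x - x ^ p ∈ Ideal.span {(p : S)}
  /-- the divided Frobenius, a `φ`-linear map on `Fil¹ S` -/
  φ₁ : Fil →ₛₗ[φ] S
  ϖ : S
  φ_eq : ∀ x : Fil, φ x = ϖ * φ₁ x
  le_jacobson : Fil ⊔ Ideal.span {(p : S)} ≤ (⊥ : Ideal S).jacobson

/-- A window over the frame `F`. -/
structure Window {p : ℕ} {S : Type u} [CommRing S] (F : Frame p S) where
  M : Type u
  [addCommGroup : AddCommGroup M]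
  [module : Module S M]
  [finite : Module.Finite S M]
  [projective : Module.Projective S M]
  Fil : Submodule S M
  Φ : M →ₛₗ[F.φ] M
  Φ₁ : Fil →ₛₗ[F.φ] M
  /-- existence of a normal decomposition -/
  normal : ∃ L N : Submodule S M, IsCompl L N ∧ Fil = L ⊔ F.Fil • N
  Φ₁_smul : ∀ (s : F.Fil) (m : M) (h : (s : S) • m ∈ Fil), Φ₁ ⟨(s : S) • m, h⟩ = F.φ₁ s • Φ m
  Φ_eq : ∀ m : Fil, Φ m = F.ϖ • Φ₁ m
  span_eq_top : Submodule.span S (Set.range Φ₁ ∪ Set.range Φ) = ⊤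

attribute [instance] Window.addCommGroup Window.module Window.finite Window.projective

namespace Window

variable {p : ℕ} {S : Type u} [CommRing S] {F : Frame p S}

/-- Homomorphisms of windows over a fixed frame. -/
@[ext]
structure Hom (A B : Window F) where
  toLinearMap : A.M →ₗ[S] B.M
  map_fil : ∀ x ∈ A.Fil, toLinearMap x ∈ B.Fil
  map_Φ : ∀ x, toLinearMap (A.Φ x) = B.Φ (toLinearMap x)
  map_Φ₁ : ∀ x : A.Fil, toLinearMap (A.Φ₁ x) = B.Φ₁ ⟨toLinearMap x, map_fil x x.2⟩

/-- The category of windows over `F`. -/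
instance : Category (Window F) where
  Hom A B := Hom A B
  id A := ⟨LinearMap.id, fun _ h => h, fun _ => rfl, fun _ => rfl⟩
  comp f g := ⟨g.toLinearMap ∘ₗ f.toLinearMap, fun x h => g.map_fil _ (f.map_fil x h),
    fun x => by simp [f.map_Φ, g.map_Φ], fun x => by simp [f.map_Φ₁, g.map_Φ₁]⟩

@[ext]
theorem hom_ext {A B : Window F} (f g : A ⟶ B) (h : f.toLinearMap = g.toLinearMap) : f = g :=
  Hom.ext h

theorem smul_top_le (A : Window F) : F.Fil • (⊤ : Submodule S A.M) ≤ A.Fil := by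
  obtain ⟨L, N, hc, hF⟩ := A.normal
  rw [Submodule.smul_le]
  intro a ha m _
  have hm : m ∈ L ⊔ N := hc.sup_eq_top ▸ Submodule.mem_top
  obtain ⟨l, hl, n, hn, rfl⟩ := Submodule.mem_sup.1 hm
  rw [hF, smul_add]
  exact add_mem (Submodule.mem_sup_left (L.smul_mem _ hl))
    (Submodule.mem_sup_right (Submodule.smul_mem_smul ha hn))

end Window

/-- A homomorphism of frames; the unit `c` is part of the data. -/
structure FrameHom {p : ℕ} {S S' : Type u} [CommRing S] [CommRing S']
    (F : Frame p S) (F' : Frame p S') where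
  toRingHom : S →+* S'
  map_φ : ∀ x, F'.φ (toRingHom x) = toRingHom (F.φ x)
  map_fil : ∀ x ∈ F.Fil, toRingHom x ∈ F'.Fil
  c : S'ˣ
  map_φ₁ : ∀ x : F.Fil, F'.φ₁ ⟨toRingHom x, map_fil x x.2⟩ = c * toRingHom (F.φ₁ x)
  map_ϖ : toRingHom F.ϖ = c * F'.ϖ

section SemilinearExtension

variable {S S' : Type u} [CommRing S] [CommRing S'] [Algebra S S'] {σ : S →+* S} {σ' : S' →+* S'}
  (hσ : ∀ x, σ' (algebraMap S S' x) = algebraMap S S' (σ x))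
  {M N : Type u} [AddCommGroup M] [Module S M] [AddCommGroup N] [Module S N]

/-- The semilinear extension `s' ⊗ m ↦ σ' s' ⊗ G m` of a `σ`-linear map `G`. -/
noncomputable def semilinearExt (G : M →ₛₗ[σ] N) : S' ⊗[S] M →ₛₗ[σ'] S' ⊗[S] N where
  toFun := TensorProduct.liftAddHom
    (AddMonoidHom.mk' (fun s' : S' => AddMonoidHom.mk' (fun m : M => σ' s' ⊗ₜ[S] G m)
      (fun a b => by rw [map_add, tmul_add]))
      (fun a b => by ext m; simp [add_tmul]))
    (fun r s' m => by
      simp only [AddMonoidHom.mk'_apply, map_smulₛₗ, tmul_smul]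
      rw [Algebra.smul_def, map_mul, hσ, ← Algebra.smul_def, smul_tmul'])
  map_add' x y := map_add _ x y
  map_smul' r x := by
    induction x with
    | zero => simp
    | add x y hx hy => simp only [smul_add, map_add, hx, hy]
    | tmul s m => simp [smul_tmul']

@[simp]
theorem semilinearExt_tmul (G : M →ₛₗ[σ] N) (s' : S') (m : M) :
    semilinearExt hσ G (s' ⊗ₜ[S] m) = σ' s' ⊗ₜ[S] G m := rfl

theorem semilinear_ext_one_tmul {P : Type u} [AddCommGroup P] [Module S' P]
    {f g : S' ⊗[S] M →ₛₗ[σ'] P} (h : ∀ m, f (1 ⊗ₜ m) = g (1 ⊗ₜ m)) (x : S' ⊗[S] M) :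
    f x = g x := by
  induction x with
  | zero => simp
  | add x y hx hy => simp only [map_add, hx, hy]
  | tmul s m =>
    have : s ⊗ₜ[S] m = s • ((1 : S') ⊗ₜ[S] m) := by rw [smul_tmul', smul_eq_mul, mul_one]
    rw [this, map_smulₛₗ, map_smulₛₗ, h]

end SemilinearExtension

namespace FrameHom

variable {p : ℕ} {S S' : Type u} [CommRing S] [CommRing S'] {F : Frame p S} {F' : Frame p S'}

theorem map_φ' [Algebra S S'] (α : FrameHom F F') (hα : α.toRingHom = algebraMap S S') (x : S) :
    F'.φ (algebraMap S S' x) = algebraMap S S' (F.φ x) := by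
  rw [← hα]; exact α.map_φ x

variable [Algebra S S'] (α : FrameHom F F') (hα : α.toRingHom = algebraMap S S') (A : Window F)

variable (F') in
/-- The submodule of `S' ⊗ M` generated by `(Fil¹ S') (S' ⊗ M)` and the image of `Fil¹ M`. -/
def bcFil : Submodule S' (S' ⊗[S] A.M) :=
  Submodule.span S' ({y | ∃ a ∈ F'.Fil, ∃ m : S' ⊗[S] A.M, a • m = y} ∪
    {y | ∃ x ∈ A.Fil, (1 : S') ⊗ₜ[S] x = y})

theorem one_tmul_mem_bcFil {x : A.M} (hx : x ∈ A.Fil) : (1 : S') ⊗ₜ[S] x ∈ bcFil F' A :=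
  Submodule.subset_span (Or.inr ⟨x, hx, rfl⟩)

theorem smul_mem_bcFil {a : S'} (ha : a ∈ F'.Fil) (m : S' ⊗[S] A.M) : a • m ∈ bcFil F' A :=
  Submodule.subset_span (Or.inl ⟨a, ha, m, rfl⟩)

/-- The map `Φ'` of the base change: `s' ⊗ m ↦ φ' s' ⊗ Φ m`. -/
noncomputable def bcΦ : S' ⊗[S] A.M →ₛₗ[F'.φ] S' ⊗[S] A.M :=
  semilinearExt (map_φ' α hα) A.Φ

theorem exists_bcΦ₁ : ∃ Ψ : bcFil F' A →ₛₗ[F'.φ] S' ⊗[S] A.M,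
    (∀ (a : F'.Fil) (m : S' ⊗[S] A.M),
      Ψ ⟨(a : S') • m, smul_mem_bcFil A a.2 m⟩ = F'.φ₁ a • bcΦ α hα A m) ∧
    (∀ x : A.Fil, Ψ ⟨1 ⊗ₜ (x : A.M), one_tmul_mem_bcFil A x.2⟩ = (α.c : S') ⊗ₜ[S] A.Φ₁ x) := by
  obtain ⟨L, N, hc, hF⟩ := A.normal
  obtain ⟨n, f, g, -, -, hfg⟩ := Module.Finite.exists_comp_eq_id_of_projective S A.M
  have hL : ∀ m, L.projection N hc m ∈ A.Fil := fun m =>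
    hF ▸ Submodule.mem_sup_left (Submodule.projection_apply_mem hc m)
  let πN : A.M →ₗ[S] A.M := N.projection L hc.symm
  have hsum : ∀ m, L.projection N hc m + πN m = m := fun m =>
    Submodule.projection_add_projection_eq_self hc m
  let G : A.M →ₛₗ[F.φ] A.M := A.Φ₁.comp ((L.projection N hc).codRestrict A.Fil hL)
  let G' : S' ⊗[S] A.M →ₛₗ[F'.φ] S' ⊗[S] A.M := (α.c : S') • semilinearExt (map_φ' α hα) G
  let e : Fin n → A.M := fun i => f (Pi.single i 1)
  let ℓ : Fin n → (A.M →ₗ[S] S) := fun i => LinearMap.proj i ∘ₗ g ∘ₗ πN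
  have hℓ : ∀ m, ∑ i, ℓ i m • e i = πN m := by
    intro m
    have h1 : f (g (πN m)) = πN m := congrArg (fun h : A.M →ₗ[S] A.M => h (πN m)) hfg
    have h2 : g (πN m) = ∑ i, g (πN m) i • (Pi.single i (1 : S) : Fin n → S) := by
      ext j; simp [Finset.sum_apply, Pi.single_apply]
    rw [h2, map_sum] at h1
    simpa [ℓ, e] using h1
  have hℓF : ∀ i, ∀ x ∈ A.Fil, ℓ i x ∈ F.Fil := by
    intro i x hx
    rw [hF] at hx
    obtain ⟨l, hl, y, hy, rfl⟩ := Submodule.mem_sup.1 hx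
    have h0 : πN l = 0 := (Submodule.projection_apply_eq_zero_iff hc.symm).2 hl
    have : ℓ i (l + y) = ℓ i y := by simp [ℓ, h0]
    rw [this]
    have hle : F.Fil • N ≤ Submodule.comap (ℓ i) F.Fil := Submodule.smul_le.2 fun r hr n _ => by
      rw [Submodule.mem_comap, map_smul]; exact Ideal.mul_mem_right _ _ hr
    exact hle hy
  let ℓ' : Fin n → (S' ⊗[S] A.M →ₗ[S'] S') := fun i =>
    (Algebra.linearMap S S' ∘ₗ ℓ i).liftBaseChange S'
  have hℓ' : ∀ i (m : A.M), ℓ' i (1 ⊗ₜ m) = algebraMap S S' (ℓ i m) := by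
    intro i m; simp [ℓ']
  have hℓ'F : ∀ i, ∀ x ∈ bcFil F' A, ℓ' i x ∈ F'.Fil := by
    intro i x hx
    have : bcFil F' A ≤ Submodule.comap (ℓ' i) F'.Fil := by
      refine Submodule.span_le.2 ?_
      rintro y (⟨a, ha, m, rfl⟩ | ⟨x, hx, rfl⟩)
      · simp only [Submodule.comap_coe, Set.mem_preimage, map_smul]
        exact Ideal.mul_mem_right _ _ ha
      · simp only [Submodule.comap_coe, Set.mem_preimage, hℓ']
        rw [← hα]
        exact α.map_fil _ (hℓF i x hx)
    exact this hx
  let T : Fin n → (bcFil F' A →ₛₗ[F'.φ] S' ⊗[S] A.M) := fun i =>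
    (LinearMap.toSpanSingleton S' _ ((1 : S') ⊗ₜ[S] A.Φ (e i))).comp
      (F'.φ₁.comp ((ℓ' i).restrict (hℓ'F i)))
  have hT : ∀ i x, T i x = F'.φ₁ ⟨ℓ' i x, hℓ'F i x x.2⟩ • ((1 : S') ⊗ₜ[S] A.Φ (e i)) :=
    fun i x => rfl
  refine ⟨G'.comp (bcFil F' A).subtype + ∑ i, T i, fun a m => ?_, fun x => ?_⟩
  · have key : ∀ m' : S' ⊗[S] A.M, (F'.ϖ • G' + (bcΦ α hα A).comp
        (∑ i, (ℓ' i).smulRight ((1 : S') ⊗ₜ[S] e i))) m' = bcΦ α hα A m' := by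
      refine semilinear_ext_one_tmul fun m => ?_
      have h1 : (∑ i, (ℓ' i).smulRight ((1 : S') ⊗ₜ[S] e i)) ((1 : S') ⊗ₜ[S] m) =
          (1 : S') ⊗ₜ[S] πN m := by
        rw [← hℓ m, tmul_sum, LinearMap.sum_apply]
        refine Finset.sum_congr rfl fun i _ => ?_
        rw [LinearMap.smulRight_apply, hℓ', tmul_smul, algebraMap_smul]
      have h2 : F'.ϖ • G' ((1 : S') ⊗ₜ[S] m) = (1 : S') ⊗ₜ[S] A.Φ (L.projection N hc m) := by
        have h3 : A.Φ (L.projection N hc m) = F.ϖ • G m := A.Φ_eq ⟨_, hL m⟩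
        have h4 : algebraMap S S' F.ϖ = α.c * F'.ϖ := by rw [← hα]; exact α.map_ϖ
        rw [h3, tmul_smul, ← algebraMap_smul S' F.ϖ, h4]
        simp [G', smul_tmul', mul_comm]
      rw [LinearMap.add_apply, LinearMap.smul_apply, h2, LinearMap.comp_apply, h1]
      simp only [bcΦ, semilinearExt_tmul, map_one]
      rw [← tmul_add, ← map_add, hsum]
    rw [← key m, LinearMap.add_apply, LinearMap.sum_apply]
    simp only [LinearMap.add_apply, LinearMap.smul_apply, LinearMap.comp_apply,
      LinearMap.sum_apply, map_sum, smul_add, Finset.smul_sum, Submodule.subtype_apply, hT,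
      LinearMap.smulRight_apply, map_smulₛₗ]
    congr 1
    · rw [F'.φ_eq a, smul_smul, mul_comm]
    · refine Finset.sum_congr rfl fun i _ => ?_
      have h5 : F'.φ₁ ⟨(RingHom.id S') (a : S') • ℓ' i m, Ideal.mul_mem_right _ _ a.2⟩ =
          F'.φ (ℓ' i m) * F'.φ₁ a := by
        rw [← smul_eq_mul (F'.φ _), ← map_smulₛₗ F'.φ₁]
        refine congrArg F'.φ₁ (Subtype.ext ?_)
        simp [mul_comm]
      refine (congrArg (· • ((1 : S') ⊗ₜ[S] A.Φ (e i))) h5).trans ?_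
      simp only [bcΦ, semilinearExt_tmul, map_one, smul_smul, mul_comm]
  · rw [LinearMap.add_apply, LinearMap.sum_apply]
    have h1 : ∀ i, T i ⟨1 ⊗ₜ (x : A.M), one_tmul_mem_bcFil A x.2⟩ =
        (α.c : S') ⊗ₜ[S] A.Φ₁ ⟨ℓ i x • e i, A.smul_top_le
          (Submodule.smul_mem_smul (hℓF i x x.2) Submodule.mem_top)⟩ := by
      intro i
      rw [hT, A.Φ₁_smul ⟨ℓ i x, hℓF i x x.2⟩, tmul_smul, ← algebraMap_smul S' (F.φ₁ _), ← hα]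
      have h5 : F'.φ₁ ⟨ℓ' i ((1 : S') ⊗ₜ[S] (x : A.M)), hℓ'F i _ (one_tmul_mem_bcFil A x.2)⟩ =
          α.c * α.toRingHom (F.φ₁ ⟨ℓ i x, hℓF i x x.2⟩) := by
        rw [← α.map_φ₁]
        refine congrArg F'.φ₁ (Subtype.ext ?_)
        simp only [hℓ', hα]
      refine (congrArg (· • ((1 : S') ⊗ₜ[S] A.Φ (e i))) h5).trans ?_
      rw [smul_tmul', smul_tmul', smul_eq_mul, smul_eq_mul, mul_one, mul_comm]
    have h2 : (G'.comp (bcFil F' A).subtype) ⟨1 ⊗ₜ (x : A.M), one_tmul_mem_bcFil A x.2⟩ =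
        (α.c : S') ⊗ₜ[S] A.Φ₁ ⟨L.projection N hc x, hL x⟩ := by
      simp [G', G, smul_tmul', LinearMap.codRestrict]
    rw [h2, Finset.sum_congr rfl fun i _ => h1 i, ← tmul_sum, ← tmul_add, ← map_sum, ← map_add]
    congr 2
    ext
    simp [hℓ, hsum]

/-- The map `Φ₁'` of the base change. -/
noncomputable def bcΦ₁ : bcFil F' A →ₛₗ[F'.φ] S' ⊗[S] A.M := (exists_bcΦ₁ α hα A).choose

theorem bcΦ₁_smul (a : F'.Fil) (m : S' ⊗[S] A.M) (h : (a : S') • m ∈ bcFil F' A) :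
    bcΦ₁ α hα A ⟨(a : S') • m, h⟩ = F'.φ₁ a • bcΦ α hα A m :=
  (exists_bcΦ₁ α hα A).choose_spec.1 a m

theorem bcΦ₁_one_tmul (x : A.Fil) (h : (1 : S') ⊗ₜ[S] (x : A.M) ∈ bcFil F' A) :
    bcΦ₁ α hα A ⟨1 ⊗ₜ (x : A.M), h⟩ = (α.c : S') ⊗ₜ[S] A.Φ₁ x :=
  (exists_bcΦ₁ α hα A).choose_spec.2 x

theorem bcFil_hom_ext {A : Window F} {P : Type u} [AddCommGroup P] [Module S' P]
    {f g : bcFil F' A →ₛₗ[F'.φ] P}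
    (h1 : ∀ (a : F'.Fil) (m : S' ⊗[S] A.M) (h : (a : S') • m ∈ bcFil F' A),
      f ⟨(a : S') • m, h⟩ = g ⟨(a : S') • m, h⟩)
    (h2 : ∀ (x : A.Fil) (h : (1 : S') ⊗ₜ[S] (x : A.M) ∈ bcFil F' A), f ⟨_, h⟩ = g ⟨_, h⟩)
    (x : bcFil F' A) : f x = g x := by
  have key : ∀ y (hy : y ∈ bcFil F' A), ∀ h : y ∈ bcFil F' A, f ⟨y, h⟩ = g ⟨y, h⟩ := by
    intro y hy
    refine Submodule.span_induction (p := fun y _ =>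
      ∀ h : y ∈ bcFil F' A, f ⟨y, h⟩ = g ⟨y, h⟩) ?_ ?_ ?_ ?_ hy
    · rintro y (⟨a, ha, m, rfl⟩ | ⟨x, hx, rfl⟩) h
      · exact h1 ⟨a, ha⟩ m h
      · exact h2 ⟨x, hx⟩ h
    · exact fun h => (map_zero f).trans (map_zero g).symm
    · intro x y hx hy ihx ihy h
      have hx' : x ∈ bcFil F' A := hx
      have hy' : y ∈ bcFil F' A := hy
      have e : (⟨x + y, h⟩ : bcFil F' A) = ⟨x, hx'⟩ + ⟨y, hy'⟩ := rfl
      rw [e, map_add, map_add, ihx, ihy]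
    · intro s x hx ih h
      have hx' : x ∈ bcFil F' A := hx
      have e : (⟨s • x, h⟩ : bcFil F' A) = s • ⟨x, hx'⟩ := rfl
      rw [e, map_smulₛₗ, map_smulₛₗ, ih]
  exact key x x.2 x.2

theorem bc_normal (α : FrameHom F F') (hα : α.toRingHom = algebraMap S S') (A : Window F) : ∃ L N : Submodule S' (S' ⊗[S] A.M),
    IsCompl L N ∧ bcFil F' A = L ⊔ F'.Fil • N := by
  obtain ⟨L, N, hc, hF⟩ := A.normal
  let P : S' ⊗[S] A.M →ₗ[S'] S' ⊗[S] A.M := (L.projection N hc).baseChange S'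
  let Q : S' ⊗[S] A.M →ₗ[S'] S' ⊗[S] A.M := (N.projection L hc.symm).baseChange S'
  have hPQ : ∀ x, P x + Q x = x := by
    intro x
    have := congrArg (fun f : A.M →ₗ[S] A.M => f.baseChange S' x)
      (Submodule.projection_add_projection_eq_id hc)
    simpa [P, Q, LinearMap.baseChange_add] using this
  have hPP : ∀ x, P (P x) = P x := by
    intro x
    have := congrArg (fun f : A.M →ₗ[S] A.M => f.baseChange S' x)
      (Submodule.isIdempotentElem_projection hc).eq
    simpa [P, Module.End.mul_eq_comp, LinearMap.baseChange_comp] using this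
  refine ⟨LinearMap.range P, LinearMap.range Q, ?_, ?_⟩
  · rw [isCompl_iff, Submodule.disjoint_def, codisjoint_iff]
    constructor
    · rintro x ⟨y, rfl⟩ ⟨z, hz⟩
      have h1 := hPQ z
      have h2 : P (Q z) = 0 := by
        have := congrArg P h1
        rw [map_add, hPP] at this
        simpa using this
      rw [hz, hPP] at h2
      exact h2
    · rw [eq_top_iff]
      intro x _
      rw [← hPQ x]
      exact add_mem (Submodule.mem_sup_left ⟨x, rfl⟩) (Submodule.mem_sup_right ⟨x, rfl⟩)
  · apply le_antisymm
    · refine Submodule.span_le.2 ?_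
      rintro y (⟨a, ha, m, rfl⟩ | ⟨x, hx, rfl⟩)
      · rw [← hPQ m, smul_add]
        exact add_mem (Submodule.mem_sup_left (Submodule.smul_mem _ _ ⟨m, rfl⟩))
          (Submodule.mem_sup_right (Submodule.smul_mem_smul ha ⟨m, rfl⟩))
      · rw [hF] at hx
        obtain ⟨l, hl, y, hy, rfl⟩ := Submodule.mem_sup.1 hx
        rw [tmul_add]
        refine add_mem (Submodule.mem_sup_left ⟨1 ⊗ₜ l, ?_⟩) (Submodule.mem_sup_right ?_)
        · simp [P, Submodule.projection_apply_of_mem_left hc hl]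
        · have hle : F.Fil • N ≤ Submodule.comap (TensorProduct.mk S S' A.M 1)
              ((F'.Fil • LinearMap.range Q).restrictScalars S) := by
            refine Submodule.smul_le.2 fun r hr n hn => ?_
            have h1 : (1 : S') ⊗ₜ[S] (r • n) = algebraMap S S' r • ((1 : S') ⊗ₜ[S] n) := by
              rw [tmul_smul, algebraMap_smul]
            simp only [Submodule.mem_comap, TensorProduct.mk_apply,
              Submodule.restrictScalars_mem, h1]
            refine Submodule.smul_mem_smul (hα ▸ α.map_fil r hr) ⟨1 ⊗ₜ n, ?_⟩
            simp [Q, Submodule.projection_apply_of_mem_left hc.symm hn]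
          exact hle hy
    · refine sup_le ?_ (Submodule.smul_le.2 fun a ha m _ => smul_mem_bcFil A ha m)
      rintro _ ⟨x, rfl⟩
      induction x with
      | zero => simp
      | add x y hx hy => rw [map_add]; exact add_mem hx hy
      | tmul s m =>
        have : P (s ⊗ₜ[S] m) = s • ((1 : S') ⊗ₜ[S] (L.projection N hc m)) := by
          simp [P, smul_tmul']
        rw [this]
        exact Submodule.smul_mem _ _ (one_tmul_mem_bcFil A
          (hF ▸ Submodule.mem_sup_left (Submodule.projection_apply_mem hc m)))

/-- The base change of a window. -/
noncomputable def bcObj : Window F' where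
  M := S' ⊗[S] A.M
  Fil := bcFil F' A
  Φ := bcΦ α hα A
  Φ₁ := bcΦ₁ α hα A
  normal := bc_normal α hα A
  Φ₁_smul s m h := bcΦ₁_smul α hα A s m h
  Φ_eq x := by
    refine bcFil_hom_ext (f := (bcΦ α hα A).comp (bcFil F' A).subtype)
      (g := F'.ϖ • bcΦ₁ α hα A) (fun a m h => ?_) (fun x h => ?_) x
    · rw [LinearMap.smul_apply, bcΦ₁_smul, smul_smul, ← F'.φ_eq]
      exact map_smulₛₗ (bcΦ α hα A) (a : S') m
    · have h4 : algebraMap S S' F.ϖ = α.c * F'.ϖ := by rw [← hα]; exact α.map_ϖ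
      rw [LinearMap.smul_apply, bcΦ₁_one_tmul]
      simp only [LinearMap.comp_apply, Submodule.subtype_apply, bcΦ, semilinearExt_tmul, map_one,
        A.Φ_eq x, tmul_smul]
      rw [← algebraMap_smul S' F.ϖ, h4, smul_tmul', smul_tmul', smul_eq_mul, smul_eq_mul,
        mul_one, mul_comm]
  span_eq_top := by
    set U := Submodule.span S' (Set.range (bcΦ₁ α hα A) ∪ Set.range (bcΦ α hα A))
    have h1 : ∀ m : A.M, (1 : S') ⊗ₜ[S] m ∈ U := by
      have hle : (⊤ : Submodule S A.M) ≤
          Submodule.comap (TensorProduct.mk S S' A.M 1) (U.restrictScalars S) := by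
        rw [← A.span_eq_top]
        refine Submodule.span_le.2 ?_
        rintro _ (⟨x, rfl⟩ | ⟨x, rfl⟩)
        · have h2 : (1 : S') ⊗ₜ[S] A.Φ₁ x = (↑α.c⁻¹ : S') •
              bcΦ₁ α hα A ⟨1 ⊗ₜ (x : A.M), one_tmul_mem_bcFil A x.2⟩ := by
            rw [bcΦ₁_one_tmul, smul_tmul', smul_eq_mul, Units.inv_mul]
          simp only [Submodule.comap_coe, Set.mem_preimage, TensorProduct.mk_apply,
            SetLike.mem_coe, Submodule.restrictScalars_mem, h2]
          exact U.smul_mem _ (Submodule.subset_span (Or.inl ⟨_, rfl⟩))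
        · refine Submodule.subset_span (Or.inr ⟨1 ⊗ₜ x, ?_⟩)
          simp [bcΦ]
      exact fun m => hle Submodule.mem_top
    rw [eq_top_iff]
    intro x _
    induction x with
    | zero => exact zero_mem _
    | add x y hx hy => exact add_mem (hx trivial) (hy trivial)
    | tmul s m =>
      have : s ⊗ₜ[S] m = s • ((1 : S') ⊗ₜ[S] m) := by rw [smul_tmul', smul_eq_mul, mul_one]
      rw [this]
      exact U.smul_mem _ (h1 m)

theorem bc_map_fil {A B : Window F} (f : A ⟶ B) (x : S' ⊗[S] A.M) (hx : x ∈ bcFil F' A) :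
    f.toLinearMap.baseChange S' x ∈ bcFil F' B := by
  have hle : bcFil F' A ≤ (bcFil F' B).comap (f.toLinearMap.baseChange S') := by
    refine Submodule.span_le.2 ?_
    rintro y (⟨a, ha, m, rfl⟩ | ⟨x, hx, rfl⟩)
    · simp only [Submodule.comap_coe, Set.mem_preimage, map_smul]
      exact smul_mem_bcFil B ha _
    · exact one_tmul_mem_bcFil B (f.map_fil x hx)
  exact hle hx

theorem bc_map_Φ {A B : Window F} (f : A ⟶ B) (x : S' ⊗[S] A.M) :
    f.toLinearMap.baseChange S' (bcΦ α hα A x) = bcΦ α hα B (f.toLinearMap.baseChange S' x) := by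
  induction x with
  | zero => simp
  | add x y hx hy => simp only [map_add, hx, hy]
  | tmul s m => simp [bcΦ, f.map_Φ]

/-- The base change of a homomorphism of windows: `s' ⊗ m ↦ s' ⊗ f m`. -/
noncomputable def bcMap {A B : Window F} (f : A ⟶ B) : bcObj α hα A ⟶ bcObj α hα B where
  toLinearMap := f.toLinearMap.baseChange S'
  map_fil := bc_map_fil f
  map_Φ := bc_map_Φ α hα f
  map_Φ₁ x := by
    refine bcFil_hom_ext (f := (f.toLinearMap.baseChange S').comp (bcΦ₁ α hα A))
      (g := (bcΦ₁ α hα B).comp ((f.toLinearMap.baseChange S').restrict (bc_map_fil f)))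
      (fun a m h => ?_) (fun x h => ?_) x
    · have e : (f.toLinearMap.baseChange S').restrict (bc_map_fil f) ⟨(a : S') • m, h⟩ =
          ⟨(a : S') • f.toLinearMap.baseChange S' m, smul_mem_bcFil B a.2 _⟩ :=
        Subtype.ext (map_smul (f.toLinearMap.baseChange S') (a : S') m)
      rw [LinearMap.comp_apply, LinearMap.comp_apply, e, bcΦ₁_smul, bcΦ₁_smul, map_smul, bc_map_Φ]
    · have e : (f.toLinearMap.baseChange S').restrict (bc_map_fil f) ⟨(1 : S') ⊗ₜ[S] (x : A.M), h⟩ =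
          ⟨(1 : S') ⊗ₜ[S] f.toLinearMap x, one_tmul_mem_bcFil B (f.map_fil x x.2)⟩ :=
        Subtype.ext (LinearMap.baseChange_tmul ..)
      rw [LinearMap.comp_apply, LinearMap.comp_apply, e, bcΦ₁_one_tmul,
        bcΦ₁_one_tmul α hα B ⟨f.toLinearMap x, f.map_fil x x.2⟩, LinearMap.baseChange_tmul,
        f.map_Φ₁]

/-- The base change functor along a homomorphism of frames whose underlying ring homomorphism
is the structure map of an algebra. -/
noncomputable def baseChangeAux : Window F ⥤ Window F' where
  obj A := bcObj α hα A
  map f := bcMap α hα f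
  map_id _ := Window.hom_ext _ _ (LinearMap.baseChange_id)
  map_comp _ _ := Window.hom_ext _ _ (LinearMap.baseChange_comp ..)

end FrameHom

section

variable {p : ℕ} {S S' : Type u} [CommRing S] [CommRing S'] {F : Frame p S} {F' : Frame p S'}

/-- The base change functor `α^* : Win(F) → Win(F')` of a homomorphism of frames. It sends
`(M, Fil M, Φ, Φ₁)` to `(S' ⊗ M, Fil', Φ', Φ₁')` where `Fil'` is generated by
`(Fil S') (S' ⊗ M)` and the image of `Fil M`, and where `Φ'`, `Φ₁'` are the unique semilinear maps
such that `Φ' (1 ⊗ m) = 1 ⊗ Φ m`, `Φ₁' (1 ⊗ x) = c ⊗ Φ₁ x` and `Φ₁' (a m) = φ₁' a • Φ' m`. -/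
noncomputable def FrameHom.baseChange (α : FrameHom F F') : Window F ⥤ Window F' :=
  letI : Algebra S S' := α.toRingHom.toAlgebra
  FrameHom.baseChangeAux α rfl

/-- A homomorphism of frames is crystalline if base change is an equivalence of categories. -/
def FrameHom.IsCrystalline (α : FrameHom F F') : Prop := α.baseChange.IsEquivalence

end

section Reduction

variable {p : ℕ} {S S' : Type u} [CommRing S] [CommRing S']

theorem mem_of_pow_mul_mem {I : Ideal S} (h : ∀ x : S, (p : S) * x ∈ I → x ∈ I) (n : ℕ) (x : S)
    (hx : (p : S) ^ n * x ∈ I) : x ∈ I := by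
  induction n with
  | zero => simpa using hx
  | succ n ih => exact ih (h _ (by rwa [← mul_assoc, ← pow_succ']))

theorem mk_jacobson {I K : Ideal S} (h : K ≤ (⊥ : Ideal S).jacobson) :
    K.map (Ideal.Quotient.mk I) ≤ (⊥ : Ideal (S ⧸ I)).jacobson := by
  refine Ideal.map_le_iff_le_comap.2 fun x hx => ?_
  rw [Ideal.mem_comap, Ideal.mem_jacobson_bot]
  intro y
  obtain ⟨y, rfl⟩ := Ideal.Quotient.mk_surjective y
  simpa using (Ideal.mem_jacobson_bot.1 (h hx) y).map (Ideal.Quotient.mk I)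

theorem Frame.exists_lift_fil (F : Frame p S) (I : Ideal S) (z : F.Fil.map (Ideal.Quotient.mk I)) :
    ∃ x : F.Fil, Ideal.Quotient.mk I x = z := by
  obtain ⟨x, hx, h⟩ := (Ideal.mem_map_iff_of_surjective _ Ideal.Quotient.mk_surjective).1 z.2
  exact ⟨⟨x, hx⟩, h⟩

theorem Frame.mk_φ₁_eq (F : Frame p S) (htf : ∀ x : S, (p : S) * x ∈ F.Fil → x ∈ F.Fil) (n : ℕ)
    (x y : F.Fil) (h : Ideal.Quotient.mk (Ideal.span {(p : S) ^ n}) (x : S) =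
      Ideal.Quotient.mk (Ideal.span {(p : S) ^ n}) (y : S)) :
    Ideal.Quotient.mk (Ideal.span {(p : S) ^ n}) (F.φ₁ x) =
      Ideal.Quotient.mk (Ideal.span {(p : S) ^ n}) (F.φ₁ y) := by
  rw [Ideal.Quotient.eq, Ideal.mem_span_singleton] at h ⊢
  obtain ⟨z, hz⟩ := h
  have hzF : z ∈ F.Fil := mem_of_pow_mul_mem htf n z (hz ▸ sub_mem x.2 y.2)
  have e : x - y = ((p : S) ^ n) • (⟨z, hzF⟩ : F.Fil) := Subtype.ext hz
  refine ⟨F.φ₁ ⟨z, hzF⟩, ?_⟩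
  rw [← map_sub, e, map_smulₛₗ, map_pow, map_natCast, smul_eq_mul]

/-- The reduction `F ⊗ ℤ/pⁿ` of a frame whose quotient ring `S ⧸ Fil` has no `p`-torsion. Then
`Fil ⊗ ℤ/pⁿ` is the image of `Fil` in `S ⧸ pⁿ S`, and `φ`, `φ₁`, `ϖ` are induced by those
of `F`. -/
noncomputable def Frame.mod (F : Frame p S) (htf : ∀ x : S, (p : S) * x ∈ F.Fil → x ∈ F.Fil)
    (n : ℕ) : Frame p (S ⧸ Ideal.span {(p : S) ^ n}) where
  Fil := F.Fil.map (Ideal.Quotient.mk _)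
  φ := Ideal.quotientMap _ F.φ (by
    rw [Ideal.span_le, Set.singleton_subset_iff, SetLike.mem_coe, Ideal.mem_comap, map_pow,
      map_natCast]
    exact Ideal.mem_span_singleton_self _)
  φ_frob x := by
    obtain ⟨x, rfl⟩ := Ideal.Quotient.mk_surjective x
    rw [Ideal.quotientMap_mk, ← map_pow, ← map_sub]
    obtain ⟨y, hy⟩ := Ideal.mem_span_singleton.1 (F.φ_frob x)
    rw [hy, map_mul, map_natCast]
    exact Ideal.mul_mem_right _ _ (Ideal.mem_span_singleton_self _)
  φ₁ :=
    { toFun := fun z => Ideal.Quotient.mk _ (F.φ₁ (F.exists_lift_fil _ z).choose)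
      map_add' := fun z w => by
        rw [← map_add, ← map_add]
        refine F.mk_φ₁_eq htf n _ _ ((F.exists_lift_fil _ _).choose_spec.trans ?_)
        simp only [Submodule.coe_add, map_add, (F.exists_lift_fil _ _).choose_spec]
      map_smul' := fun r z => by
        obtain ⟨r, rfl⟩ := Ideal.Quotient.mk_surjective r
        rw [Ideal.quotientMap_mk, smul_eq_mul, ← map_mul, ← smul_eq_mul, ← map_smulₛₗ]
        refine F.mk_φ₁_eq htf n _ _ ((F.exists_lift_fil _ _).choose_spec.trans ?_)
        simp only [Submodule.coe_smul, smul_eq_mul, map_mul, (F.exists_lift_fil _ _).choose_spec] }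
  ϖ := Ideal.Quotient.mk _ F.ϖ
  φ_eq z := by
    have h := (F.exists_lift_fil _ z).choose_spec
    conv_lhs => rw [← h]
    rw [Ideal.quotientMap_mk, F.φ_eq, map_mul]
    rfl
  le_jacobson := by
    have := mk_jacobson (I := Ideal.span {(p : S) ^ n}) F.le_jacobson
    rwa [Ideal.map_sup, Ideal.map_span, Set.image_singleton, map_natCast] at this

theorem Frame.mod_φ₁_mk (F : Frame p S) (htf : ∀ x : S, (p : S) * x ∈ F.Fil → x ∈ F.Fil) (n : ℕ)
    (x : F.Fil) (h : Ideal.Quotient.mk _ (x : S) ∈ (F.mod htf n).Fil) :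
    (F.mod htf n).φ₁ ⟨Ideal.Quotient.mk _ (x : S), h⟩ = Ideal.Quotient.mk _ (F.φ₁ x) :=
  F.mk_φ₁_eq htf n _ _ (F.exists_lift_fil _ _).choose_spec

/-- The reduction modulo `pⁿ` of a homomorphism of frames. -/
noncomputable def FrameHom.mod {F : Frame p S} {F' : Frame p S'} (α : FrameHom F F')
    (htf : ∀ x : S, (p : S) * x ∈ F.Fil → x ∈ F.Fil)
    (htf' : ∀ x : S', (p : S') * x ∈ F'.Fil → x ∈ F'.Fil) (n : ℕ) :
    FrameHom (F.mod htf n) (F'.mod htf' n) where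
  toRingHom := Ideal.quotientMap _ α.toRingHom (by
    rw [Ideal.span_le, Set.singleton_subset_iff, SetLike.mem_coe, Ideal.mem_comap, map_pow,
      map_natCast]
    exact Ideal.mem_span_singleton_self _)
  map_φ x := by
    obtain ⟨x, rfl⟩ := Ideal.Quotient.mk_surjective x
    simp only [Frame.mod, Ideal.quotientMap_mk, α.map_φ]
  map_fil z hz := by
    obtain ⟨x, rfl⟩ := F.exists_lift_fil _ ⟨z, hz⟩
    rw [Ideal.quotientMap_mk]
    exact Ideal.mem_map_of_mem _ (α.map_fil x x.2)
  c := Units.map (Ideal.Quotient.mk _).toMonoidHom α.c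
  map_φ₁ z := by
    obtain ⟨z, hz⟩ := z
    obtain ⟨x, hx⟩ := F.exists_lift_fil _ ⟨z, hz⟩
    have hx' : Ideal.Quotient.mk (Ideal.span {(p : S) ^ n}) (x : S) = z := hx
    subst hx'
    rw [F.mod_φ₁_mk htf n x]
    refine (F'.mod_φ₁_mk htf' n ⟨α.toRingHom x, α.map_fil x x.2⟩
      (Ideal.mem_map_of_mem _ (α.map_fil x x.2))).trans ?_
    rw [α.map_φ₁, map_mul]
    rfl
  map_ϖ := by
    simp only [Frame.mod, Ideal.quotientMap_mk, α.map_ϖ, map_mul]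
    rfl

end Reduction

section Completion

variable {p : ℕ} {T B : Type u} [CommRing T] [CommRing B]

theorem factorPow_evalₐ (I : Ideal T) {m n : ℕ} (h : m ≤ n) (x : AdicCompletion I T) :
    Ideal.Quotient.factorPow I h (AdicCompletion.evalₐ I n x) = AdicCompletion.evalₐ I m x := by
  induction x using AdicCompletion.induction_on with
  | h a =>
    rw [AdicCompletion.evalₐ_mk, AdicCompletion.evalₐ_mk]
    exact AdicCompletion.Ideal.mk_eq_mk I h a

variable (p) in
/-- The map from the `p`-adic completion of `T` to `B / pⁿ B` induced by `f : T → B`. -/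
noncomputable def completionLiftMod (f : T →+* B) (n : ℕ) :
    AdicCompletion (Ideal.span {(p : T)}) T →+* B ⧸ Ideal.span {(p : B)} ^ n :=
  (Ideal.quotientMap (I := Ideal.span {(p : T)} ^ n) (Ideal.span {(p : B)} ^ n) f (by
    rw [Ideal.span_singleton_pow, Ideal.span_singleton_pow, Ideal.span_le,
      Set.singleton_subset_iff, SetLike.mem_coe, Ideal.mem_comap, map_pow, map_natCast]
    exact Ideal.mem_span_singleton_self _)).comp
      (AdicCompletion.evalₐ (Ideal.span {(p : T)}) n : _ →+* _)

theorem completionLiftMod_compat (f : T →+* B) {m n : ℕ} (h : m ≤ n) :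
    (Ideal.Quotient.factorPow (Ideal.span {(p : B)}) h).comp (completionLiftMod p f n) =
      completionLiftMod p f m := by
  ext x
  simp only [completionLiftMod, RingHom.comp_apply, RingHom.coe_coe]
  rw [← factorPow_evalₐ _ h x]
  obtain ⟨y, hy⟩ := Ideal.Quotient.mk_surjective (AdicCompletion.evalₐ (Ideal.span {(p : T)}) n x)
  rw [← hy]
  simp

variable (p) in
/-- The extension of a ring homomorphism `f : T → B` to the `p`-adic completion of `T`, if `B`
is `p`-adically complete. -/
noncomputable def completionLift (hB : IsAdicComplete (Ideal.span {(p : B)}) B) (f : T →+* B) :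
    AdicCompletion (Ideal.span {(p : T)}) T →+* B :=
  IsAdicComplete.liftRingHom (Ideal.span {(p : B)}) (completionLiftMod p f)
    (fun h => completionLiftMod_compat f h)

theorem completionLift_algebraMap (hB : IsAdicComplete (Ideal.span {(p : B)}) B) (f : T →+* B)
    (t : T) : completionLift p hB f (algebraMap T _ t) = f t := by
  refine sub_eq_zero.1 (IsHausdorff.haus (I := Ideal.span {(p : B)}) inferInstance _ fun n => ?_)
  rw [SModEq.sub_mem, sub_zero, smul_eq_mul, Ideal.mul_top, ← Ideal.Quotient.eq_zero_iff_mem,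
    map_sub, sub_eq_zero]
  refine (IsAdicComplete.mk_liftRingHom _ _ (fun h => completionLiftMod_compat f h) n _).trans ?_
  simp only [completionLiftMod, RingHom.comp_apply, RingHom.coe_coe]
  rw [AlgHom.commutes]
  simp

theorem isAdicComplete_completion :
    IsAdicComplete (Ideal.span {(p : AdicCompletion (Ideal.span {(p : T)}) T)})
      (AdicCompletion (Ideal.span {(p : T)}) T) := by
  have h := AdicCompletion.isAdicComplete (I := Ideal.span {(p : T)}) (M := T) ⟨{(p : T)}, by simp⟩
  rw [← IsAdicComplete.map_algebraMap_iff (S := AdicCompletion (Ideal.span {(p : T)}) T),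
    Ideal.map_span, Set.image_singleton, map_natCast] at h
  exact h

theorem exists_eq_algebraMap_add (s : AdicCompletion (Ideal.span {(p : T)}) T) :
    ∃ t s', s = algebraMap T _ t + (p : AdicCompletion (Ideal.span {(p : T)}) T) * s' := by
  obtain ⟨t, ht⟩ := Ideal.Quotient.mk_surjective (AdicCompletion.evalOneₐ (Ideal.span {(p : T)}) s)
  have h : s - algebraMap T _ t ∈
      RingHom.ker (AdicCompletion.evalOneₐ (Ideal.span {(p : T)})).toRingHom := by
    rw [RingHom.mem_ker]
    simp only [AlgHom.toRingHom_eq_coe, RingHom.coe_coe, map_sub, AlgHom.commutes]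
    rw [← ht]
    exact sub_self _
  rw [AdicCompletion.ker_evalOneₐ_eq_map _ ⟨{(p : T)}, by simp⟩, Ideal.map_span,
    Set.image_singleton, map_natCast, Ideal.mem_span_singleton] at h
  obtain ⟨s', hs'⟩ := h
  exact ⟨t, s', by rw [← hs']; ring⟩

theorem completion_torsionFree (hT : ∀ x y : T, (p : T) * x = p * y → x = y)
    {s s' : AdicCompletion (Ideal.span {(p : T)}) T}
    (h : (p : AdicCompletion (Ideal.span {(p : T)}) T) * s = p * s') : s = s' := by
  refine AdicCompletion.ext_evalₐ fun n => ?_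
  rw [← sub_eq_zero, ← map_sub, ← factorPow_evalₐ _ (Nat.le_add_right n 1)]
  have h0 : (p : AdicCompletion (Ideal.span {(p : T)}) T) * (s - s') = 0 := by
    rw [mul_sub, h, sub_self]
  obtain ⟨y, hy⟩ := Ideal.Quotient.mk_surjective
    (AdicCompletion.evalₐ (Ideal.span {(p : T)}) (n + 1) (s - s'))
  have h1 := congrArg (AdicCompletion.evalₐ (Ideal.span {(p : T)}) (n + 1)) h0
  rw [map_mul, map_natCast, map_zero, ← hy, ← map_natCast (Ideal.Quotient.mk _), ← map_mul,
    Ideal.Quotient.eq_zero_iff_mem, Ideal.span_singleton_pow, Ideal.mem_span_singleton] at h1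
  obtain ⟨z, hz⟩ := h1
  have hyz : y = p ^ n * z := hT _ _ (by rw [hz, pow_succ']; ring)
  rw [← hy]
  refine (Ideal.Quotient.factor_mk _ _).trans ?_
  rw [Ideal.Quotient.eq_zero_iff_mem, Ideal.span_singleton_pow, Ideal.mem_span_singleton, hyz]
  exact dvd_mul_right _ _

end Completion

/-- The divided powers `γ` on the ideal `J` of the `A`-algebra `D` make `(D, J, γ)` the divided
power envelope of the ideal `I` of `A`. -/
structure IsPDEnvelope {A : Type u} [CommRing A] (I : Ideal A) {D : Type u} [CommRing D]
    [Algebra A D] {J : Ideal D} (γ : DividedPowers J) : Prop where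
  map_le : I.map (algebraMap A D) ≤ J
  universal : ∀ {B : Type u} [CommRing B] [Algebra A B] {K : Ideal B} (δ : DividedPowers K),
    I.map (algebraMap A B) ≤ K →
      ∃! g : D →ₐ[A] B, DividedPowers.IsDPMorphism γ δ (g : D →+* B)

theorem smodEq_span_singleton_iff {T : Type u} [CommRing T] {x a b : T} {n : ℕ} :
    a ≡ b [SMOD (Ideal.span {x} ^ n • ⊤ : Submodule T T)] ↔ x ^ n ∣ a - b := by
  rw [SModEq.sub_mem, smul_eq_mul, Ideal.mul_top, Ideal.span_singleton_pow,
    Ideal.mem_span_singleton]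

/-- A ring `𝔖` with an element `E` such that `(p, E)` is a regular sequence and `𝔖` is complete
for the `(p, E)`-adic topology, together with a lift of Frobenius `φ`. -/
structure BreuilKisinDatum (p : ℕ) (𝔖 : Type u) [CommRing 𝔖] where
  E : 𝔖
  regular : RingTheory.Sequence.IsRegular 𝔖 [(p : 𝔖), E]
  complete : IsAdicComplete (Ideal.span {(p : 𝔖), E}) 𝔖
  φ : 𝔖 →+* 𝔖
  φ_frob : ∀ x : 𝔖, φ x - x ^ p ∈ Ideal.span {(p : 𝔖)}

namespace BreuilKisinDatum

section Basic

variable {p : ℕ} {𝔖 : Type u} [CommRing 𝔖] (A : BreuilKisinDatum p 𝔖)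

theorem p_regular (A : BreuilKisinDatum p 𝔖) {x y : 𝔖} (h : (p : 𝔖) * x = p * y) : x = y := by
  have h1 := ((RingTheory.Sequence.isWeaklyRegular_cons_iff 𝔖 _ _).1
    A.regular.toIsWeaklyRegular).1
  exact h1 h

theorem p_pow_regular (A : BreuilKisinDatum p 𝔖) (n : ℕ) {x y : 𝔖}
    (h : (p : 𝔖) ^ n * x = p ^ n * y) : x = y := by
  induction n with
  | zero => simpa using h
  | succ n ih => exact ih (A.p_regular (by rw [← mul_assoc, ← mul_assoc, ← pow_succ', h]))

theorem p_dvd (A : BreuilKisinDatum p 𝔖) {x : 𝔖} (h : (p : 𝔖) ∣ A.E * x) : (p : 𝔖) ∣ x := by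
  have h1 := ((RingTheory.Sequence.isWeaklyRegular_cons_iff 𝔖 _ _).1
    A.regular.toIsWeaklyRegular).2
  have h2 := (RingTheory.Sequence.isWeaklyRegular_singleton_iff _ _).1 h1
  have hmem : ∀ z : 𝔖, (Submodule.Quotient.mk z : QuotSMulTop (p : 𝔖) 𝔖) = 0 ↔ (p : 𝔖) ∣ z := by
    intro z
    rw [Submodule.Quotient.mk_eq_zero, Submodule.mem_smul_pointwise_iff_exists]
    constructor
    · rintro ⟨b, -, rfl⟩; exact ⟨b, rfl⟩
    · rintro ⟨b, rfl⟩; exact ⟨b, trivial, rfl⟩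
  rw [← hmem] at h ⊢
  apply h2
  simp only [smul_zero]
  rw [← Submodule.Quotient.mk_smul, smul_eq_mul]
  exact h

theorem p_pow_dvd (A : BreuilKisinDatum p 𝔖) (n : ℕ) {x : 𝔖} (h : (p : 𝔖) ^ n ∣ A.E * x) :
    (p : 𝔖) ^ n ∣ x := by
  induction n generalizing x with
  | zero => simp
  | succ n ih =>
    obtain ⟨y, rfl⟩ := A.p_dvd ((dvd_pow_self _ n.succ_ne_zero).trans h)
    rw [pow_succ'] at h ⊢
    refine mul_dvd_mul_left _ (ih ?_)
    obtain ⟨z, hz⟩ := h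
    exact ⟨z, A.p_regular (by linear_combination hz)⟩

theorem p_pow_dvd_pow (A : BreuilKisinDatum p 𝔖) (n m : ℕ) {x : 𝔖}
    (h : (p : 𝔖) ^ n ∣ A.E ^ m * x) : (p : 𝔖) ^ n ∣ x := by
  induction m with
  | zero => simpa using h
  | succ m ih => exact ih (A.p_pow_dvd n (by rwa [← mul_assoc, ← pow_succ']))

/-- The ring `𝔖` is `p`-adically complete. -/
theorem isAdicComplete_p (A : BreuilKisinDatum p 𝔖) :
    IsAdicComplete (Ideal.span {(p : 𝔖)}) 𝔖 := by
  have hc := A.complete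
  set I := Ideal.span {(p : 𝔖), A.E}
  have hpI : (p : 𝔖) ∈ I := Ideal.subset_span (by simp)
  have hI : ∀ {n : ℕ} {a b : 𝔖}, (p : 𝔖) ^ n ∣ a - b → a ≡ b [SMOD (I ^ n • ⊤ : Submodule 𝔖 𝔖)] := by
    rintro n a b ⟨c, hc⟩
    rw [SModEq.sub_mem, hc, smul_eq_mul, Ideal.mul_top]
    exact Ideal.mul_mem_right _ _ (Ideal.pow_mem_pow hpI n)
  refine { haus' := fun x hx => ?_, prec' := fun f hf => ?_ }
  · refine IsHausdorff.haus (I := I) inferInstance x fun n => hI ?_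
    exact smodEq_span_singleton_iff.1 (hx n)
  · have hf' : ∀ {m n}, m ≤ n → (p : 𝔖) ^ m ∣ f m - f n := fun h =>
      smodEq_span_singleton_iff.1 (hf h)
    obtain ⟨L, hL⟩ := IsPrecomplete.prec (I := I) (M := 𝔖) inferInstance (f := f)
      fun h => hI (hf' h)
    refine ⟨L, fun n => smodEq_span_singleton_iff.2 ?_⟩
    choose g hg using fun m => hf' (Nat.le_add_right n m)
    obtain ⟨G, hG⟩ := IsPrecomplete.prec (I := I) (M := 𝔖) inferInstance (f := g) (by
      intro m k hmk
      refine hI ?_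
      obtain ⟨z, hz⟩ := hf' (Nat.add_le_add_left hmk n)
      refine ⟨-z, A.p_pow_regular n ?_⟩
      rw [mul_sub, ← hg, ← hg, ← mul_assoc, ← pow_add, mul_neg, ← hz]
      ring)
    refine ⟨G, ?_⟩
    rw [← sub_eq_zero]
    refine IsHausdorff.haus (I := I) inferInstance _ fun m => ?_
    have h1 : f (n + m) ≡ L [SMOD (I ^ m • ⊤ : Submodule 𝔖 𝔖)] :=
      (hL (n + m)).mono (Submodule.smul_mono_left (Ideal.pow_le_pow_right (Nat.le_add_left m n)))
    have h2 := hG m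
    rw [SModEq.sub_mem] at h1 h2 ⊢
    have : f n - L - p ^ n * G - 0 = (f (n + m) - L) + (p : 𝔖) ^ n • (g m - G) := by
      rw [smul_eq_mul, mul_sub, ← hg]; ring
    rw [this]
    exact add_mem h1 (Submodule.smul_mem _ _ h2)

theorem E_regular (A : BreuilKisinDatum p 𝔖) {x y : 𝔖} (h : A.E * x = A.E * y) : x = y := by
  have := A.isAdicComplete_p
  rw [← sub_eq_zero]
  refine IsHausdorff.haus (I := Ideal.span {(p : 𝔖)}) inferInstance _ fun n =>
    smodEq_span_singleton_iff.2 ?_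
  rw [sub_zero]
  refine A.p_pow_dvd n ?_
  rw [mul_sub, h, sub_self]
  exact dvd_zero _

theorem le_jacobson (A : BreuilKisinDatum p 𝔖) :
    Ideal.span {A.E} ⊔ Ideal.span {(p : 𝔖)} ≤ (⊥ : Ideal 𝔖).jacobson := by
  have := A.complete
  refine le_trans ?_ (IsAdicComplete.le_jacobson_bot (Ideal.span {(p : 𝔖), A.E}))
  exact sup_le (Ideal.span_mono (by simp)) (Ideal.span_mono (by simp))

theorem dvd_of_p_mul (A : BreuilKisinDatum p 𝔖) {x : 𝔖} (h : A.E ∣ (p : 𝔖) * x) : A.E ∣ x := by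
  obtain ⟨y, hy⟩ := h
  obtain ⟨z, rfl⟩ := A.p_dvd ⟨x, hy.symm⟩
  exact ⟨z, A.p_regular (by rw [hy]; ring)⟩

/-- The ring `R = 𝔖 / E 𝔖`. -/
abbrev R : Type u := 𝔖 ⧸ Ideal.span {A.E}

/-- The ring `R = 𝔖 / E 𝔖` is `p`-adically complete. -/
theorem isAdicComplete_R : IsAdicComplete (Ideal.span {(p : A.R)}) A.R := by
  have := A.isAdicComplete_p
  refine { haus' := fun x hx => ?_, prec' := ?_ }
  · obtain ⟨x, rfl⟩ := Ideal.Quotient.mk_surjective x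
    have h1 : ∀ n, ∃ z, (p : 𝔖) ^ n ∣ x - A.E * z := by
      intro n
      obtain ⟨y, hy⟩ := smodEq_span_singleton_iff.1 (hx n)
      obtain ⟨y, rfl⟩ := Ideal.Quotient.mk_surjective y
      rw [sub_zero, ← map_natCast (Ideal.Quotient.mk (Ideal.span {A.E})), ← map_pow, ← map_mul,
        Ideal.Quotient.eq, Ideal.mem_span_singleton] at hy
      obtain ⟨z, hz⟩ := hy
      exact ⟨z, y, by rw [← hz]; ring⟩
    choose z hz using h1
    obtain ⟨Z, hZ⟩ := IsPrecomplete.prec (I := Ideal.span {(p : 𝔖)}) (M := 𝔖) inferInstance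
      (f := z) (by
        intro m n hmn
        refine smodEq_span_singleton_iff.2 (A.p_pow_dvd m ?_)
        have : A.E * (z m - z n) = (x - A.E * z n) - (x - A.E * z m) := by ring
        rw [this]
        exact dvd_sub ((pow_dvd_pow _ hmn).trans (hz n)) (hz m))
    rw [Ideal.Quotient.eq_zero_iff_mem, Ideal.mem_span_singleton]
    refine ⟨Z, ?_⟩
    rw [← sub_eq_zero]
    refine IsHausdorff.haus (I := Ideal.span {(p : 𝔖)}) inferInstance _ fun n =>
      smodEq_span_singleton_iff.2 ?_
    have : x - A.E * Z - 0 = (x - A.E * z n) + A.E * (z n - Z) := by ring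
    rw [this]
    exact dvd_add (hz n) (Dvd.dvd.mul_left (smodEq_span_singleton_iff.1 (hZ n)) _)
  · intro f hf
    have hf' : ∀ n, ∃ y : 𝔖, f (n + 1) - f n = Ideal.Quotient.mk _ ((p : 𝔖) ^ n * y) := by
      intro n
      obtain ⟨y, hy⟩ := smodEq_span_singleton_iff.1 (hf n.le_succ)
      obtain ⟨y, rfl⟩ := Ideal.Quotient.mk_surjective y
      refine ⟨-y, ?_⟩
      rw [map_mul, map_pow, map_natCast, map_neg, mul_neg, ← hy]
      ring
    choose y hy using hf'
    obtain ⟨a, ha⟩ := Ideal.Quotient.mk_surjective (f 0)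
    let g : ℕ → 𝔖 := fun n => a + ∑ i ∈ Finset.range n, (p : 𝔖) ^ i * y i
    have hg : ∀ n, Ideal.Quotient.mk _ (g n) = f n := by
      intro n
      induction n with
      | zero => simpa [g] using ha
      | succ n ih =>
        have : g (n + 1) = g n + p ^ n * y n := by simp [g, Finset.sum_range_succ, add_assoc]
        rw [this, map_add, ih, ← hy]
        ring
    obtain ⟨L, hL⟩ := IsPrecomplete.prec (I := Ideal.span {(p : 𝔖)}) (M := 𝔖) inferInstance
      (f := g) (by
        intro m n hmn
        refine smodEq_span_singleton_iff.2 ?_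
        induction n, hmn using Nat.le_induction with
        | base => simp
        | succ n hmn ih =>
          have : g m - g (n + 1) = (g m - g n) - p ^ n * y n := by
            simp only [g, Finset.sum_range_succ]; ring
          rw [this]
          exact dvd_sub ih (Dvd.dvd.mul_right (pow_dvd_pow _ hmn) _))
    refine ⟨Ideal.Quotient.mk _ L, fun n => smodEq_span_singleton_iff.2 ?_⟩
    obtain ⟨z, hz⟩ := smodEq_span_singleton_iff.1 (hL n)
    refine ⟨Ideal.Quotient.mk _ z, ?_⟩
    rw [← hg, ← map_sub, hz, map_mul, map_pow, map_natCast]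

/-- The frame `(𝔖, E 𝔖, R, φ, φ₁')` with `φ₁' (E x) = φ x` and `ϖ = φ E`. -/
noncomputable def frame : Frame p 𝔖 where
  Fil := Ideal.span {A.E}
  φ := A.φ
  φ_frob := A.φ_frob
  φ₁ :=
    { toFun := fun x => A.φ (Ideal.mem_span_singleton.1 x.2).choose
      map_add' := fun x y => by
        rw [← map_add]
        refine congrArg A.φ (A.E_regular ?_)
        rw [mul_add, ← (Ideal.mem_span_singleton.1 (x + y).2).choose_spec,
          ← (Ideal.mem_span_singleton.1 x.2).choose_spec,
          ← (Ideal.mem_span_singleton.1 y.2).choose_spec, Submodule.coe_add]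
      map_smul' := fun r x => by
        rw [smul_eq_mul, ← map_mul]
        refine congrArg A.φ (A.E_regular ?_)
        rw [← (Ideal.mem_span_singleton.1 (r • x).2).choose_spec, mul_left_comm,
          ← (Ideal.mem_span_singleton.1 x.2).choose_spec, Submodule.coe_smul, smul_eq_mul] }
  ϖ := A.φ A.E
  φ_eq x := by
    conv_lhs => rw [(Ideal.mem_span_singleton.1 x.2).choose_spec]
    exact map_mul _ _ _
  le_jacobson := A.le_jacobson

theorem frame_φ₁ (x : 𝔖) (h : A.E * x ∈ A.frame.Fil) : A.frame.φ₁ ⟨A.E * x, h⟩ = A.φ x :=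
  congrArg A.φ (A.E_regular (Ideal.mem_span_singleton.1 h).choose_spec.symm)

theorem frame_torsionFree (x : 𝔖) (h : (p : 𝔖) * x ∈ A.frame.Fil) : x ∈ A.frame.Fil :=
  Ideal.mem_span_singleton.2 (A.dvd_of_p_mul (Ideal.mem_span_singleton.1 h))

end Basic

section Envelope

variable {p : ℕ} [hp : Fact p.Prime] {𝔖 : Type u} [CommRing 𝔖] (A : BreuilKisinDatum p 𝔖)

theorem isUnit_natCast_of_not_dvd (A : BreuilKisinDatum p 𝔖) {m : ℕ} (h : ¬ p ∣ m) :
    IsUnit (m : 𝔖) := by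
  have hc : IsCoprime (m : ℤ) (p : ℤ) :=
    Nat.isCoprime_iff_coprime.2 ((Nat.Prime.coprime_iff_not_dvd hp.out).2 h).symm
  obtain ⟨a, b, hab⟩ := hc
  have h1 : (a : 𝔖) * m + b * p = 1 := by exact_mod_cast congrArg (Int.cast : ℤ → 𝔖) hab
  have h2 : (p : 𝔖) ∈ (⊥ : Ideal 𝔖).jacobson :=
    A.le_jacobson (Ideal.mem_sup_right (Ideal.mem_span_singleton_self _))
  have h3 := Ideal.mem_jacobson_bot.1 h2 (-b)
  have h4 : (p : 𝔖) * -b + 1 = a * m := by rw [← h1]; ring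
  rw [h4] at h3
  exact isUnit_of_mul_isUnit_right h3

theorem exists_natCast_eq (A : BreuilKisinDatum p 𝔖) {n : ℕ} (hn : n ≠ 0) :
    ∃ v : 𝔖, IsUnit v ∧ (n : 𝔖) = p ^ padicValNat p n * v := by
  obtain ⟨m, hm⟩ := pow_padicValNat_dvd (p := p) (n := n)
  refine ⟨m, A.isUnit_natCast_of_not_dvd fun hd => ?_, by rw [← Nat.cast_pow, ← Nat.cast_mul, ← hm]⟩
  refine pow_succ_padicValNat_not_dvd (p := p) hn ?_
  rw [hm, pow_succ]
  conv_rhs => rw [hm]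
  exact mul_dvd_mul_left _ hd

theorem natCast_dvd (A : BreuilKisinDatum p 𝔖) {n : ℕ} (hn : n ≠ 0) (m : ℕ) {x : 𝔖}
    (h : (n : 𝔖) ∣ A.E ^ m * x) : (n : 𝔖) ∣ x := by
  obtain ⟨v, hv, hnv⟩ := A.exists_natCast_eq hn
  rw [hnv, hv.mul_right_dvd] at h ⊢
  exact A.p_pow_dvd_pow _ _ h

/-- For `n ≥ 1`, the number `pⁿ / n!` lies in `p 𝔖`. -/
theorem exists_p_pow_eq (A : BreuilKisinDatum p 𝔖) {n : ℕ} (hn : n ≠ 0) :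
    ∃ r : 𝔖, (p : 𝔖) ^ n = (n.factorial : 𝔖) * (p * r) := by
  obtain ⟨v, hv, hnv⟩ := A.exists_natCast_eq n.factorial_ne_zero
  have hlt := padicValNat_factorial_lt_of_ne_zero p hn
  obtain ⟨k, hk⟩ := Nat.exists_eq_add_of_lt hlt
  obtain ⟨w, hw⟩ := hv.exists_right_inv
  refine ⟨p ^ k * w, ?_⟩
  rw [hnv]
  conv_lhs => rw [hk]
  linear_combination (-(p : 𝔖) ^ (padicValNat p n.factorial + k + 1)) * hw

/-- The ring `𝔖[1/p]`. -/
abbrev L (_A : BreuilKisinDatum p 𝔖) : Type u := Localization.Away (p : 𝔖)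

theorem algebraMap_L_injective : Function.Injective (algebraMap 𝔖 A.L) := by
  refine IsLocalization.injective A.L (M := Submonoid.powers (p : 𝔖)) ?_
  rintro _ ⟨n, rfl⟩
  rw [mem_nonZeroDivisors_iff_right]
  intro x hx
  exact A.p_pow_regular n (by simpa [mul_comm] using hx)

theorem isUnit_p_L : IsUnit (p : A.L) := by
  have := IsLocalization.Away.algebraMap_isUnit (S := A.L) (p : 𝔖)
  rwa [map_natCast] at this

theorem isUnit_natCast_L {n : ℕ} (hn : n ≠ 0) : IsUnit (n : A.L) := by
  obtain ⟨v, hv, hnv⟩ := A.exists_natCast_eq hn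
  rw [← map_natCast (algebraMap 𝔖 A.L), hnv, map_mul, map_pow, map_natCast]
  exact (A.isUnit_p_L.pow _).mul (hv.map _)

/-- The element `Eⁿ / n!` of `𝔖[1/p]`, in which `n!` is invertible. -/
noncomputable def dp (n : ℕ) : A.L :=
  Ring.inverse (n.factorial : A.L) * algebraMap 𝔖 A.L A.E ^ n

theorem factorial_mul_dp (n : ℕ) :
    (n.factorial : A.L) * A.dp n = algebraMap 𝔖 A.L A.E ^ n := by
  rw [dp, Ring.mul_inverse_cancel_left _ _ (A.isUnit_natCast_L n.factorial_ne_zero)]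

theorem factorial_cancel {n : ℕ} {x y : A.L}
    (h : (n.factorial : A.L) * x = n.factorial * y) : x = y :=
  (A.isUnit_natCast_L n.factorial_ne_zero).mul_left_cancel h

theorem dp_zero : A.dp 0 = 1 := by simp [dp]

theorem dp_one : A.dp 1 = algebraMap 𝔖 _ A.E := by simp [dp]

theorem dp_mul (m n : ℕ) : A.dp m * A.dp n = ((m + n).choose m : A.L) * A.dp (m + n) := by
  refine A.factorial_cancel (n := m) (A.factorial_cancel (n := n) ?_)
  have h : ((m + n).choose m * m.factorial * n.factorial : A.L) = (m + n).factorial := by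
    rw [Nat.choose_symm_add]
    exact_mod_cast congrArg (Nat.cast : ℕ → A.L) (Nat.add_choose_mul_factorial_mul_factorial m n)
  calc (n.factorial : A.L) * (m.factorial * (A.dp m * A.dp n))
      = (m.factorial * A.dp m) * (n.factorial * A.dp n) := by ring
    _ = (m + n).factorial * A.dp (m + n) := by
        rw [factorial_mul_dp, factorial_mul_dp, factorial_mul_dp, pow_add]
    _ = _ := by rw [← h]; ring

theorem succ_mul_dp (n : ℕ) :
    ((n + 1 : ℕ) : A.L) * A.dp (n + 1) = algebraMap 𝔖 _ A.E * A.dp n := by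
  rw [← dp_one, dp_mul, add_comm 1 n, Nat.choose_one_right]

/-- The divided power envelope of the ideal `E 𝔖` of `𝔖`: the subring of `𝔖[1/p]` generated
over `𝔖` by the elements `Eⁿ / n!`.  The universal property is `isPDEnvelope` below. -/
noncomputable def D : Subalgebra 𝔖 A.L := Algebra.adjoin 𝔖 (Set.range A.dp)

theorem dp_mem (n : ℕ) : A.dp n ∈ A.D := Algebra.subset_adjoin ⟨n, rfl⟩

/-- The element `Eⁿ / n!` of the divided power envelope. -/
noncomputable def dpD (n : ℕ) : A.D := ⟨A.dp n, A.dp_mem n⟩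

theorem mem_D_iff {x : A.L} :
    x ∈ A.D ↔ ∃ a : ℕ →₀ 𝔖, Finsupp.linearCombination 𝔖 A.dp a = x := by
  constructor
  · intro hx
    induction hx using Algebra.adjoin_induction with
    | mem x hx => obtain ⟨n, rfl⟩ := hx; exact ⟨Finsupp.single n 1, by simp⟩
    | algebraMap r => exact ⟨Finsupp.single 0 r, by simp [dp_zero, Algebra.smul_def]⟩
    | add x y _ _ hx hy =>
      obtain ⟨a, rfl⟩ := hx
      obtain ⟨b, rfl⟩ := hy
      exact ⟨a + b, map_add _ _ _⟩
    | mul x y _ _ hx hy =>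
      obtain ⟨a, rfl⟩ := hx
      obtain ⟨b, rfl⟩ := hy
      rw [← LinearMap.mem_range, Finsupp.range_linearCombination]
      rw [Finsupp.linearCombination_apply, Finsupp.linearCombination_apply, Finsupp.sum,
        Finsupp.sum, Finset.sum_mul_sum]
      refine Submodule.sum_mem _ fun i _ => Submodule.sum_mem _ fun j _ => ?_
      rw [smul_mul_smul_comm, dp_mul, ← nsmul_eq_mul]
      exact Submodule.smul_mem _ _ (nsmul_mem (Submodule.subset_span (Set.mem_range_self _)) _)
  · rintro ⟨a, rfl⟩
    rw [Finsupp.linearCombination_apply, Finsupp.sum]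
    exact sum_mem fun i _ => A.D.smul_mem (A.dp_mem i) _

/-- All relations between the `Eⁿ / n!` follow from `(n + 1) Eⁿ⁺¹ / (n + 1)! = E Eⁿ / n!`. -/
theorem relation {B : Type u} [AddCommGroup B] [Module 𝔖 B] (y : ℕ → B)
    (hy : ∀ n, ((n + 1 : ℕ) : 𝔖) • y (n + 1) = A.E • y n) (N : ℕ) (a : ℕ → 𝔖)
    (h : ∑ n ∈ Finset.range N, a n • A.dp n = 0) : ∑ n ∈ Finset.range N, a n • y n = 0 := by
  induction N generalizing a with
  | zero => simp
  | succ N ih =>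
    cases N with
    | zero =>
      simp only [zero_add, Finset.sum_range_one, dp_zero, Algebra.smul_def, mul_one] at h ⊢
      have : a 0 = 0 := A.algebraMap_L_injective (by rw [h, map_zero])
      simp [this]
    | succ M =>
      have hd : ((M + 1 : ℕ) : 𝔖) ∣ a (M + 1) := by
        have h1 : ∃ z : 𝔖, (M.factorial : A.L) * ∑ n ∈ Finset.range (M + 1), a n • A.dp n =
            algebraMap 𝔖 _ z := by
          have : ∀ n ∈ Finset.range (M + 1), ∃ z : 𝔖,
              (M.factorial : A.L) * (a n • A.dp n) = algebraMap 𝔖 _ z := by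
            intro n hn
            obtain ⟨k, hk⟩ := Nat.factorial_dvd_factorial (Nat.lt_succ_iff.1 (Finset.mem_range.1 hn))
            refine ⟨k * a n * A.E ^ n, ?_⟩
            rw [hk, Nat.cast_mul, map_mul, map_mul, map_pow, ← factorial_mul_dp, map_natCast,
              Algebra.smul_def]
            ring
          choose! z hz using this
          refine ⟨∑ n ∈ Finset.range (M + 1), z n, ?_⟩
          rw [Finset.mul_sum, map_sum]
          exact Finset.sum_congr rfl hz
        obtain ⟨z, hz⟩ := h1
        rw [Finset.sum_range_succ] at h
        have h2 := congrArg (((M + 1).factorial : A.L) * ·) h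
        simp only [mul_add, mul_zero] at h2
        rw [Nat.factorial_succ, Nat.cast_mul, mul_assoc, hz, ← Nat.cast_mul,
          ← Nat.factorial_succ, Algebra.smul_def, mul_left_comm, factorial_mul_dp,
          ← map_natCast (algebraMap 𝔖 A.L) (M + 1), ← map_pow, ← map_mul, ← map_mul,
          ← map_add, ← map_zero (algebraMap 𝔖 A.L)] at h2
        have h3 := A.algebraMap_L_injective h2
        refine A.natCast_dvd M.succ_ne_zero (M + 1) ⟨-z, ?_⟩
        linear_combination h3
      obtain ⟨b, hb⟩ := hd
      let a' : ℕ → 𝔖 := fun n => if n = M then a M + b * A.E else a n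
      have key : ∀ {C : Type u} [AddCommGroup C] [Module 𝔖 C] (w : ℕ → C),
          ((M + 1 : ℕ) : 𝔖) • w (M + 1) = A.E • w M →
          ∑ n ∈ Finset.range (M + 1 + 1), a n • w n = ∑ n ∈ Finset.range (M + 1), a' n • w n := by
        intro C _ _ w hw
        rw [Finset.sum_range_succ, Finset.sum_range_succ, Finset.sum_range_succ, hb, mul_comm,
          mul_smul, hw, smul_smul, add_assoc, ← add_smul]
        have e : ∑ n ∈ Finset.range M, a' n • w n = ∑ n ∈ Finset.range M, a n • w n :=
          Finset.sum_congr rfl fun n hn => by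
            simp [a', (Finset.mem_range.1 hn).ne]
        rw [e]
        simp [a']
      have hw : ((M + 1 : ℕ) : 𝔖) • A.dp (M + 1) = A.E • A.dp M := by
        rw [Algebra.smul_def, Algebra.smul_def, map_natCast, succ_mul_dp]
      rw [key y (hy M)]
      exact ih a' (by rw [← key A.dp hw]; exact h)

theorem relation' {B : Type u} [AddCommGroup B] [Module 𝔖 B] (y : ℕ → B)
    (hy : ∀ n, ((n + 1 : ℕ) : 𝔖) • y (n + 1) = A.E • y n) (a : ℕ →₀ 𝔖)
    (h : Finsupp.linearCombination 𝔖 A.dp a = 0) : Finsupp.linearCombination 𝔖 y a = 0 := by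
  obtain ⟨N, hN⟩ := a.support.exists_nat_subset_range
  rw [Finsupp.linearCombination_apply, Finsupp.sum_of_support_subset _ hN _ (by simp)] at h ⊢
  exact A.relation y hy N a h

end Envelope

section Universal

variable {p : ℕ} [hp : Fact p.Prime] {𝔖 : Type u} [CommRing 𝔖] (A : BreuilKisinDatum p 𝔖)

theorem exists_lift {B : Type u} [CommRing B] [Algebra 𝔖 B] (y : ℕ → B) (hy0 : y 0 = 1)
    (hy1 : y 1 = algebraMap 𝔖 B A.E)
    (hy : ∀ m n, y m * y n = ((m + n).choose m : B) * y (m + n)) :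
    ∃ g : A.D →ₐ[𝔖] B, ∀ n, g (A.dpD n) = y n := by
  have hrel : ∀ n, ((n + 1 : ℕ) : 𝔖) • y (n + 1) = A.E • y n := by
    intro n
    rw [Algebra.smul_def, Algebra.smul_def, ← hy1, hy, map_natCast, add_comm 1 n,
      Nat.choose_one_right]
  choose rep hrep using fun d : A.D => A.mem_D_iff.1 d.2
  let g : A.D → B := fun d => Finsupp.linearCombination 𝔖 y (rep d)
  have hg : ∀ (d : A.D) (a : ℕ →₀ 𝔖), Finsupp.linearCombination 𝔖 A.dp a = d →
      g d = Finsupp.linearCombination 𝔖 y a := by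
    intro d a h
    rw [← sub_eq_zero, ← map_sub]
    refine A.relation' y hrel _ ?_
    rw [map_sub, hrep, h, sub_self]
  have hadd : ∀ d e, g (d + e) = g d + g e := fun d e =>
    (hg _ (rep d + rep e) (by rw [map_add, hrep, hrep]; rfl)).trans (map_add _ _ _)
  have hsmul : ∀ (r : 𝔖) d, g (r • d) = r • g d := fun r d =>
    (hg _ (r • rep d) (by rw [map_smul, hrep]; rfl)).trans (map_smul _ _ _)
  have hdp : ∀ n, g (A.dpD n) = y n := fun n =>
    (hg _ (Finsupp.single n 1) (by simp [dpD])).trans (by simp)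
  let gl : A.D →ₗ[𝔖] B := { toFun := g, map_add' := hadd, map_smul' := hsmul }
  have hspan : ∀ d : A.D, d ∈ Submodule.span 𝔖 (Set.range A.dpD) := by
    intro d
    have : d = Finsupp.linearCombination 𝔖 A.dpD (rep d) := by
      ext
      rw [← hrep d, Finsupp.linearCombination_apply, Finsupp.linearCombination_apply,
        Finsupp.sum, Finsupp.sum, AddSubmonoidClass.coe_finsetSum]
      rfl
    rw [this, ← Finsupp.range_linearCombination]
    exact ⟨_, rfl⟩
  have hdpmul : ∀ m n, A.dpD m * A.dpD n = ((m + n).choose m : 𝔖) • A.dpD (m + n) := by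
    intro m n
    ext
    have := A.dp_mul m n
    rw [← map_natCast (algebraMap 𝔖 A.L), ← Algebra.smul_def] at this
    exact this
  have hmul : ∀ d e, gl (d * e) = gl d * gl e := by
    intro d e
    refine Submodule.span_induction₂ (p := fun d e _ _ => gl (d * e) = gl d * gl e)
      ?_ ?_ ?_ ?_ ?_ ?_ ?_ (hspan d) (hspan e)
    · rintro _ _ ⟨m, rfl⟩ ⟨n, rfl⟩
      have e1 : ∀ n, gl (A.dpD n) = y n := hdp
      rw [hdpmul, map_smul, e1, e1, e1, hy, Algebra.smul_def, map_natCast]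
    · intros; simp
    · intros; simp
    · intro x y z _ _ _ h1 h2; rw [add_mul, map_add, map_add, h1, h2, add_mul]
    · intro x y z _ _ _ h1 h2; rw [mul_add, map_add, map_add, h1, h2, mul_add]
    · intro r x y _ _ h; rw [smul_mul_assoc, map_smul, map_smul, h, smul_mul_assoc]
    · intro r x y _ _ h; rw [mul_smul_comm, map_smul, map_smul, h, mul_smul_comm]
  have hone : gl 1 = 1 := by
    have : (1 : A.D) = A.dpD 0 := Subtype.ext A.dp_zero.symm
    rw [this]
    exact (hdp 0).trans hy0
  exact ⟨AlgHom.ofLinearMap gl hone hmul, hdp⟩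

theorem algHom_ext_D {B : Type u} [CommRing B] [Algebra 𝔖 B] {f g : A.D →ₐ[𝔖] B}
    (h : ∀ n, f (A.dpD n) = g (A.dpD n)) : f = g := by
  refine AlgHom.ext fun d => ?_
  obtain ⟨d, hd⟩ := d
  have key : ∀ d (hd : d ∈ A.D), ∀ h' : d ∈ A.D, f ⟨d, h'⟩ = g ⟨d, h'⟩ := by
    intro d hd
    refine Algebra.adjoin_induction (p := fun d _ => ∀ h' : d ∈ A.D, f ⟨d, h'⟩ = g ⟨d, h'⟩)
      ?_ ?_ ?_ ?_ hd
    · rintro _ ⟨n, rfl⟩ _; exact h n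
    · intro r h'; exact (f.commutes r).trans (g.commutes r).symm
    · intro x y hx hy h1 h2 h'
      change x ∈ A.D at hx
      change y ∈ A.D at hy
      have e : (⟨x + y, h'⟩ : A.D) = ⟨x, hx⟩ + ⟨y, hy⟩ := rfl
      rw [e, map_add, map_add, h1, h2]
    · intro x y hx hy h1 h2 h'
      change x ∈ A.D at hx
      change y ∈ A.D at hy
      have e : (⟨x * y, h'⟩ : A.D) = ⟨x, hx⟩ * ⟨y, hy⟩ := rfl
      rw [e, map_mul, map_mul, h1, h2]
  exact key d hd hd

/-- The ideal of the divided power envelope which carries the divided powers: it is generated by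
the elements `Eⁿ / n!` with `n ≥ 1`. -/
noncomputable def J : Ideal A.D := Ideal.span {x | ∃ n ≠ 0, A.dpD n = x}

theorem dpD_mem_J {n : ℕ} (hn : n ≠ 0) : A.dpD n ∈ A.J := Ideal.subset_span ⟨n, hn, rfl⟩

theorem dpD_one : A.dpD 1 = algebraMap 𝔖 A.D A.E := Subtype.ext A.dp_one

theorem dpD_zero : A.dpD 0 = 1 := Subtype.ext A.dp_zero

/-- The ring `𝔖[1/p]` contains the rational numbers, since primes other than `p` are invertible
in `𝔖`. -/
@[reducible]
noncomputable def algebraRatL : Algebra ℚ A.L :=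
  (IsLocalization.lift (M := nonZeroDivisors ℤ) (S := ℚ) (g := Int.castRingHom A.L) (by
    rintro ⟨z, hz⟩
    have hz0 : z ≠ 0 := nonZeroDivisors.ne_zero hz
    have h1 := A.isUnit_natCast_L (Int.natAbs_ne_zero.2 hz0)
    rcases Int.natAbs_eq z with h | h
    · simp only [eq_intCast]
      rw [h]
      simpa using h1
    · simp only [eq_intCast]
      rw [h]
      simpa using h1)).toAlgebra

open Classical in
/-- The divided powers `x ↦ xⁿ / n!` on an ideal of `𝔖[1/p]`. -/
noncomputable def dividedPowersL (I : Ideal A.L) : DividedPowers I :=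
  letI := A.algebraRatL
  DividedPowers.RatAlgebra.dividedPowers I

theorem factorial_mul_dividedPowersL (I : Ideal A.L) (n : ℕ) {x : A.L} (hx : x ∈ I) :
    (n.factorial : A.L) * (A.dividedPowersL I).dpow n x = x ^ n :=
  (A.dividedPowersL I).factorial_mul_dpow_eq_pow hx

theorem exists_dpow (n : ℕ) {x : A.D} (hx : x ∈ A.J) :
    ∃ (y : A.D) (_ : n ≠ 0 → y ∈ A.J), A.D.val.toRingHom y =
      (A.dividedPowersL (A.J.map A.D.val.toRingHom)).dpow n (A.D.val.toRingHom x) := by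
  set K := A.J.map A.D.val.toRingHom
  set δ := A.dividedPowersL K
  have hK : ∀ {x : A.D}, x ∈ A.J → A.D.val.toRingHom x ∈ K := fun h => Ideal.mem_map_of_mem _ h
  have hE : A.D.val.toRingHom (A.dpD 1) ∈ K := hK (A.dpD_mem_J one_ne_zero)
  have hdp : ∀ m, A.D.val.toRingHom (A.dpD m) = δ.dpow m (A.D.val.toRingHom (A.dpD 1)) := by
    intro m
    refine A.factorial_cancel (n := m) ?_
    rw [A.factorial_mul_dividedPowersL K m hE]
    refine (A.factorial_mul_dp m).trans ?_
    rw [dpD_one]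
    rfl
  induction hx using Submodule.span_induction generalizing n with
  | mem x hx =>
    obtain ⟨m, hm, rfl⟩ := hx
    refine ⟨(Nat.uniformBell n m : A.D) * A.dpD (n * m), fun hn =>
      Ideal.mul_mem_left _ _ (A.dpD_mem_J (Nat.mul_ne_zero hn hm)), ?_⟩
    rw [map_mul, map_natCast, hdp (n * m), hdp m, δ.dpow_comp hm hE]
  | zero =>
    rcases eq_or_ne n 0 with rfl | hn
    · exact ⟨1, fun h => absurd rfl h, by rw [map_one, δ.dpow_zero (hK (zero_mem _))]⟩
    · exact ⟨0, fun _ => zero_mem _, by rw [map_zero, δ.dpow_eval_zero hn]⟩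
  | add x y hx hy ihx ihy =>
    choose f hf hf' using ihx
    choose g hg hg' using ihy
    refine ⟨∑ k ∈ Finset.HasAntidiagonal.antidiagonal n, f k.1 * g k.2, fun hn => ?_, ?_⟩
    · refine sum_mem fun k hk => ?_
      rw [Finset.HasAntidiagonal.mem_antidiagonal] at hk
      rcases eq_or_ne k.1 0 with h0 | h0
      · exact Ideal.mul_mem_left _ _ (hg _ (by omega))
      · exact Ideal.mul_mem_right _ _ (hf _ h0)
    · rw [map_add, δ.dpow_add (hK hx) (hK hy), map_sum]
      exact Finset.sum_congr rfl fun k _ => by rw [map_mul, hf', hg']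
  | smul a x hx ih =>
    obtain ⟨y, hy, hy'⟩ := ih n
    exact ⟨a ^ n * y, fun hn => Ideal.mul_mem_left _ _ (hy hn), by
      rw [smul_eq_mul, map_mul, map_mul, δ.dpow_mul (hK hx), hy', map_pow]⟩

/-- The divided powers `x ↦ xⁿ / n!` on the ideal `J` of the divided power envelope. -/
noncomputable def dividedPowersJ : DividedPowers A.J :=
  DividedPowers.ofInjective A.J (A.J.map A.D.val.toRingHom) A.D.val.toRingHom
    Subtype.val_injective (A.dividedPowersL _) rfl (fun n _ hx => A.exists_dpow n hx)

theorem dividedPowersJ_dpD_one (n : ℕ) : A.dividedPowersJ.dpow n (A.dpD 1) = A.dpD n := by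
  refine Subtype.ext (A.factorial_cancel (n := n) ?_)
  have h1 := A.dividedPowersJ.factorial_mul_dpow_eq_pow (n := n) (A.dpD_mem_J one_ne_zero)
  have h2 := congrArg (fun x : A.D => (x : A.L)) h1
  simp only [MulMemClass.coe_mul, SubmonoidClass.coe_pow] at h2
  refine (Eq.trans ?_ h2).trans ?_
  · norm_cast
  · rw [dpD_one]
    exact (A.factorial_mul_dp n).symm

/-- The triple `(D, J, γ)` is the divided power envelope of the ideal `E 𝔖` of `𝔖`. -/
theorem isPDEnvelope : IsPDEnvelope (Ideal.span {A.E}) A.dividedPowersJ where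
  map_le := by
    rw [Ideal.map_span, Set.image_singleton, Ideal.span_le, Set.singleton_subset_iff, ← dpD_one]
    exact A.dpD_mem_J one_ne_zero
  universal := by
    intro B _ _ K δ hK
    have hE : algebraMap 𝔖 B A.E ∈ K :=
      hK (Ideal.mem_map_of_mem _ (Ideal.mem_span_singleton_self _))
    obtain ⟨g, hg⟩ := A.exists_lift (fun n => δ.dpow n (algebraMap 𝔖 B A.E)) (δ.dpow_zero hE)
      (δ.dpow_one hE) (fun m n => δ.mul_dpow hE)
    refine ⟨g, DividedPowers.IsDPMorphism.on_span _ _ rfl ?_ ?_, ?_⟩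
    · rintro _ ⟨n, hn, rfl⟩
      refine (hg n).symm ▸ δ.dpow_mem hn hE
    · rintro m _ ⟨n, hn, rfl⟩
      have h1 : A.dividedPowersJ.dpow m (A.dpD n) = (Nat.uniformBell m n : A.D) * A.dpD (m * n) := by
        rw [← dividedPowersJ_dpD_one, A.dividedPowersJ.dpow_comp hn (A.dpD_mem_J one_ne_zero),
          dividedPowersJ_dpD_one]
      rw [h1, map_mul, map_natCast]
      refine Eq.trans ?_ (congrArg (δ.dpow m) (hg n).symm)
      rw [δ.dpow_comp hn hE]
      exact congrArg _ (hg _)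
    · intro g' hg'
      refine A.algHom_ext_D fun n => ?_
      rw [hg, ← dividedPowersJ_dpD_one]
      refine (hg'.dpow_comp (n := n) _ (A.dpD_mem_J one_ne_zero)).symm.trans ?_
      rw [dpD_one]
      exact congrArg (δ.dpow n) (g'.commutes A.E)

end Universal

section Frame

variable {p : ℕ} [hp : Fact p.Prime] {𝔖 : Type u} [CommRing 𝔖] (A : BreuilKisinDatum p 𝔖)

/-- The extension of `φ` to `𝔖[1/p]`. -/
noncomputable def φL : A.L →+* A.L :=
  IsLocalization.Away.lift (p : 𝔖) (g := (algebraMap 𝔖 A.L).comp A.φ) (by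
    rw [map_natCast]; exact A.isUnit_p_L)

theorem φL_algebraMap (x : 𝔖) : A.φL (algebraMap 𝔖 A.L x) = algebraMap 𝔖 A.L (A.φ x) :=
  IsLocalization.Away.lift_eq _ _ _

theorem exists_φL_E : ∃ c : A.D, A.φL (algebraMap 𝔖 A.L A.E) = p * (c : A.L) := by
  obtain ⟨d, hd⟩ := Ideal.mem_span_singleton.1 (A.φ_frob A.E)
  refine ⟨((p - 1).factorial : A.D) * A.dpD p + algebraMap 𝔖 A.D d, ?_⟩
  have h1 := A.factorial_mul_dp p
  rw [← Nat.mul_factorial_pred hp.out.ne_zero, Nat.cast_mul] at h1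
  have h2 : A.φ A.E = A.E ^ p + p * d := by rw [← hd]; ring
  have h3 : ((((p - 1).factorial : A.D) * A.dpD p + algebraMap 𝔖 A.D d : A.D) : A.L) =
      (p - 1).factorial * A.dp p + algebraMap 𝔖 A.L d := by
    push_cast
    rfl
  rw [φL_algebraMap, h2, h3, map_add, map_mul, map_pow, map_natCast, ← h1]
  ring

theorem exists_φL_dp {n : ℕ} (hn : n ≠ 0) : ∃ z : A.D, A.φL (A.dp n) = p * (z : A.L) := by
  obtain ⟨c, hc⟩ := A.exists_φL_E
  obtain ⟨r, hr⟩ := A.exists_p_pow_eq hn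
  refine ⟨algebraMap 𝔖 A.D r * c ^ n, A.factorial_cancel (n := n) ?_⟩
  have h1 := congrArg A.φL (A.factorial_mul_dp n)
  have h2 := congrArg (algebraMap 𝔖 A.L) hr
  simp only [map_mul, map_pow, map_natCast] at h1 h2
  have h3 : ((algebraMap 𝔖 A.D r * c ^ n : A.D) : A.L) = algebraMap 𝔖 A.L r * (c : A.L) ^ n := by
    push_cast
    rfl
  rw [h1, hc, mul_pow, h2, h3]
  ring

theorem φL_mem {x : A.L} (hx : x ∈ A.D) : A.φL x ∈ A.D := by
  induction hx using Algebra.adjoin_induction with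
  | mem x hx =>
    obtain ⟨n, rfl⟩ := hx
    rcases eq_or_ne n 0 with rfl | hn
    · rw [dp_zero, map_one]; exact one_mem _
    · obtain ⟨z, hz⟩ := A.exists_φL_dp hn
      rw [hz]
      exact mul_mem (natCast_mem _ _) z.2
  | algebraMap r => rw [φL_algebraMap]; exact A.D.algebraMap_mem _
  | add x y _ _ hx hy => rw [map_add]; exact add_mem hx hy
  | mul x y _ _ hx hy => rw [map_mul]; exact mul_mem hx hy

/-- The extension of `φ` to the divided power envelope. -/
noncomputable def φD : A.D →+* A.D :=
  (A.φL.comp A.D.val.toRingHom).codRestrict A.D fun x => A.φL_mem x.2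

theorem φD_algebraMap (x : 𝔖) : A.φD (algebraMap 𝔖 A.D x) = algebraMap 𝔖 A.D (A.φ x) :=
  Subtype.ext (A.φL_algebraMap x)

theorem p_dvd_φD_of_mem_J {x : A.D} (hx : x ∈ A.J) : (p : A.D) ∣ A.φD x := by
  have hle : A.J ≤ (Ideal.span {(p : A.D)}).comap A.φD := by
    refine Ideal.span_le.2 ?_
    rintro _ ⟨n, hn, rfl⟩
    obtain ⟨z, hz⟩ := A.exists_φL_dp hn
    refine Ideal.mem_span_singleton.2 ⟨z, Subtype.ext ?_⟩
    refine hz.trans ?_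
    push_cast
    rfl
  exact Ideal.mem_span_singleton.1 (hle hx)

theorem p_dvd_pow_of_mem_J {x : A.D} (hx : x ∈ A.J) : (p : A.D) ∣ x ^ p := by
  rw [← A.dividedPowersJ.factorial_mul_dpow_eq_pow hx, ← Nat.mul_factorial_pred hp.out.ne_zero,
    Nat.cast_mul, mul_assoc]
  exact dvd_mul_right _ _

theorem exists_add_mem_J (d : A.D) : ∃ a : 𝔖, d - algebraMap 𝔖 A.D a ∈ A.J := by
  obtain ⟨d, hd⟩ := d
  have key : ∀ d (hd : d ∈ A.D), ∀ h' : d ∈ A.D,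
      ∃ a : 𝔖, (⟨d, h'⟩ : A.D) - algebraMap 𝔖 A.D a ∈ A.J := by
    intro d hd
    refine Algebra.adjoin_induction (p := fun d _ => ∀ h' : d ∈ A.D,
      ∃ a : 𝔖, (⟨d, h'⟩ : A.D) - algebraMap 𝔖 A.D a ∈ A.J) ?_ ?_ ?_ ?_ hd
    · rintro _ ⟨n, rfl⟩ h'
      rcases eq_or_ne n 0 with rfl | hn
      · refine ⟨1, ?_⟩
        have : (⟨A.dp 0, h'⟩ : A.D) = 1 := A.dpD_zero
        rw [this, map_one, sub_self]
        exact zero_mem _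
      · refine ⟨0, ?_⟩
        rw [map_zero, sub_zero]
        exact A.dpD_mem_J hn
    · intro r h'
      exact ⟨r, by
        have : (⟨algebraMap 𝔖 A.L r, h'⟩ : A.D) = algebraMap 𝔖 A.D r := rfl
        rw [this, sub_self]
        exact zero_mem _⟩
    · intro x y hx hy h1 h2 h'
      obtain ⟨a, ha⟩ := h1 hx
      obtain ⟨b, hb⟩ := h2 hy
      refine ⟨a + b, ?_⟩
      have := add_mem ha hb
      rw [map_add]
      convert this using 1
      have e : (⟨x + y, h'⟩ : A.D) = ⟨x, hx⟩ + ⟨y, hy⟩ := rfl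
      rw [e]
      ring
    · intro x y hx hy h1 h2 h'
      obtain ⟨a, ha⟩ := h1 hx
      obtain ⟨b, hb⟩ := h2 hy
      refine ⟨a * b, ?_⟩
      have := add_mem (Ideal.mul_mem_left _ (⟨x, hx⟩ : A.D) hb)
        (Ideal.mul_mem_left _ (algebraMap 𝔖 A.D b) ha)
      rw [map_mul]
      convert this using 1
      have e : (⟨x * y, h'⟩ : A.D) = ⟨x, hx⟩ * ⟨y, hy⟩ := rfl
      rw [e]
      ring
  exact key d hd hd

theorem φD_frob (x : A.D) : (p : A.D) ∣ A.φD x - x ^ p := by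
  obtain ⟨a, ha⟩ := A.exists_add_mem_J x
  set j := x - algebraMap 𝔖 A.D a
  have hx : x = j + algebraMap 𝔖 A.D a := by simp [j]
  obtain ⟨r, hr⟩ := exists_add_pow_prime_eq hp.out j (algebraMap 𝔖 A.D a)
  obtain ⟨u, hu⟩ := A.p_dvd_φD_of_mem_J ha
  obtain ⟨v, hv⟩ := A.p_dvd_pow_of_mem_J ha
  obtain ⟨w, hw⟩ := Ideal.mem_span_singleton.1 (A.φ_frob a)
  have hw' := congrArg (algebraMap 𝔖 A.D) hw
  rw [map_sub, map_pow, map_mul, map_natCast] at hw'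
  refine ⟨u - v + algebraMap 𝔖 A.D w - j * algebraMap 𝔖 A.D a * r, ?_⟩
  rw [hx, hr, map_add, hu, hv, φD_algebraMap]
  linear_combination hw'

theorem D_torsionFree (x y : A.D) (h : (p : A.D) * x = p * y) : x = y := by
  refine Subtype.ext (A.isUnit_p_L.mul_left_cancel ?_)
  have := congrArg (fun z : A.D => (z : A.L)) h
  push_cast at this
  exact this

theorem exists_D_to_R : ∃ g : A.D →ₐ[𝔖] A.R, ∀ n, g (A.dpD n) = if n = 0 then 1 else 0 := by
  refine A.exists_lift _ (if_pos rfl) ?_ ?_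
  · rw [if_neg one_ne_zero]
    exact (Ideal.Quotient.eq_zero_iff_mem.2 (Ideal.mem_span_singleton_self _)).symm
  · intro m n
    rcases eq_or_ne m 0 with rfl | hm
    · simp
    · simp [hm]

/-- The canonical map from the divided power envelope to `R`, which sends `Eⁿ / n!` to zero
for `n ≥ 1`. -/
noncomputable def πD : A.D →ₐ[𝔖] A.R := A.exists_D_to_R.choose

theorem πD_of_mem_J {x : A.D} (hx : x ∈ A.J) : A.πD x = 0 := by
  have hle : A.J ≤ RingHom.ker A.πD := by
    refine Ideal.span_le.2 ?_
    rintro _ ⟨n, hn, rfl⟩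
    exact (A.exists_D_to_R.choose_spec n).trans (if_neg hn)
  exact hle hx

/-- The ring `S`: the `p`-adic completion of the divided power envelope. -/
abbrev S : Type u := AdicCompletion (Ideal.span {(p : A.D)}) A.D

/-- The natural map `S → R`. -/
noncomputable def πS : A.S →+* A.R :=
  completionLift p A.isAdicComplete_R A.πD.toRingHom

theorem πS_algebraMap_D (d : A.D) : A.πS (algebraMap A.D A.S d) = A.πD d :=
  completionLift_algebraMap _ _ _

/-- The natural extension of `φ` to `S`. -/
noncomputable def φS : A.S →+* A.S :=
  completionLift p isAdicComplete_completion ((algebraMap A.D A.S).comp A.φD)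

theorem φS_algebraMap_D (d : A.D) : A.φS (algebraMap A.D A.S d) = algebraMap A.D A.S (A.φD d) :=
  completionLift_algebraMap _ _ _

theorem algebraMap_S (x : 𝔖) :
    algebraMap 𝔖 A.S x = algebraMap A.D A.S (algebraMap 𝔖 A.D x) := rfl

theorem φS_algebraMap (x : 𝔖) : A.φS (algebraMap 𝔖 A.S x) = algebraMap 𝔖 A.S (A.φ x) := by
  rw [algebraMap_S, φS_algebraMap_D, φD_algebraMap, algebraMap_S]

theorem πS_algebraMap (x : 𝔖) : A.πS (algebraMap 𝔖 A.S x) = Ideal.Quotient.mk _ x := by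
  rw [algebraMap_S, πS_algebraMap_D, AlgHom.commutes]
  rfl

theorem p_regular_S {x y : A.S} (h : (p : A.S) * x = p * y) : x = y :=
  completion_torsionFree A.D_torsionFree h

theorem exists_of_πS_eq_zero {x : A.S} (hx : A.πS x = 0) :
    ∃ j ∈ A.J, ∃ y : A.S, x = algebraMap A.D A.S j + p * y := by
  obtain ⟨d, y, rfl⟩ := exists_eq_algebraMap_add x
  obtain ⟨a, ha⟩ := A.exists_add_mem_J d
  have h1 : A.πD d = Ideal.Quotient.mk _ a := by
    have := A.πD_of_mem_J ha
    rw [map_sub, AlgHom.commutes, sub_eq_zero] at this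
    exact this
  obtain ⟨z, hz⟩ := Ideal.Quotient.mk_surjective (A.πS y)
  rw [map_add, map_mul, map_natCast, πS_algebraMap_D, h1, ← hz,
    ← map_natCast (Ideal.Quotient.mk _), ← map_mul, ← map_add, Ideal.Quotient.eq_zero_iff_mem,
    Ideal.mem_span_singleton] at hx
  obtain ⟨w, hw⟩ := hx
  refine ⟨(d - algebraMap 𝔖 A.D a) + A.dpD 1 * algebraMap 𝔖 A.D w,
    add_mem ha (Ideal.mul_mem_right _ _ (A.dpD_mem_J one_ne_zero)),
    y - algebraMap 𝔖 A.S z, ?_⟩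
  have h2 := congrArg (algebraMap 𝔖 A.S) hw
  rw [map_add, map_mul, map_mul, map_natCast] at h2
  rw [dpD_one, map_add, map_sub, map_mul, ← algebraMap_S, ← algebraMap_S, ← algebraMap_S, ← h2]
  ring

theorem φS_frob (x : A.S) : A.φS x - x ^ p ∈ Ideal.span {(p : A.S)} := by
  obtain ⟨d, y, rfl⟩ := exists_eq_algebraMap_add x
  obtain ⟨r, hr⟩ := exists_add_pow_prime_eq hp.out (algebraMap A.D A.S d) (p * y)
  obtain ⟨w, hw⟩ := A.φD_frob d
  have hw' := congrArg (algebraMap A.D A.S) hw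
  rw [map_sub, map_pow, map_mul, map_natCast] at hw'
  obtain ⟨q, hq⟩ : (p : A.S) ∣ (p * y) ^ p := (dvd_mul_right _ _).trans (dvd_pow_self _ hp.out.ne_zero)
  rw [Ideal.mem_span_singleton]
  refine ⟨algebraMap A.D A.S w + A.φS y - q - algebraMap A.D A.S d * (p * y) * r, ?_⟩
  rw [hr, hq, map_add, map_mul, map_natCast, φS_algebraMap_D]
  linear_combination hw'

theorem p_dvd_φS {x : A.S} (hx : x ∈ RingHom.ker A.πS) : (p : A.S) ∣ A.φS x := by
  obtain ⟨j, hj, y, rfl⟩ := A.exists_of_πS_eq_zero hx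
  rw [map_add, map_mul, map_natCast, φS_algebraMap_D]
  refine dvd_add ?_ (dvd_mul_right _ _)
  obtain ⟨u, hu⟩ := A.p_dvd_φD_of_mem_J hj
  rw [hu, map_mul, map_natCast]
  exact dvd_mul_right _ _

theorem S_le_jacobson :
    RingHom.ker A.πS ⊔ Ideal.span {(p : A.S)} ≤ (⊥ : Ideal A.S).jacobson := by
  have hc : IsAdicComplete (Ideal.span {(p : A.S)}) A.S := isAdicComplete_completion
  have hpj : Ideal.span {(p : A.S)} ≤ (⊥ : Ideal A.S).jacobson :=
    IsAdicComplete.le_jacobson_bot _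
  refine sup_le (fun x hx => ?_) hpj
  obtain ⟨j, hj, y, rfl⟩ := A.exists_of_πS_eq_zero hx
  refine add_mem ?_ (hpj (Ideal.mul_mem_right _ _ (Ideal.mem_span_singleton_self _)))
  obtain ⟨u, hu⟩ := A.p_dvd_pow_of_mem_J hj
  have h1 : algebraMap A.D A.S j ^ p ∈ (⊥ : Ideal A.S).jacobson := by
    rw [← map_pow, hu, map_mul, map_natCast]
    exact hpj (Ideal.mul_mem_right _ _ (Ideal.mem_span_singleton_self _))
  exact Ideal.isRadical_jacobson _ ⟨p, h1⟩

/-- The frame `(S, Fil¹ S, R, φ, φ₁, p)` with `Fil¹ S = ker (S → R)` and `φ₁ = p⁻¹ φ`. -/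
noncomputable def frameS : Frame p A.S where
  Fil := RingHom.ker A.πS
  φ := A.φS
  φ_frob := A.φS_frob
  φ₁ :=
    { toFun := fun x => (A.p_dvd_φS x.2).choose
      map_add' := fun x y => by
        refine A.p_regular_S ?_
        rw [mul_add, ← (A.p_dvd_φS (x + y).2).choose_spec, ← (A.p_dvd_φS x.2).choose_spec,
          ← (A.p_dvd_φS y.2).choose_spec, Submodule.coe_add, map_add]
      map_smul' := fun r x => by
        refine A.p_regular_S ?_
        rw [← (A.p_dvd_φS (r • x).2).choose_spec, smul_eq_mul, mul_left_comm,
          ← (A.p_dvd_φS x.2).choose_spec, Submodule.coe_smul, smul_eq_mul, map_mul] }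
  ϖ := p
  φ_eq x := (A.p_dvd_φS x.2).choose_spec
  le_jacobson := A.S_le_jacobson

theorem frameS_torsionFree (x : A.S) (h : (p : A.S) * x ∈ A.frameS.Fil) : x ∈ A.frameS.Fil := by
  change A.πS (p * x) = 0 at h
  change A.πS x = 0
  obtain ⟨z, hz⟩ := Ideal.Quotient.mk_surjective (A.πS x)
  rw [map_mul, map_natCast, ← hz, ← map_natCast (Ideal.Quotient.mk _), ← map_mul,
    Ideal.Quotient.eq_zero_iff_mem, Ideal.mem_span_singleton] at h
  rw [← hz, Ideal.Quotient.eq_zero_iff_mem, Ideal.mem_span_singleton]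
  exact A.dvd_of_p_mul h

theorem E_mem_FilS : algebraMap 𝔖 A.S A.E ∈ A.frameS.Fil := by
  change A.πS _ = 0
  rw [πS_algebraMap]
  exact Ideal.Quotient.eq_zero_iff_mem.2 (Ideal.mem_span_singleton_self _)

/-- The element `c = φ₁(E)` of `S`. -/
noncomputable def c : A.S := A.frameS.φ₁ ⟨algebraMap 𝔖 A.S A.E, A.E_mem_FilS⟩

/-- The homomorphism of frames `λ : 𝔖 → S` given by the natural ring homomorphism and the
element `c = φ₁(E)`, if the latter is a unit. -/
noncomputable def frameHom (hc : IsUnit A.c) : FrameHom A.frame A.frameS where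
  toRingHom := algebraMap 𝔖 A.S
  map_φ := A.φS_algebraMap
  map_fil x hx := by
    obtain ⟨y, rfl⟩ := Ideal.mem_span_singleton.1 hx
    rw [map_mul]
    exact Ideal.mul_mem_right _ _ A.E_mem_FilS
  c := hc.unit
  map_φ₁ x := by
    obtain ⟨x, hx⟩ := x
    obtain ⟨y, rfl⟩ := Ideal.mem_span_singleton.1 hx
    rw [frame_φ₁, IsUnit.unit_spec, mul_comm A.c, c, ← φS_algebraMap]
    refine Eq.trans ?_ (map_smulₛₗ A.frameS.φ₁ (algebraMap 𝔖 A.S y) _)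
    refine congrArg A.frameS.φ₁ (Subtype.ext ?_)
    rw [Submodule.coe_smul, smul_eq_mul, ← map_mul, mul_comm y]
  map_ϖ := by
    refine (A.φS_algebraMap A.E).symm.trans ?_
    rw [IsUnit.unit_spec, mul_comm]
    exact A.frameS.φ_eq ⟨algebraMap 𝔖 A.S A.E, A.E_mem_FilS⟩

/-- The reduction `λₙ` of `λ` modulo `pⁿ`. -/
noncomputable def frameHomMod (hc : IsUnit A.c) (n : ℕ) :
    FrameHom (A.frame.mod A.frame_torsionFree n) (A.frameS.mod A.frameS_torsionFree n) :=
  (A.frameHom hc).mod A.frame_torsionFree A.frameS_torsionFree n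

end Frame


end BreuilKisinDatum

end WindowTheory

/-! For a frame homomorphism `α : S → S'` let `K` be `F'.divKer`, the ideal of those `x` in `Fil S'`
with `φ₁ x ∈ p S'`. Base change is an equivalence by successive approximation as soon as `S' = α(S)
+ K`, the relevant topologies are complete, and `φ₁` is topologically nilpotent on `ker α`. These
conditions are collected in `FrameHom.Contracting`, and `FrameHom.isCrystalline_of_contracting`
draws the conclusion.

Why `K` helps: a linear map with values in `K • W` gains a factor `p` when composed with `Φ₁`, and
also with `Φ = ϖ Φ₁`. A homomorphism `g` of base changes that is defined over `S` up to `pᵏ` can be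
written as `f + pᵏ h` with `f` over `S` and `h` valued in `K`. Since `g` commutes with `Φ` and `Φ₁`,
whose values generate, `g` is defined over `S` up to `pᵏ⁺¹`. As `α(S)` is `p`-adically closed, `g`
comes from an `S`-linear map. That map need not commute with Frobenius, because of `ker α`;
iterating `f ↦ f'`, where `f' Φ₁ = Φ₁ f` and `f' Φ = Φ f`, converges to one that does. The same
nilpotence gives faithfulness.

For essential surjectivity, a normal decomposition of a window `W` over `S'` descends to finite
projective `S`-modules `L` and `N`, since `S / Fil S = S' / Fil S'` and `S` is `Fil S`-adically
complete. A window structure on `L × N` with base change `W` amounts to a semilinear `T : L × N → W`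
and a Frobenius-linear `Ψ` on `L × N` with generating image, such that `theta T = T Ψ`. Here `theta
T` is `c⁻¹ Φ₁ T` on `L` and `Φ T` on `N`. The equation is solved modulo growing powers of `p`: the
part of the error in the image of `T` is absorbed by `Ψ`, the part in `K` by `T` (`exists_descent`).

For `λ` the equality `S = 𝔖 + K` is where `p ≥ 3` enters. Since `φ E` is divisible by `p` in `S`,
`φ(Eⁿ/n!)` is a multiple of `pⁿ/n!`, which for `n ≥ 2` is divisible by `p²`; hence `Eⁿ/n! ∈ K`.
Moreover `p Fil S ⊆ K`. The topologies are compared by `𝔖 ∩ pᵐ S ⊆ (p, E)ᵐ` and `(p, E)^((1+p)k) ⊆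
pᵏ S`, so `𝔖 → S` is injective with closed image. The reductions `λₙ` have a kernel when `n ≥ 1`,
but `φ₁` carries the image of `𝔖 ∩ pⁿ⁺ᵏ S` in `𝔖/pⁿ` into that of `𝔖 ∩ pⁿ⁺ᵏ⁺¹ S`
(`exists_dvd_φ_sub`). -/

namespace WindowTheory

/-! ### Finite projective modules: dual bases, completeness, limits, Nakayama -/

section Modules

/-- A substitute for a basis: semilinear maps out of `M` are built from arbitrary values at the `e
i` by the formula `m ↦ ∑ σ (ℓ i m) • y i`, with no relation to check. -/
theorem exists_dual_basis (S M : Type*) [CommRing S] [AddCommGroup M] [Module S M]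
    [Module.Finite S M] [Module.Projective S M] :
    ∃ (n : ℕ) (e : Fin n → M) (ℓ : Fin n → M →ₗ[S] S), ∀ m, ∑ i, ℓ i m • e i = m := by
  obtain ⟨n, f, g, -, -, hfg⟩ := Module.Finite.exists_comp_eq_id_of_projective S M
  refine ⟨n, fun i => f (Pi.single i 1), fun i => LinearMap.proj i ∘ₗ g, fun m => ?_⟩
  have h1 : f (g m) = m := congrArg (fun h : M →ₗ[S] M => h m) hfg
  have h2 : g m = ∑ i, g m i • (Pi.single i (1 : S) : Fin n → S) := by
    ext j; simp [Finset.sum_apply, Pi.single_apply]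
  rw [h2, map_sum] at h1
  simpa using h1

variable {S S' M M' : Type*} [CommRing S] [CommRing S'] [AddCommGroup M] [Module S M]
  [AddCommGroup M'] [Module S' M']

theorem map_mem_smul_top {σ : S →+* S'} (f : M →ₛₗ[σ] M') {I : Ideal S} {J : Ideal S'}
    (h : ∀ x ∈ I, σ x ∈ J) {m : M} (hm : m ∈ (I • ⊤ : Submodule S M)) :
    f m ∈ (J • ⊤ : Submodule S' M') := by
  induction hm using Submodule.smul_induction_on' with
  | smul r hr n _ => rw [map_smulₛₗ]; exact Submodule.smul_mem_smul (h r hr) trivial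
  | add x _ y _ hx hy => rw [map_add]; exact add_mem hx hy

theorem apply_mem_of_mem_smul_top (f : M →ₗ[S] S) {I : Ideal S} {m : M}
    (hm : m ∈ (I • ⊤ : Submodule S M)) : f m ∈ I := by
  have := map_mem_smul_top f (I := I) (J := I) (fun x hx => hx) hm
  rwa [smul_eq_mul, Ideal.mul_top] at this

theorem mem_span_pow_smul_top_iff {a : S} {k : ℕ} {x : M} :
    x ∈ (Ideal.span {a} ^ k • ⊤ : Submodule S M) ↔ ∃ y, x = a ^ k • y := by
  rw [Ideal.span_singleton_pow, Submodule.ideal_span_singleton_smul,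
    Submodule.mem_smul_pointwise_iff_exists]
  simp [eq_comm]

/-- The coordinates `ℓ i` carry `Iᵏ M` into `Iᵏ`, so limits can be taken coordinatewise in `S` and
reassembled with the `e i`. -/
theorem isAdicComplete_of_projective [Module.Finite S M] [Module.Projective S M] (I : Ideal S)
    [IsAdicComplete I S] : IsAdicComplete I M := by
  obtain ⟨n, e, ℓ, h⟩ := exists_dual_basis S M
  refine { haus' := fun x hx => ?_, prec' := fun f hf => ?_ }
  · rw [← h x]
    refine Finset.sum_eq_zero fun i _ => ?_
    rw [IsHausdorff.haus (I := I) (M := S) inferInstance (ℓ i x) fun k => ?_, zero_smul]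
    have := hx k
    rw [SModEq.zero] at this ⊢
    rw [smul_eq_mul, Ideal.mul_top]
    exact apply_mem_of_mem_smul_top _ this
  · have : ∀ i, ∃ L, ∀ k, ℓ i (f k) ≡ L [SMOD (I ^ k • ⊤ : Submodule S S)] := by
      intro i
      refine IsPrecomplete.prec (I := I) (M := S) inferInstance fun {m k} hmk => ?_
      have := hf hmk
      rw [SModEq.sub_mem] at this ⊢
      rw [smul_eq_mul, Ideal.mul_top, ← map_sub]
      exact apply_mem_of_mem_smul_top _ this
    choose L hL using this
    refine ⟨∑ i, L i • e i, fun k => ?_⟩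
    rw [SModEq.sub_mem, ← h (f k), ← Finset.sum_sub_distrib]
    refine sum_mem fun i _ => ?_
    rw [← sub_smul]
    have := hL i k
    rw [SModEq.sub_mem, smul_eq_mul, Ideal.mul_top] at this
    exact Submodule.smul_mem_smul this trivial

theorem eq_zero_of_forall_mem_pow_smul_top (I : Ideal S) [IsHausdorff I M] {x : M}
    (h : ∀ k, x ∈ (I ^ k • ⊤ : Submodule S M)) : x = 0 :=
  IsHausdorff.haus (I := I) inferInstance x fun k => SModEq.zero.2 (h k)

/-- Limits of sequences of semilinear maps with values in a complete module. -/
theorem exists_limit_semilinear {σ : S →+* S'} (I : Ideal S') [IsAdicComplete I M']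
    (f : ℕ → M →ₛₗ[σ] M')
    (hf : ∀ k x, f (k + 1) x - f k x ∈ (I ^ k • ⊤ : Submodule S' M')) :
    ∃ g : M →ₛₗ[σ] M', ∀ k x, g x - f k x ∈ (I ^ k • ⊤ : Submodule S' M') := by
  have mono : ∀ {m k}, m ≤ k → (I ^ k • ⊤ : Submodule S' M') ≤ I ^ m • ⊤ := fun h =>
    Submodule.smul_mono_left (Ideal.pow_le_pow_right h)
  have hc : ∀ x {m k}, m ≤ k → f m x ≡ f k x [SMOD (I ^ m • ⊤ : Submodule S' M')] := by
    intro x m k hmk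
    rw [SModEq.sub_mem]
    induction k, hmk using Nat.le_induction with
    | base => simp
    | succ k hmk ih =>
      have : f m x - f (k + 1) x = (f m x - f k x) - (f (k + 1) x - f k x) := by abel
      rw [this]
      exact sub_mem ih (mono hmk (hf k x))
  choose g hg using fun x => IsPrecomplete.prec (I := I) (M := M') inferInstance (hc x)
  have hg' : ∀ k x, g x - f k x ∈ (I ^ k • ⊤ : Submodule S' M') := fun k x =>
    SModEq.sub_mem.1 (hg x k).symm
  refine ⟨{ toFun := g, map_add' := fun x y => ?_, map_smul' := fun r x => ?_ }, hg'⟩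
  · rw [← sub_eq_zero]
    refine eq_zero_of_forall_mem_pow_smul_top I fun k => ?_
    have : g (x + y) - (g x + g y) =
        (g (x + y) - f k (x + y)) - (g x - f k x) - (g y - f k y) := by rw [map_add]; abel
    rw [this]
    exact sub_mem (sub_mem (hg' k _) (hg' k _)) (hg' k _)
  · rw [← sub_eq_zero]
    refine eq_zero_of_forall_mem_pow_smul_top I fun k => ?_
    have : g (r • x) - σ r • g x = (g (r • x) - f k (r • x)) - σ r • (g x - f k x) := by
      rw [map_smulₛₗ, smul_sub]; abel
    rw [this]
    exact sub_mem (hg' k _) (Submodule.smul_mem _ _ (hg' k _))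

theorem surjective_of_sub_mem_smul_top [Module.Finite S M] {J : Ideal S}
    (hJ : J ≤ (⊥ : Ideal S).jacobson) {X : Type*} [AddCommGroup X] [Module S X]
    {f g : X →ₗ[S] M} (hf : Function.Surjective f)
    (h : ∀ x, g x - f x ∈ (J • ⊤ : Submodule S M)) : Function.Surjective g := by
  rw [← LinearMap.range_eq_top, eq_top_iff]
  refine Submodule.le_of_le_smul_of_le_jacobson_bot Module.Finite.fg_top hJ fun y _ => ?_
  obtain ⟨x, rfl⟩ := hf y
  rw [← sub_sub_cancel (g x) (f x)]
  exact sub_mem (Submodule.mem_sup_left ⟨x, rfl⟩) (Submodule.mem_sup_right (h x))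

/-- Transported along `f`, the map `g` becomes an endomorphism of `M` congruent to the identity. It
is surjective by Nakayama, and a surjective endomorphism of a finite module is injective. -/
theorem bijective_of_sub_mem_smul_top [Module.Finite S M] {J : Ideal S}
    (hJ : J ≤ (⊥ : Ideal S).jacobson) {X : Type*} [AddCommGroup X] [Module S X]
    {f g : X →ₗ[S] M} (hf : Function.Bijective f)
    (h : ∀ x, g x - f x ∈ (J • ⊤ : Submodule S M)) : Function.Bijective g := by
  let e := LinearEquiv.ofBijective f hf
  have hs : Function.Surjective (g ∘ₗ e.symm.toLinearMap) := by
    refine surjective_of_sub_mem_smul_top hJ (f := LinearMap.id) (fun x => ⟨x, rfl⟩) fun x => ?_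
    have := h (e.symm x)
    rwa [show f (e.symm x) = x from e.apply_symm_apply x] at this
  have hb := OrzechProperty.bijective_of_surjective_endomorphism _ hs
  have : g = (g ∘ₗ e.symm.toLinearMap) ∘ₗ e.toLinearMap := by ext x; simp
  rw [this, LinearMap.coe_comp]
  exact hb.comp e.bijective

end Modules

/-! ### Linear extension along Frobenius-linear maps with generating image -/

section Frobenius

/-- A semilinear map `Ψ : M → N` of finite projective modules whose image generates `N` identifies
`N` with the base change of `M`, if the ranks match. -/
theorem existsUnique_comp_eq_of_rankAtStalk {R R' : Type u} [CommRing R] [CommRing R']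
    {σ : R →+* R'} {M N P : Type u} [AddCommGroup M] [Module R M] [Module.Finite R M]
    [Module.Projective R M] [AddCommGroup N] [Module R' N] [Module.Finite R' N]
    [Module.Projective R' N] [AddCommGroup P] [Module R' P] (Ψ : M →ₛₗ[σ] N)
    (hΨ : Submodule.span R' (Set.range Ψ) = ⊤)
    (hr : ∀ (m : Ideal R') [m.IsMaximal], Module.rankAtStalk N ⟨m, inferInstance⟩ =
      Module.rankAtStalk M (PrimeSpectrum.comap σ ⟨m, inferInstance⟩))
    (z : M →ₛₗ[σ] P) : ∃! τ : N →ₗ[R'] P, ∀ m, τ (Ψ m) = z m := by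
  let _ : Algebra R R' := σ.toAlgebra
  let _ : Module R N := Module.compHom N σ
  let _ : Module R P := Module.compHom P σ
  have _ : IsScalarTower R R' N := ⟨fun r s x => mul_smul (σ r) s x⟩
  have _ : IsScalarTower R R' P := ⟨fun r s x => mul_smul (σ r) s x⟩
  let Ψ' : M →ₗ[R] N := { toFun := Ψ, map_add' := map_add Ψ, map_smul' := fun r x => map_smulₛₗ Ψ r x }
  let z' : M →ₗ[R] P := { toFun := z, map_add' := map_add z, map_smul' := fun r x => map_smulₛₗ z r x }
  let Ψb : R' ⊗[R] M →ₗ[R'] N := Ψ'.liftBaseChange R'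
  have h1 : ∀ m, Ψb (1 ⊗ₜ m) = Ψ m := fun m => by simp [Ψb, Ψ']
  have hs : Function.Surjective Ψb := by
    rw [← LinearMap.range_eq_top, eq_top_iff, ← hΨ, Submodule.span_le]
    rintro _ ⟨m, rfl⟩
    exact ⟨1 ⊗ₜ m, h1 m⟩
  have hb : Function.Bijective Ψb := by
    -- A surjection of finite projective modules with equal ranks at the maximal ideals is an
    -- isomorphism.
    refine Module.bijective_of_surjective_of_rankAtStalk_eq hs fun m _ => ?_
    rw [Module.rankAtStalk_baseChange, hr]
    rfl
  let e := LinearEquiv.ofBijective Ψb hb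
  refine ⟨z'.liftBaseChange R' ∘ₗ e.symm.toLinearMap, fun m => ?_, fun τ hτ => ?_⟩
  · have : e.symm (Ψ m) = 1 ⊗ₜ m := by rw [LinearEquiv.symm_apply_eq]; exact (h1 m).symm
    simp [this, z']
  · refine LinearMap.ext_on_range hΨ fun m => ?_
    have : e.symm (Ψ m) = 1 ⊗ₜ m := by rw [LinearEquiv.symm_apply_eq]; exact (h1 m).symm
    simp [this, z', hτ]

/-- Linear extension along a Frobenius-linear map whose image generates. -/
theorem existsUnique_comp_eq {p : ℕ} {S : Type u} [CommRing S] (F : Frame p S)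
    (hp : p ≠ 0) {M P : Type u} [AddCommGroup M] [Module S M] [Module.Finite S M]
    [Module.Projective S M] [AddCommGroup P] [Module S P] (Ψ : M →ₛₗ[F.φ] M)
    (hΨ : Submodule.span S (Set.range Ψ) = ⊤) (z : M →ₛₗ[F.φ] P) :
    ∃! τ : M →ₗ[S] P, ∀ m, τ (Ψ m) = z m := by
  refine existsUnique_comp_eq_of_rankAtStalk Ψ hΨ (fun m hm => ?_) z
  have hpm : Ideal.span {(p : S)} ≤ m := (le_sup_right.trans F.le_jacobson).trans
    (sInf_le ⟨bot_le, hm⟩)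
  -- Each maximal ideal `m` contains `p`, so `φ x ≡ xᵖ` modulo `m` and the preimage of `m` under `φ`
  -- is `m` itself. Hence the ranks of `M` and of its Frobenius twist agree at `m`.
  refine congrArg _ (PrimeSpectrum.ext ?_)
  ext x
  have h := hpm (F.φ_frob x)
  refine ⟨fun hx => ?_, fun hx => ?_⟩
  · change F.φ x ∈ m
    have := add_mem h (Ideal.pow_mem_of_mem m hx p (Nat.pos_of_ne_zero hp))
    simpa using this
  · have hx' : F.φ x ∈ m := hx
    have := sub_mem hx' h
    rw [sub_sub_cancel] at this
    exact hm.isPrime.mem_of_pow_mem _ this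

/-- Semilinear version of `existsUnique_comp_eq`. -/
theorem exists_semilinear_comp_eq {p : ℕ} {S S' : Type u} [CommRing S] [CommRing S']
    (F : Frame p S) (hp : p ≠ 0) {σ : S →+* S'} {M P : Type u} [AddCommGroup M] [Module S M]
    [Module.Finite S M] [Module.Projective S M] [AddCommGroup P] [Module S' P] (Ψ : M →ₛₗ[F.φ] M)
    (hΨ : Submodule.span S (Set.range Ψ) = ⊤) (z : M →ₛₗ[σ.comp F.φ] P) :
    ∃ τ : M →ₛₗ[σ] P, ∀ m, τ (Ψ m) = z m := by
  let _ : Module S P := Module.compHom P σ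
  let z' : M →ₛₗ[F.φ] P :=
    { toFun := z, map_add' := map_add z, map_smul' := fun r x => map_smulₛₗ z r x }
  obtain ⟨τ, hτ, -⟩ := existsUnique_comp_eq F hp Ψ hΨ z'
  exact ⟨{ toFun := τ, map_add' := map_add τ, map_smul' := fun r x => map_smul τ r x }, hτ⟩

end Frobenius

/-! ### Lifting idempotents in noncommutative algebras -/

section Idempotents

theorem mul_mem_smul_top {S V : Type*} [CommRing S] [Ring V] [Algebra S V] {I J : Ideal S}
    {x y : V} (hx : x ∈ (I • ⊤ : Submodule S V)) (hy : y ∈ (J • ⊤ : Submodule S V)) :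
    x * y ∈ ((I * J) • ⊤ : Submodule S V) := by
  induction hx using Submodule.smul_induction_on' with
  | smul r hr n _ =>
    rw [smul_mul_assoc, Submodule.mul_smul]
    exact Submodule.smul_mem_smul hr
      (map_mem_smul_top (LinearMap.mulLeft S n) (fun x hx => hx) hy)
  | add x _ y _ hx hy => rw [add_mul]; exact add_mem hx hy

theorem mul_mem_smul_top_left {S V : Type*} [CommRing S] [Ring V] [Algebra S V] {I : Ideal S}
    (x : V) {y : V} (hy : y ∈ (I • ⊤ : Submodule S V)) : x * y ∈ (I • ⊤ : Submodule S V) :=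
  map_mem_smul_top (LinearMap.mulLeft S x) (fun _ hx => hx) hy

theorem mul_mem_smul_top_right {S V : Type*} [CommRing S] [Ring V] [Algebra S V] {I : Ideal S}
    {x : V} (y : V) (hx : x ∈ (I • ⊤ : Submodule S V)) : x * y ∈ (I • ⊤ : Submodule S V) :=
  map_mem_smul_top (LinearMap.mulRight S y) (fun _ hx => hx) hx

/-- Idempotents lift along complete ideals, in a not necessarily commutative algebra. -/
theorem exists_isIdempotentElem_sub_mem {S V : Type*} [CommRing S] [Ring V] [Algebra S V]
    (I : Ideal S) [IsAdicComplete I V] (x : V) (hx : x * x - x ∈ (I • ⊤ : Submodule S V)) :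
    ∃ e : V, IsIdempotentElem e ∧ e - x ∈ (I • ⊤ : Submodule S V) := by
  -- The Newton iteration `e ↦ 3e² - 2e³` for the equation `e² = e`.
  let s : ℕ → V := fun k => (fun e => 3 * (e * e) - 2 * (e * e * e))^[k] x
  have hs : ∀ k, s (k + 1) = 3 * (s k * s k) - 2 * (s k * s k * s k) := fun k =>
    Function.iterate_succ_apply' _ _ _
  have mono : ∀ {m k}, m ≤ k → (I ^ k • ⊤ : Submodule S V) ≤ I ^ m • ⊤ := fun h =>
    Submodule.smul_mono_left (Ideal.pow_le_pow_right h)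
  have hd : ∀ k, s k * s k - s k ∈ (I ^ (k + 1) • ⊤ : Submodule S V) := by
    intro k
    induction k with
    | zero => simpa [s] using hx
    | succ k ih =>
      -- The new defect is a multiple of the square of the old one. Only powers of the single
      -- element `s k` occur, so noncommutativity of `V` is harmless.
      have e1 : s (k + 1) * s (k + 1) - s (k + 1) =
          (s k * s k - s k) * (s k * s k - s k) * (4 * (s k * s k) - 4 * s k - 3) := by
        rw [hs]; noncomm_ring
      rw [e1]
      refine mul_mem_smul_top_right _ (mono (m := k + 2) (k := (k + 1) + (k + 1)) (by omega) ?_)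
      rw [pow_add]
      exact mul_mem_smul_top ih ih
  have hstep : ∀ k, s (k + 1) - s k ∈ (I ^ (k + 1) • ⊤ : Submodule S V) := by
    intro k
    have e1 : s (k + 1) - s k = (1 - 2 * s k) * (s k * s k - s k) := by rw [hs]; noncomm_ring
    rw [e1]
    exact mul_mem_smul_top_left _ (hd k)
  obtain ⟨g, hg⟩ := exists_limit_semilinear (σ := RingHom.id S) I
    (fun k => LinearMap.toSpanSingleton S V (s k)) (fun k r => by
      rw [LinearMap.toSpanSingleton_apply, LinearMap.toSpanSingleton_apply, ← smul_sub]
      exact Submodule.smul_mem _ _ (mono k.le_succ (hstep k)))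
  have hg1 : ∀ k, g 1 - s k ∈ (I ^ k • ⊤ : Submodule S V) := fun k => by
    simpa using hg k 1
  refine ⟨g 1, ?_, ?_⟩
  · rw [IsIdempotentElem, ← sub_eq_zero]
    refine eq_zero_of_forall_mem_pow_smul_top I fun k => ?_
    have : g 1 * g 1 - g 1 = (g 1 - s k) * g 1 + s k * (g 1 - s k) - (g 1 - s k) +
        (s k * s k - s k) := by noncomm_ring
    rw [this]
    exact add_mem (sub_mem (add_mem (mul_mem_smul_top_right _ (hg1 k))
      (mul_mem_smul_top_left _ (hg1 k))) (hg1 k)) (mono k.le_succ (hd k))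
  · have := add_mem (hg1 1) (hstep 0)
    rw [zero_add, sub_add_sub_cancel, pow_one] at this
    exact this

end Idempotents

/-! ### Base change of modules, and descent of projective modules -/

section BaseChange

variable {S S' : Type u} [CommRing S] [CommRing S'] [Algebra S S']
  {M W : Type u} [AddCommGroup M] [Module S M] [AddCommGroup W] [Module S' W]

/-- The linear extension `s ⊗ m ↦ s • T m` of a semilinear map `T`. -/
noncomputable def linearExt (T : M →ₛₗ[algebraMap S S'] W) : S' ⊗[S] M →ₗ[S'] W where
  toFun := TensorProduct.liftAddHom
    (AddMonoidHom.mk' (fun s' : S' => AddMonoidHom.mk' (fun m : M => s' • T m)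
      (fun a b => by rw [map_add, smul_add]))
      (fun a b => by ext m; simp [add_smul]))
    (fun r s' m => by
      simp only [AddMonoidHom.mk'_apply, map_smulₛₗ]
      rw [Algebra.smul_def, mul_smul, smul_comm])
  map_add' x y := map_add _ x y
  map_smul' r x := by
    induction x with
    | zero => simp
    | add x y hx hy => simp only [smul_add, map_add, hx, hy]
    | tmul s m => simp [smul_tmul', mul_smul]

@[simp]
theorem linearExt_tmul (T : M →ₛₗ[algebraMap S S'] W) (s : S') (m : M) :
    linearExt T (s ⊗ₜ[S] m) = s • T m := rfl

/-- The map `m ↦ 1 ⊗ m` as a semilinear map. -/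
def oneTmul (S') [CommRing S'] [Algebra S S'] (M : Type u) [AddCommGroup M] [Module S M] :
    M →ₛₗ[algebraMap S S'] S' ⊗[S] M where
  toFun m := 1 ⊗ₜ m
  map_add' x y := tmul_add _ _ _
  map_smul' r x := by rw [tmul_smul, algebraMap_smul]

theorem tmul_eq_smul_one_tmul (s : S') (m : M) : s ⊗ₜ[S] m = s • ((1 : S') ⊗ₜ[S] m) := by
  rw [smul_tmul', smul_eq_mul, mul_one]

theorem one_tmul_smul (s : S) (m : M) :
    (1 : S') ⊗ₜ[S] (s • m) = algebraMap S S' s • ((1 : S') ⊗ₜ[S] m) :=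
  (oneTmul S' M).map_smulₛₗ s m

theorem linearMap_ext_one_tmul {f g : S' ⊗[S] M →ₗ[S'] W} (h : ∀ m, f (1 ⊗ₜ m) = g (1 ⊗ₜ m)) :
    f = g :=
  LinearMap.ext fun x => semilinear_ext_one_tmul h x

theorem forall_mem_of_forall_one_tmul {f : S' ⊗[S] M →ₗ[S'] W} {U : Submodule S' W}
    (h : ∀ m, f (1 ⊗ₜ m) ∈ U) (x : S' ⊗[S] M) : f x ∈ U := by
  induction x with
  | zero => rw [map_zero]; exact zero_mem _
  | add x y hx hy => rw [map_add]; exact add_mem hx hy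
  | tmul s m => rw [tmul_eq_smul_one_tmul, map_smul]; exact U.smul_mem _ (h m)

/-- Extension of linear forms to the base change. -/
noncomputable def coord (S') [CommRing S'] [Algebra S S'] (ℓ : M →ₗ[S] S) : S' ⊗[S] M →ₗ[S'] S' :=
  (Algebra.linearMap S S' ∘ₗ ℓ).liftBaseChange S'

@[simp]
theorem coord_one_tmul (ℓ : M →ₗ[S] S) (m : M) : coord S' ℓ (1 ⊗ₜ m) = algebraMap S S' (ℓ m) := by
  simp [coord]

theorem sum_coord_smul {n : ℕ} {e : Fin n → M} {ℓ : Fin n → M →ₗ[S] S}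
    (h : ∀ m, ∑ i, ℓ i m • e i = m) (x : S' ⊗[S] M) :
    ∑ i, coord S' (ℓ i) x • ((1 : S') ⊗ₜ[S] e i) = x := by
  induction x with
  | zero => simp
  | add x y hx hy => simp only [map_add, add_smul, Finset.sum_add_distrib, hx, hy]
  | tmul s m =>
    rw [tmul_eq_smul_one_tmul]
    conv_rhs => rw [← h m]
    simp only [map_smul, smul_eq_mul, coord_one_tmul, mul_smul, tmul_sum, one_tmul_smul,
      Finset.smul_sum]

/-- All coordinates of `m` in a dual basis die in `S'`, hence lie in the kernel. -/
theorem mem_ker_smul_top_of_one_tmul_eq_zero [Module.Finite S M] [Module.Projective S M] {m : M}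
    (h : (1 : S') ⊗ₜ[S] m = 0) : m ∈ (RingHom.ker (algebraMap S S') • ⊤ : Submodule S M) := by
  obtain ⟨n, e, ℓ, hℓ⟩ := exists_dual_basis S M
  rw [← hℓ m]
  refine sum_mem fun i _ => Submodule.smul_mem_smul ?_ trivial
  rw [RingHom.mem_ker, ← coord_one_tmul, h, map_zero]

/-- Finite projective modules descend along a ring homomorphism `S → S'` which becomes an
isomorphism modulo ideals `I`, `J`, if `S` is `I`-adically complete and `J` lies in the Jacobson
radical. -/
theorem exists_projective_descent {I : Ideal S} {J : Ideal S'} [IsAdicComplete I S]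
    (hJ : J ≤ (⊥ : Ideal S').jacobson) (h1 : ∀ a, algebraMap S S' a ∈ J → a ∈ I)
    (h1' : ∀ a ∈ I, algebraMap S S' a ∈ J)
    (h2 : ∀ b, ∃ a, b - algebraMap S S' a ∈ J) [Module.Finite S' W] [Module.Projective S' W] :
    ∃ (L : Type u) (_ : AddCommGroup L) (_ : Module S L) (_ : Module.Finite S L)
      (_ : Module.Projective S L) (T : L →ₛₗ[algebraMap S S'] W),
      Function.Bijective (linearExt T) := by
  obtain ⟨n, e, ℓ, hℓ⟩ := exists_dual_basis S' W
  choose a ha using h2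
  -- `W` is the image of the idempotent matrix `ℓ i (e j)` over `S'`. Its entries are lifted to `S`
  -- modulo `J`; the lift is idempotent modulo `I`, and is then corrected to a true idempotent `P`,
  -- whose image is the descended module.
  let X : Matrix (Fin n) (Fin n) S := fun i j => a (ℓ i (e j))
  have hX : X * X - X ∈ (I • ⊤ : Submodule S (Matrix (Fin n) (Fin n) S)) := by
    rw [Matrix.matrix_eq_sum_single (X * X - X)]
    refine sum_mem fun i _ => sum_mem fun j _ => ?_
    rw [← mul_one ((X * X - X) i j), ← smul_eq_mul, ← Matrix.smul_single]
    refine Submodule.smul_mem_smul (h1 _ ?_) trivial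
    have e1 : ℓ i (e j) = ∑ k, ℓ i (e k) * ℓ k (e j) := by
      conv_lhs => rw [← hℓ (e j)]
      simp only [map_sum, map_smul, smul_eq_mul, mul_comm]
    have e2 : algebraMap S S' ((X * X - X) i j) =
        (ℓ i (e j) - algebraMap S S' (X i j)) - ∑ k, (ℓ i (e k) * (ℓ k (e j) -
          algebraMap S S' (X k j)) + (ℓ i (e k) - algebraMap S S' (X i k)) *
            algebraMap S S' (X k j)) := by
      rw [Matrix.sub_apply, Matrix.mul_apply, map_sub, map_sum]
      simp only [map_mul, mul_sub, sub_mul, sub_add_sub_cancel, Finset.sum_sub_distrib]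
      rw [← e1]
      ring
    rw [e2]
    exact sub_mem (ha _) (sum_mem fun k _ => add_mem (Ideal.mul_mem_left _ _ (ha _))
      (Ideal.mul_mem_right _ _ (ha _)))
  have := isAdicComplete_of_projective (M := Matrix (Fin n) (Fin n) S) I
  obtain ⟨P, hP, hPX⟩ := exists_isIdempotentElem_sub_mem I X hX
  have hPE : ∀ i j, algebraMap S S' (P i j) - ℓ i (e j) ∈ J := by
    intro i j
    have h3 : (P - X) i j ∈ I := apply_mem_of_mem_smul_top
      ((LinearMap.proj j : (Fin n → S) →ₗ[S] S) ∘ₗ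
        (LinearMap.proj i : (Fin n → Fin n → S) →ₗ[S] (Fin n → S))) hPX
    have h4 := sub_mem (h1' _ h3) (ha (ℓ i (e j)))
    have e3 : algebraMap S S' (P i j) - ℓ i (e j) = algebraMap S S' ((P - X) i j) -
        (ℓ i (e j) - algebraMap S S' (a (ℓ i (e j)))) := by
      rw [Matrix.sub_apply, map_sub]; ring
    rwa [e3]
  let f : (Fin n → S) →ₗ[S] (Fin n → S) := Matrix.toLin' P
  have hff : ∀ v, f (f v) = f v := fun v => by
    rw [← LinearMap.comp_apply, ← Matrix.toLin'_mul, hP]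
  let L := LinearMap.range f
  have hL : ∀ v : L, f v = v := by
    rintro ⟨_, v, rfl⟩; exact hff v
  have : Module.Projective S L := Module.Projective.of_split L.subtype f.rangeRestrict (by
    ext v; exact congrFun (hL v) _)
  let T : L →ₛₗ[algebraMap S S'] W :=
    { toFun := fun v => ∑ i, algebraMap S S' (v.1 i) • e i
      map_add' := fun v w => by simp [add_smul, Finset.sum_add_distrib]
      map_smul' := fun r v => by simp [mul_smul, Finset.smul_sum] }
  have hT : ∀ v : L, T v = ∑ i, algebraMap S S' (v.1 i) • e i := fun v => rfl
  let δ : Fin n → L := fun i => ⟨f (Pi.single i 1), _, rfl⟩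
  have hδ : ∀ i j, (δ i).1 j = P j i := fun i j => by simp [δ, f]
  have hδs : ∀ v : L, ∑ i, v.1 i • δ i = v := fun v => by
    refine Subtype.ext ?_
    conv_rhs => rw [← hL v]
    ext j
    simp [hδ, f, Matrix.mulVec, dotProduct, Finset.sum_apply, mul_comm]
  -- An approximate inverse of `linearExt T`: both composites are congruent to the identity modulo
  -- `J`, because `P` and `ℓ i (e j)` agree modulo `J`. Both are therefore bijective.
  let Q : W →ₗ[S'] S' ⊗[S] L := ∑ i, (ℓ i).smulRight ((1 : S') ⊗ₜ[S] δ i)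
  have hQ : ∀ w, Q w = ∑ i, ℓ i w • ((1 : S') ⊗ₜ[S] δ i) := fun w => by simp [Q]
  have hTQ : Function.Bijective (linearExt T ∘ₗ Q) := by
    refine bijective_of_sub_mem_smul_top hJ (f := LinearMap.id) Function.bijective_id fun w => ?_
    have e4 : (linearExt T ∘ₗ Q) w = ∑ i, ∑ j, (ℓ i w * algebraMap S S' (P j i)) • e j := by
      simp only [LinearMap.comp_apply, hQ, map_sum, map_smul, linearExt_tmul, hT, hδ,
        Finset.smul_sum, smul_smul, one_mul]
    have e5 : w = ∑ i, ∑ j, (ℓ i w * ℓ j (e i)) • e j := by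
      conv_lhs => rw [← hℓ w]
      refine Finset.sum_congr rfl fun i _ => ?_
      conv_lhs => rw [← hℓ (e i)]
      simp only [Finset.smul_sum, smul_smul]
    have e6 : (linearExt T ∘ₗ Q) w - (LinearMap.id : W →ₗ[S'] W) w =
        ∑ i, ∑ j, (ℓ i w * (algebraMap S S' (P j i) - ℓ j (e i))) • e j := by
      simp only [mul_sub, sub_smul, Finset.sum_sub_distrib]
      rw [e4, ← e5, LinearMap.id_apply]
    rw [e6]
    exact sum_mem fun i _ => sum_mem fun j _ =>
      Submodule.smul_mem_smul (Ideal.mul_mem_left _ _ (hPE j i)) trivial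
  have hQT : Function.Bijective (Q ∘ₗ linearExt T) := by
    refine bijective_of_sub_mem_smul_top hJ (f := LinearMap.id) Function.bijective_id fun w => ?_
    rw [← LinearMap.sub_apply]
    refine forall_mem_of_forall_one_tmul (fun v => ?_) w
    have e4 : (Q ∘ₗ linearExt T) (1 ⊗ₜ v) =
        ∑ i, ∑ j, (algebraMap S S' (v.1 j) * ℓ i (e j)) • ((1 : S') ⊗ₜ[S] δ i) := by
      simp only [LinearMap.comp_apply, linearExt_tmul, one_smul, hT, hQ, map_sum, map_smul,
        smul_eq_mul, Finset.sum_smul]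
    have e5 : (1 : S') ⊗ₜ[S] v =
        ∑ i, ∑ j, (algebraMap S S' (v.1 j) * algebraMap S S' (P i j)) • ((1 : S') ⊗ₜ[S] δ i) := by
      conv_lhs => rw [← hδs v, tmul_sum]
      refine Finset.sum_congr rfl fun i _ => ?_
      rw [one_tmul_smul, ← Finset.sum_smul]
      congr 1
      simp only [← map_mul, ← map_sum]
      congr 1
      conv_lhs => rw [← hL v]
      simp [f, Matrix.mulVec, dotProduct, mul_comm]
    have e6 : (Q ∘ₗ linearExt T) ((1 : S') ⊗ₜ[S] v) - (1 : S') ⊗ₜ[S] v =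
        ∑ i, ∑ j, (algebraMap S S' (v.1 j) *
          (ℓ i (e j) - algebraMap S S' (P i j))) • ((1 : S') ⊗ₜ[S] δ i) := by
      refine (congrArg₂ (· - ·) e4 e5).trans ?_
      rw [← Finset.sum_sub_distrib]
      refine Finset.sum_congr rfl fun i _ => ?_
      rw [← Finset.sum_sub_distrib]
      refine Finset.sum_congr rfl fun j _ => ?_
      rw [mul_sub]
      exact (sub_smul (algebraMap S S' (v.1 j) * ℓ i (e j))
        (algebraMap S S' (v.1 j) * algebraMap S S' (P i j)) ((1 : S') ⊗ₜ[S] δ i)).symm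
    rw [LinearMap.sub_apply, LinearMap.id_apply, e6]
    refine sum_mem fun i _ => sum_mem fun j _ =>
      Submodule.smul_mem_smul (Ideal.mul_mem_left _ _ ?_) trivial
    rw [← neg_sub]
    exact neg_mem (hPE i j)
  refine ⟨L, inferInstance, inferInstance, inferInstance, inferInstance, T, ?_, ?_⟩
  · exact Function.Injective.of_comp hQT.1
  · exact Function.Surjective.of_comp hTQ.2

end BaseChange

/-! ### Windows, contracting frame homomorphisms, faithfulness -/

section Windows

variable {p : ℕ} {S : Type u} [CommRing S] {F : Frame p S}

/-- The ideal of all `x ∈ Fil¹ S` such that `φ₁ x` is divisible by `p`. -/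
def Frame.divKer (F : Frame p S) : Ideal S where
  carrier := {x | ∃ h : x ∈ F.Fil, F.φ₁ ⟨x, h⟩ ∈ Ideal.span {(p : S)}}
  add_mem' := by
    rintro x y ⟨hx, hx'⟩ ⟨hy, hy'⟩
    exact ⟨add_mem hx hy, by
      have := add_mem hx' hy'
      rwa [← map_add] at this⟩
  zero_mem' := ⟨zero_mem _, by
    have : F.φ₁ ⟨0, zero_mem _⟩ = 0 := map_zero F.φ₁
    rw [this]
    exact zero_mem _⟩
  smul_mem' := by
    rintro a x ⟨hx, hx'⟩
    refine ⟨Ideal.mul_mem_left _ _ hx, ?_⟩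
    have : F.φ₁ ⟨a * x, Ideal.mul_mem_left _ _ hx⟩ = F.φ a * F.φ₁ ⟨x, hx⟩ :=
      map_smulₛₗ F.φ₁ a ⟨x, hx⟩
    change F.φ₁ ⟨a * x, _⟩ ∈ _
    rw [this]
    exact Ideal.mul_mem_left _ _ hx'

theorem Frame.divKer_le : F.divKer ≤ F.Fil := fun _ h => h.1

namespace Window

variable (A : Window F)

/-- The linear forms are the coordinates of the `N`-component of a normal decomposition: `L` imposes
no condition on elements of `Fil M`. This reduces membership in `Fil M` to membership in `Fil S`. -/
theorem exists_fil_coords :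
    ∃ (n : ℕ) (ℓ : Fin n → A.M →ₗ[S] S), ∀ x, x ∈ A.Fil ↔ ∀ i, ℓ i x ∈ F.Fil := by
  obtain ⟨L, N, hc, hF⟩ := A.normal
  obtain ⟨n, e, ℓ, hℓ⟩ := exists_dual_basis S A.M
  let πN : A.M →ₗ[S] A.M := N.projection L hc.symm
  have hsum : ∀ m, L.projection N hc m + πN m = m := fun m =>
    Submodule.projection_add_projection_eq_self hc m
  refine ⟨n, fun i => ℓ i ∘ₗ πN, fun x => ⟨fun hx i => ?_, fun hx => ?_⟩⟩
  · rw [hF] at hx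
    obtain ⟨l, hl, y, hy, rfl⟩ := Submodule.mem_sup.1 hx
    have h0 : πN l = 0 := (Submodule.projection_apply_eq_zero_iff hc.symm).2 hl
    rw [map_add, LinearMap.comp_apply, h0, map_zero, zero_add]
    exact apply_mem_of_mem_smul_top _ (Submodule.smul_mono le_rfl le_top hy)
  · rw [← hsum x]
    refine add_mem (hF ▸ Submodule.mem_sup_left (Submodule.projection_apply_mem hc x))
      (A.smul_top_le ?_)
    rw [← hℓ (πN x)]
    exact sum_mem fun i _ => Submodule.smul_mem_smul (hx i) trivial

theorem Φ₁_mem_smul_top {𝔞 𝔠 : Ideal S} (h : ∀ x ∈ 𝔞, ∃ h : x ∈ F.Fil, F.φ₁ ⟨x, h⟩ ∈ 𝔠) {x : A.M}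
    (hx : x ∈ (𝔞 • ⊤ : Submodule S A.M)) :
    ∃ h : x ∈ A.Fil, A.Φ₁ ⟨x, h⟩ ∈ (𝔠 • ⊤ : Submodule S A.M) := by
  induction hx using Submodule.smul_induction_on' with
  | smul r hr n _ =>
    obtain ⟨h1, h2⟩ := h r hr
    refine ⟨A.smul_top_le (Submodule.smul_mem_smul h1 trivial), ?_⟩
    rw [A.Φ₁_smul ⟨r, h1⟩]
    exact Submodule.smul_mem_smul h2 trivial
  | add x _ y _ hx hy =>
    obtain ⟨hx, hx'⟩ := hx
    obtain ⟨hy, hy'⟩ := hy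
    refine ⟨add_mem hx hy, ?_⟩
    have := add_mem hx' hy'
    rwa [← map_add] at this

theorem fil_hom_ext {T P : Type*} [CommRing T] {σ : S →+* T} [AddCommGroup P] [Module T P]
    {L N : Submodule S A.M} (hF : A.Fil = L ⊔ F.Fil • N) {f g : A.Fil →ₛₗ[σ] P}
    (h1 : ∀ l (hl : l ∈ A.Fil), l ∈ L → f ⟨l, hl⟩ = g ⟨l, hl⟩)
    (h2 : ∀ s ∈ F.Fil, ∀ n ∈ N, ∀ h : s • n ∈ A.Fil, f ⟨s • n, h⟩ = g ⟨s • n, h⟩) : f = g := by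
  have hle : F.Fil • N ≤ A.Fil := hF ▸ le_sup_right
  have key : ∀ y (hy : y ∈ F.Fil • N), f ⟨y, hle hy⟩ = g ⟨y, hle hy⟩ := by
    intro y hy
    induction hy using Submodule.smul_induction_on' with
    | smul r hr n hn => exact h2 r hr n hn _
    | add x hx y hy ihx ihy =>
      have e : (⟨x + y, hle (add_mem hx hy)⟩ : A.Fil) = ⟨x, hle hx⟩ + ⟨y, hle hy⟩ := rfl
      rw [e, map_add, map_add, ihx, ihy]
  ext ⟨x, hx⟩
  obtain ⟨l, hl, y, hy, rfl⟩ := Submodule.mem_sup.1 (hF ▸ hx)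
  have hl' : l ∈ A.Fil := hF ▸ Submodule.mem_sup_left hl
  have e : (⟨l + y, hx⟩ : A.Fil) = ⟨l, hl'⟩ + ⟨y, hle hy⟩ := rfl
  rw [e, map_add, map_add, h1 l hl' hl, key y hy]

/-- Pairs of Frobenius-linear maps which satisfy the same relations as `Φ` and `Φ₁` factor through
`Φ` and `Φ₁`. -/
theorem exists_linear_comp_eq (hp : p ≠ 0) {P : Type u} [AddCommGroup P] [Module S P]
    (u : A.M →ₛₗ[F.φ] P) (v : A.Fil →ₛₗ[F.φ] P)
    (h1 : ∀ (s : F.Fil) (m : A.M) (h : (s : S) • m ∈ A.Fil),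
      v ⟨(s : S) • m, h⟩ = F.φ₁ s • u m)
    (h2 : ∀ m : A.Fil, u m = F.ϖ • v m) :
    ∃ τ : A.M →ₗ[S] P, (∀ m, τ (A.Φ m) = u m) ∧ ∀ x, τ (A.Φ₁ x) = v x := by
  obtain ⟨L, N, hc, hF⟩ := A.normal
  have hLF : L ≤ A.Fil := hF ▸ le_sup_left
  have hL : ∀ m, L.projection N hc m ∈ A.Fil := fun m =>
    hLF (Submodule.projection_apply_mem hc m)
  let πL : A.M →ₗ[S] A.Fil := (L.projection N hc).codRestrict A.Fil hL
  let πN : A.M →ₗ[S] A.M := N.projection L hc.symm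
  have hπL : ∀ l (hl : l ∈ L), πL l = ⟨l, hLF hl⟩ := fun l hl =>
    Subtype.ext (Submodule.projection_apply_of_mem_left hc hl)
  have hπL' : ∀ n ∈ N, πL n = 0 := fun n hn =>
    Subtype.ext ((Submodule.projection_apply_eq_zero_iff hc).2 hn)
  have hπN : ∀ n ∈ N, πN n = n := fun n hn => Submodule.projection_apply_of_mem_left hc.symm hn
  have hπN' : ∀ l ∈ L, πN l = 0 := fun l hl =>
    (Submodule.projection_apply_eq_zero_iff hc.symm).2 hl
  have hsum : ∀ m, (πL m : A.M) + πN m = m := fun m =>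
    Submodule.projection_add_projection_eq_self hc m
  have hNmem : ∀ m, πN m ∈ N := fun m => Submodule.projection_apply_mem hc.symm m
  -- The Frobenius-linear map `Φ₁` on `L`, `Φ` on `N` contains all the information of the window,
  -- and its image generates `M`. The map `z` is its analogue for the pair `(u, v)`, so `τ` is the
  -- solution of `τ Ψ = z`.
  let Ψ : A.M →ₛₗ[F.φ] A.M := A.Φ₁.comp πL + A.Φ.comp πN
  let z : A.M →ₛₗ[F.φ] P := v.comp πL + u.comp πN
  have hΨL : ∀ l (hl : l ∈ L), Ψ l = A.Φ₁ ⟨l, hLF hl⟩ := fun l hl => by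
    simp [Ψ, hπL l hl, hπN' l hl]
  have hΨN : ∀ n ∈ N, Ψ n = A.Φ n := fun n hn => by simp [Ψ, hπL' n hn, hπN n hn]
  have hzL : ∀ l (hl : l ∈ L), z l = v ⟨l, hLF hl⟩ := fun l hl => by
    simp [z, hπL l hl, hπN' l hl]
  have hzN : ∀ n ∈ N, z n = u n := fun n hn => by simp [z, hπL' n hn, hπN n hn]
  -- Compatibility on `L` and `N` suffices, since the relations between `Φ` and `Φ₁` determine the
  -- rest. The target `Q` is arbitrary because this is used twice: for the generation property of
  -- `Ψ`, and for `P`.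
  have main : ∀ {Q : Type u} [AddCommGroup Q] [Module S Q] (u' : A.M →ₛₗ[F.φ] Q)
      (v' : A.Fil →ₛₗ[F.φ] Q)
      (_ : ∀ (s : F.Fil) (m : A.M) (h : (s : S) • m ∈ A.Fil),
        v' ⟨(s : S) • m, h⟩ = F.φ₁ s • u' m)
      (_ : ∀ m : A.Fil, u' m = F.ϖ • v' m) (τ : A.M →ₗ[S] Q)
      (_ : ∀ l (hl : l ∈ L), τ (Ψ l) = v' ⟨l, hLF hl⟩) (_ : ∀ n ∈ N, τ (Ψ n) = u' n),
      (∀ m, τ (A.Φ m) = u' m) ∧ ∀ x, τ (A.Φ₁ x) = v' x := by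
    intro Q _ _ u' v' k1 k2 τ hτL hτN
    have hv : τ.comp A.Φ₁ = v' := by
      refine A.fil_hom_ext hF (fun l hl hl' => ?_) (fun s hs n hn h => ?_)
      · rw [LinearMap.comp_apply, ← hΨL l hl', hτL l hl']
      · rw [LinearMap.comp_apply, A.Φ₁_smul ⟨s, hs⟩, k1 ⟨s, hs⟩, map_smul, ← hΨN n hn, hτN n hn]
    have hv' : ∀ x, τ (A.Φ₁ x) = v' x := fun x => congrArg (fun f => f x) hv
    refine ⟨fun m => ?_, hv'⟩
    rw [← hsum m, map_add, map_add, map_add, A.Φ_eq, map_smul, hv', k2, ← hΨN _ (hNmem m),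
      hτN _ (hNmem m)]
  have hspan : Submodule.span S (Set.range Ψ) = ⊤ := by
    rw [eq_top_iff, ← A.span_eq_top, Submodule.span_le]
    set U := Submodule.span S (Set.range Ψ)
    have hU : ∀ m, U.mkQ (Ψ m) = 0 := fun m =>
      (Submodule.Quotient.mk_eq_zero _).2 (Submodule.subset_span ⟨m, rfl⟩)
    -- With zero maps into `M / U`, the projection is a solution. So `Φ` and `Φ₁` take values in
    -- `U`, which is then everything by the generation axiom.
    obtain ⟨k1, k2⟩ := main (Q := A.M ⧸ U) 0 0 (by simp) (by simp) U.mkQ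
      (fun l hl => hU l) (fun n hn => hU n)
    rintro _ (⟨x, rfl⟩ | ⟨x, rfl⟩)
    · exact (Submodule.Quotient.mk_eq_zero _).1 (k2 x)
    · exact (Submodule.Quotient.mk_eq_zero _).1 (k1 x)
  obtain ⟨τ, hτ, -⟩ := existsUnique_comp_eq F hp Ψ hspan z
  exact ⟨τ, main u v h1 h2 τ (fun l hl => by rw [hτ, hzL l hl]) (fun n hn => by rw [hτ, hzN n hn])⟩

theorem eq_top_of_Φ_mem {A : Window F} {U : Submodule S A.M} (h1 : ∀ x, A.Φ₁ x ∈ U)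
    (h2 : ∀ x, A.Φ x ∈ U) (x : A.M) : x ∈ U := by
  have : (⊤ : Submodule S A.M) ≤ U := by
    rw [← A.span_eq_top, Submodule.span_le]
    rintro _ (⟨x, rfl⟩ | ⟨x, rfl⟩)
    · exact h1 x
    · exact h2 x
  exact this trivial

/-- The contraction principle: `d'` arises from `d` by Frobenius on both sides, and `Φ₁` and `Φ = ϖ
Φ₁` turn values in `𝔟 • M` into values in `𝔠 • M`. The values of `Φ` and `Φ₁` generate the source,
so this controls all of `d'`. -/
theorem forall_mem_smul_top_of_comp {A B : Window F} {d d' : A.M →ₗ[S] B.M} {𝔟 𝔠 : Ideal S}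
    (h𝔟 : ∀ x ∈ 𝔟, ∃ h : x ∈ F.Fil, F.φ₁ ⟨x, h⟩ ∈ 𝔠)
    (hd : ∀ x, d x ∈ (𝔟 • ⊤ : Submodule S B.M))
    (h1 : ∀ (x : A.Fil) (h : d x ∈ B.Fil), d' (A.Φ₁ x) = B.Φ₁ ⟨d x, h⟩)
    (h2 : ∀ x, d' (A.Φ x) = B.Φ (d x)) (x : A.M) : d' x ∈ (𝔠 • ⊤ : Submodule S B.M) := by
  refine eq_top_of_Φ_mem (U := Submodule.comap d' (𝔠 • ⊤)) (fun x => ?_) (fun x => ?_) x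
  · obtain ⟨h, h'⟩ := B.Φ₁_mem_smul_top h𝔟 (hd x)
    rw [Submodule.mem_comap, h1 x h]
    exact h'
  · obtain ⟨h, h'⟩ := B.Φ₁_mem_smul_top h𝔟 (hd x)
    rw [Submodule.mem_comap, h2, B.Φ_eq ⟨d x, h⟩]
    exact Submodule.smul_mem _ _ h'

end Window

variable {S' : Type u} [CommRing S'] {F' : Frame p S'}

/-- Conditions on a homomorphism of frames under which base change is an equivalence. -/
structure FrameHom.Contracting (α : FrameHom F F') : Prop where
  mem_fil : ∀ a, α.toRingHom a ∈ F'.Fil → a ∈ F.Fil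
  exists_sub_mem : ∀ b, ∃ a, b - α.toRingHom a ∈ F'.divKer
  complete_fil : IsAdicComplete F.Fil S
  complete_source : IsAdicComplete (Ideal.span {(p : S)}) S
  complete_target : IsAdicComplete (Ideal.span {(p : S')}) S'
  closed : ∀ b, (∀ k, ∃ a, b - α.toRingHom a ∈ Ideal.span {(p : S')} ^ k) →
    ∃ a, b = α.toRingHom a
  fil_closed : ∀ b, (∀ k, b ∈ F'.Fil ⊔ Ideal.span {(p : S')} ^ k) → b ∈ F'.Fil
  φ₁_mem : ∀ k, ∀ b : F'.Fil, (b : S') ∈ Ideal.span {(p : S')} ^ k →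
    F'.φ₁ b ∈ Ideal.span {(p : S')} ^ k
  /-- The divided Frobenius is topologically nilpotent on the kernel. -/
  exists_ideals : ∃ (𝔪 : Ideal S) (𝔟 : ℕ → Ideal S) (N : ℕ), IsAdicComplete 𝔪 S ∧
    (∀ b, (∀ k, b ∈ (𝔪 ^ k).map α.toRingHom) → b = 0) ∧
    RingHom.ker α.toRingHom ≤ 𝔟 0 ∧ (∀ k, 𝔟 k ≤ 𝔪 ^ k) ∧
    (∀ k, ∀ x ∈ 𝔟 k, ∃ h : x ∈ F.Fil, F.φ₁ ⟨x, h⟩ ∈ 𝔟 (k + 1)) ∧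
    ∀ j, ∀ x ∈ 𝔪 ^ (N + j), ∃ h : x ∈ F.Fil, F.φ₁ ⟨x, h⟩ ∈ 𝔪 ^ j

namespace FrameHom

variable [Algebra S S'] (α : FrameHom F F') (hα : α.toRingHom = algebraMap S S')

/-- By `exists_fil_coords` this is the statement about rings that `Fil S` is the full preimage of
`Fil S'`, applied to each coordinate. -/
theorem mem_fil_of_one_tmul_mem {α : FrameHom F F'} (hC : α.Contracting)
    (hα : α.toRingHom = algebraMap S S') {A : Window F} {y : A.M}
    (hy : (1 : S') ⊗ₜ[S] y ∈ bcFil F' A) : y ∈ A.Fil := by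
  obtain ⟨n, ℓ, hℓ⟩ := A.exists_fil_coords
  rw [hℓ]
  intro i
  refine hC.mem_fil _ ?_
  have hle : bcFil F' A ≤ Submodule.comap (coord S' (ℓ i)) F'.Fil := by
    refine Submodule.span_le.2 ?_
    rintro y (⟨a, ha, m, rfl⟩ | ⟨x, hx, rfl⟩)
    · simp only [Submodule.comap_coe, Set.mem_preimage, map_smul]
      exact Ideal.mul_mem_right _ _ ha
    · simp only [Submodule.comap_coe, Set.mem_preimage, coord_one_tmul]
      rw [← hα]
      exact α.map_fil _ ((hℓ x).1 hx i)
  have := hle hy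
  rwa [Submodule.mem_comap, coord_one_tmul, ← hα] at this

/-- The difference of two homomorphisms with equal base change has values in `ker α • M ⊆ 𝔟 0 • M`.
It commutes with Frobenius, so contraction pushes its values into every `𝔟 k • M ⊆ 𝔪ᵏ M`, hence to
zero. -/
theorem faithful_of_contracting (hC : α.Contracting) : (baseChangeAux α hα).Faithful where
  map_injective {A B} f g hfg := by
    obtain ⟨𝔪, 𝔟, N, hm, -, h0, hle, hstep, -⟩ := hC.exists_ideals
    have := isAdicComplete_of_projective (M := B.M) 𝔪
    have hfg' : f.toLinearMap.baseChange S' = g.toLinearMap.baseChange S' :=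
      congrArg (fun h : bcObj α hα A ⟶ bcObj α hα B => h.toLinearMap) hfg
    let d := f.toLinearMap - g.toLinearMap
    have hd : ∀ k x, d x ∈ (𝔟 k • ⊤ : Submodule S B.M) := by
      intro k
      induction k with
      | zero =>
        intro x
        refine Submodule.smul_mono_left h0 ?_
        rw [hα]
        refine mem_ker_smul_top_of_one_tmul_eq_zero ?_
        have := congrArg (fun h => h ((1 : S') ⊗ₜ[S] x)) hfg'
        simp only [LinearMap.baseChange_tmul] at this
        rw [LinearMap.sub_apply, tmul_sub, this, sub_self]
      | succ k ih =>
        refine Window.forall_mem_smul_top_of_comp (hstep k) ih (fun x h => ?_) (fun x => ?_)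
        · simp only [d, LinearMap.sub_apply, f.map_Φ₁, g.map_Φ₁]
          rw [← map_sub]
          rfl
        · simp only [d, LinearMap.sub_apply, f.map_Φ, g.map_Φ, map_sub]
    refine Window.hom_ext _ _ (LinearMap.ext fun x => sub_eq_zero.1 ?_)
    exact eq_zero_of_forall_mem_pow_smul_top 𝔪 fun k => Submodule.smul_mono_left (hle k) (hd k x)

end FrameHom

end Windows

/-! ### Fullness of base change -/

section Full

variable {p : ℕ} {S S' : Type u} [CommRing S] [CommRing S'] {F : Frame p S} {F' : Frame p S'}
  [Algebra S S']

theorem sub_smul_tensor {M : Type u} [AddCommGroup M] [Module S M] (a b : S') (x : S' ⊗[S] M) :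
    (a - b) • x = a • x - b • x := sub_smul a b x

theorem exists_sub_one_tmul_mem {K : Ideal S'} (h : ∀ b, ∃ a, b - algebraMap S S' a ∈ K)
    {M : Type u} [AddCommGroup M] [Module S M] (z : S' ⊗[S] M) :
    ∃ w : M, z - 1 ⊗ₜ w ∈ (K • ⊤ : Submodule S' (S' ⊗[S] M)) := by
  induction z with
  | zero => exact ⟨0, by rw [tmul_zero, sub_zero]; exact zero_mem _⟩
  | add x y hx hy =>
    obtain ⟨w, hw⟩ := hx
    obtain ⟨w', hw'⟩ := hy
    refine ⟨w + w', ?_⟩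
    rw [tmul_add, add_sub_add_comm]
    exact add_mem hw hw'
  | tmul s m =>
    obtain ⟨a, ha⟩ := h s
    refine ⟨a • m, ?_⟩
    rw [one_tmul_smul, tmul_eq_smul_one_tmul, ← sub_smul_tensor]
    exact Submodule.smul_mem_smul ha trivial

/-- The image of `M` in `S' ⊗ M` plus the multiples of `pᵏ`. -/
def nearImage (p : ℕ) (S' : Type u) [CommRing S'] [Algebra S S'] (M : Type u) [AddCommGroup M]
    [Module S M] (k : ℕ) : Submodule S (S' ⊗[S] M) :=
  LinearMap.range (TensorProduct.mk S S' M 1) ⊔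
    ((Ideal.span {(p : S')} ^ k • ⊤ : Submodule S' (S' ⊗[S] M)).restrictScalars S)

theorem mem_nearImage {M : Type u} [AddCommGroup M] [Module S M] {k : ℕ} {x : S' ⊗[S] M} :
    x ∈ nearImage p S' M k ↔
      ∃ y z, x = 1 ⊗ₜ[S] y + (p : S') ^ k • z := by
  rw [nearImage, Submodule.mem_sup]
  constructor
  · rintro ⟨_, ⟨y, rfl⟩, z, hz, rfl⟩
    obtain ⟨z', rfl⟩ := mem_span_pow_smul_top_iff.1 (Submodule.restrictScalars_mem S _ _ |>.1 hz)
    exact ⟨y, z', rfl⟩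
  · rintro ⟨y, z, rfl⟩
    exact ⟨_, ⟨y, rfl⟩, _, (Submodule.restrictScalars_mem S _ _).2
      (mem_span_pow_smul_top_iff.2 ⟨z, rfl⟩), rfl⟩

/-- The error terms `pᵏ z i` at the dual basis vectors are split by `S' = S + K`: the part of `z i`
over `S` goes into `f`, the part in `K` into `h`. Working on a dual basis avoids dividing by `pᵏ` in
the presence of `p`-torsion. -/
theorem exists_baseChange_add_eq {K : Ideal S'} (hK : ∀ b, ∃ a, b - algebraMap S S' a ∈ K)
    {M M' : Type u} [AddCommGroup M] [Module S M] [Module.Finite S M] [Module.Projective S M]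
    [AddCommGroup M'] [Module S M'] (g : S' ⊗[S] M →ₗ[S'] S' ⊗[S] M') (k : ℕ)
    (hg : ∀ m, g (1 ⊗ₜ m) ∈ nearImage p S' M' k) :
    ∃ (f : M →ₗ[S] M') (h : S' ⊗[S] M →ₗ[S'] S' ⊗[S] M'),
      g = f.baseChange S' + (p : S') ^ k • h ∧ ∀ x, h x ∈ (K • ⊤ : Submodule S' (S' ⊗[S] M')) := by
  obtain ⟨n, e, ℓ, hℓ⟩ := exists_dual_basis S M
  choose y z hyz using fun i => mem_nearImage.1 (hg (e i))
  choose w hw using fun i => exists_sub_one_tmul_mem hK (z i)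
  refine ⟨∑ i, (ℓ i).smulRight (y i + (p : S) ^ k • w i),
    ∑ i, (coord S' (ℓ i)).smulRight (z i - 1 ⊗ₜ w i), linearMap_ext_one_tmul fun m => ?_,
    fun x => ?_⟩
  · have h1 : g (1 ⊗ₜ m) = ∑ i, algebraMap S S' (ℓ i m) • g (1 ⊗ₜ e i) := by
      conv_lhs => rw [← hℓ m]
      simp only [tmul_sum, one_tmul_smul, map_sum, map_smul]
    rw [h1, LinearMap.add_apply, LinearMap.smul_apply, LinearMap.baseChange_tmul,
      LinearMap.sum_apply, LinearMap.sum_apply, tmul_sum, Finset.smul_sum,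
      ← Finset.sum_add_distrib]
    refine Finset.sum_congr rfl fun i _ => ?_
    simp only [LinearMap.smulRight_apply, one_tmul_smul, coord_one_tmul, tmul_add, map_pow,
      map_natCast]
    rw [hyz, smul_comm _ (algebraMap S S' (ℓ i m)), ← smul_add, smul_sub]
    congr 1
    abel
  · rw [LinearMap.sum_apply]
    exact sum_mem fun i _ => Submodule.smul_mem _ _ (hw i)

theorem exists_baseChange_eq {M M' : Type u} [AddCommGroup M] [Module S M] [Module.Finite S M]
    [Module.Projective S M] [AddCommGroup M'] [Module S M']
    (g : S' ⊗[S] M →ₗ[S'] S' ⊗[S] M') (hg : ∀ m, ∃ y, g (1 ⊗ₜ m) = 1 ⊗ₜ y) :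
    ∃ f : M →ₗ[S] M', f.baseChange S' = g := by
  obtain ⟨n, e, ℓ, hℓ⟩ := exists_dual_basis S M
  choose y hy using hg
  refine ⟨∑ i, (ℓ i).smulRight (y (e i)), linearMap_ext_one_tmul fun m => ?_⟩
  conv_rhs => rw [← hℓ m]
  simp only [LinearMap.baseChange_tmul, LinearMap.sum_apply, LinearMap.smulRight_apply, tmul_sum,
    one_tmul_smul, map_sum, map_smul, hy]

namespace FrameHom

variable {α : FrameHom F F'} (hα : α.toRingHom = algebraMap S S')

/-- The conditions on a linear map of base changes to be a homomorphism of windows, checked on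
elements of the form `1 ⊗ x`. -/
structure IsBaseChangeHom {A B : Window F} (g : S' ⊗[S] A.M →ₗ[S'] S' ⊗[S] B.M) : Prop where
  map_Φ₁ : ∀ x : A.Fil, ∃ h : g (1 ⊗ₜ (x : A.M)) ∈ bcFil F' B,
    g (1 ⊗ₜ A.Φ₁ x) = (↑α.c⁻¹ : S') • bcΦ₁ α hα B ⟨g (1 ⊗ₜ (x : A.M)), h⟩
  map_Φ : ∀ x, g (1 ⊗ₜ A.Φ x) = bcΦ α hα B (g (1 ⊗ₜ x))

theorem one_tmul_Φ₁ (B : Window F) (y : B.Fil) (h : (1 : S') ⊗ₜ[S] (y : B.M) ∈ bcFil F' B) :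
    (1 : S') ⊗ₜ[S] B.Φ₁ y = (↑α.c⁻¹ : S') • bcΦ₁ α hα B ⟨(1 : S') ⊗ₜ[S] (y : B.M), h⟩ := by
  rw [bcΦ₁_one_tmul, smul_tmul', smul_eq_mul, Units.inv_mul]

theorem one_tmul_Φ (B : Window F) (y : B.M) :
    (1 : S') ⊗ₜ[S] B.Φ y = bcΦ α hα B ((1 : S') ⊗ₜ[S] y) := by
  simp [bcΦ]

theorem isBaseChangeHom {A B : Window F} (g : bcObj α hα A ⟶ bcObj α hα B) :
    IsBaseChangeHom hα (A := A) (B := B) g.toLinearMap where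
  map_Φ₁ x := by
    have hx : (1 : S') ⊗ₜ[S] (x : A.M) ∈ bcFil F' A := one_tmul_mem_bcFil A x.2
    refine ⟨g.map_fil _ hx, ?_⟩
    rw [one_tmul_Φ₁ hα A x hx]
    refine (map_smul g.toLinearMap _ _).trans ?_
    exact congrArg ((↑α.c⁻¹ : S') • ·) (g.map_Φ₁ ⟨_, hx⟩)
  map_Φ x := by
    rw [one_tmul_Φ hα]
    exact g.map_Φ _

theorem bcΦ₁_mem_smul_top (B : Window F) {𝔞 𝔠 : Ideal S'}
    (h : ∀ x ∈ 𝔞, ∃ h : x ∈ F'.Fil, F'.φ₁ ⟨x, h⟩ ∈ 𝔠) {x : S' ⊗[S] B.M}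
    (hx : x ∈ (𝔞 • ⊤ : Submodule S' (S' ⊗[S] B.M))) :
    ∃ h : x ∈ bcFil F' B, bcΦ₁ α hα B ⟨x, h⟩ ∈ (𝔠 • ⊤ : Submodule S' (S' ⊗[S] B.M)) :=
  (bcObj α hα B).Φ₁_mem_smul_top h hx

theorem bcΦ_eq (B : Window F) (x : bcFil F' B) : bcΦ α hα B x = F'.ϖ • bcΦ₁ α hα B x :=
  (bcObj α hα B).Φ_eq x

theorem Contracting.exists_sub_mem' (hα : α.toRingHom = algebraMap S S') (hC : α.Contracting)
    (b : S') : ∃ a, b - algebraMap S S' a ∈ F'.divKer := hα ▸ hC.exists_sub_mem b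

/-- Induction on the `p`-adic precision. Writing `g = f + pᵏ h` with `h` valued in `K`, Frobenius
applied to `pᵏ h` gives a multiple of `pᵏ⁺¹`, while Frobenius applied to `1 ⊗ f x` stays in the
image of `M`. Since `Φ` and `Φ₁` generate the source, the precision improves everywhere. -/
theorem map_one_tmul_mem_nearImage (hC : α.Contracting) {A B : Window F}
    {g : S' ⊗[S] A.M →ₗ[S'] S' ⊗[S] B.M} (hg₀ : IsBaseChangeHom hα g) (k : ℕ) (m : A.M) :
    g ((1 : S') ⊗ₜ[S] m) ∈ nearImage p S' B.M k := by
  induction k generalizing m with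
  | zero => exact mem_nearImage.2 ⟨0, g ((1 : S') ⊗ₜ[S] m), by simp⟩
  | succ k ih =>
    obtain ⟨f, h, hg, hh⟩ := exists_baseChange_add_eq (hC.exists_sub_mem' hα) g k ih
    have hg' : ∀ x : A.M, g ((1 : S') ⊗ₜ[S] x) =
        (1 : S') ⊗ₜ[S] f x + (p : S') ^ k • h ((1 : S') ⊗ₜ[S] x) := fun x => by rw [hg]; rfl
    have hK : ∀ x ∈ F'.divKer, ∃ h : x ∈ F'.Fil, F'.φ₁ ⟨x, h⟩ ∈ Ideal.span {(p : S')} :=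
      fun x hx => hx
    have hΦ₁ : ∀ x, ∃ hx : h x ∈ bcFil F' B, ∃ z, bcΦ₁ α hα B ⟨h x, hx⟩ =
        (p : S') • z := by
      intro x
      obtain ⟨h1, h2⟩ := bcΦ₁_mem_smul_top hα B hK (hh x)
      rw [← pow_one (Ideal.span _)] at h2
      obtain ⟨z, hz⟩ := mem_span_pow_smul_top_iff.1 h2
      exact ⟨h1, z, by rw [hz, pow_one]⟩
    refine Window.eq_top_of_Φ_mem (U := Submodule.comap
      ((g.restrictScalars S) ∘ₗ (TensorProduct.mk S S' A.M 1))
      (nearImage p S' B.M (k + 1))) (fun x => ?_) (fun x => ?_) m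
    · change g ((1 : S') ⊗ₜ[S] A.Φ₁ x) ∈ nearImage p S' B.M (k + 1)
      obtain ⟨h1, h2⟩ := hg₀.map_Φ₁ x
      obtain ⟨h3, z, hz⟩ := hΦ₁ ((1 : S') ⊗ₜ[S] (x : A.M))
      have h4 : (1 : S') ⊗ₜ[S] f x ∈ bcFil F' B := by
        -- Both `g (1 ⊗ x)` and `pᵏ h (1 ⊗ x)` lie in the filtration, hence so does `1 ⊗ f x`. This
        -- places `f x` in `Fil B`, where `Φ₁` is defined.
        have := sub_mem h1 ((bcFil F' B).smul_mem ((p : S') ^ k) h3)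
        rwa [hg', add_sub_cancel_right] at this
      have h5 : (⟨g ((1 : S') ⊗ₜ[S] (x : A.M)), h1⟩ : bcFil F' B) =
          ⟨(1 : S') ⊗ₜ[S] f x, h4⟩ + (p : S') ^ k • ⟨h ((1 : S') ⊗ₜ[S] (x : A.M)), h3⟩ :=
        Subtype.ext (hg' x)
      rw [h2, h5, map_add, map_smulₛₗ, hz, smul_add,
        ← one_tmul_Φ₁ hα B ⟨f x, mem_fil_of_one_tmul_mem hC hα h4⟩ h4]
      refine mem_nearImage.2 ⟨_, (↑α.c⁻¹ : S') • z, congrArg _ ?_⟩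
      rw [map_pow, map_natCast, smul_smul, smul_smul, smul_smul]
      congr 1
      ring
    · change g ((1 : S') ⊗ₜ[S] A.Φ x) ∈ nearImage p S' B.M (k + 1)
      obtain ⟨h3, z, hz⟩ := hΦ₁ ((1 : S') ⊗ₜ[S] x)
      rw [hg₀.map_Φ x, hg', map_add, map_smulₛₗ, ← one_tmul_Φ,
        bcΦ_eq hα B ⟨_, h3⟩, hz]
      refine mem_nearImage.2 ⟨_, F'.ϖ • z, congrArg _ ?_⟩
      rw [map_pow, map_natCast, smul_smul, smul_smul, smul_smul]
      congr 1
      ring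

/-- The coordinates of `g (1 ⊗ m)` are `p`-adic limits of elements of `α(S)`, which is closed. -/
theorem exists_map_one_tmul_eq (hC : α.Contracting) {A B : Window F}
    {g : S' ⊗[S] A.M →ₗ[S'] S' ⊗[S] B.M} (hg₀ : IsBaseChangeHom hα g) (m : A.M) :
    ∃ y : B.M, g ((1 : S') ⊗ₜ[S] m) = (1 : S') ⊗ₜ[S] y := by
  obtain ⟨n, e, ℓ, hℓ⟩ := exists_dual_basis S B.M
  have : ∀ i, ∃ a, coord S' (ℓ i) (g ((1 : S') ⊗ₜ[S] m)) = α.toRingHom a := by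
    intro i
    refine hC.closed _ fun k => ?_
    obtain ⟨y, z, hyz⟩ := mem_nearImage.1 (map_one_tmul_mem_nearImage hα hC hg₀ k m)
    refine ⟨ℓ i y, ?_⟩
    rw [hyz, hα, map_add, coord_one_tmul, add_sub_cancel_left, map_smul, smul_eq_mul]
    exact Ideal.mul_mem_right _ _ (Ideal.pow_mem_pow (Ideal.mem_span_singleton_self _) k)
  choose a ha using this
  refine ⟨∑ i, a i • e i, ?_⟩
  refine (sum_coord_smul hℓ (g ((1 : S') ⊗ₜ[S] m))).symm.trans ?_
  rw [tmul_sum]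
  refine Finset.sum_congr rfl fun i _ => ?_
  rw [ha, hα, one_tmul_smul]

/-- The maps `Φ f` and `Φ₁ f` satisfy the window relations, so they factor uniquely in terms of
generators through some `f'`. As `g` commutes with Frobenius, `f'` is again a lift of `g`: the two
sides agree on the values of `Φ` and `Φ₁`. -/
theorem exists_frobenius_improvement (hp : p ≠ 0) (hC : α.Contracting) {A B : Window F}
    {g : S' ⊗[S] A.M →ₗ[S'] S' ⊗[S] B.M} (hg₀ : IsBaseChangeHom hα g) (f : A.M →ₗ[S] B.M)
    (hf : ∀ m, (1 : S') ⊗ₜ[S] f m = g ((1 : S') ⊗ₜ[S] m)) :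
    ∃ f' : A.M →ₗ[S] B.M,
      (∀ m, (1 : S') ⊗ₜ[S] f' m = g ((1 : S') ⊗ₜ[S] m)) ∧
      (∀ (x : A.Fil) (h : f x ∈ B.Fil), f' (A.Φ₁ x) = B.Φ₁ ⟨f x, h⟩) ∧
      ∀ x, f' (A.Φ x) = B.Φ (f x) := by
  have hfil : ∀ x ∈ A.Fil, f x ∈ B.Fil := fun x hx => by
    refine mem_fil_of_one_tmul_mem (α := α) hC hα ?_
    rw [hf]
    exact (hg₀.map_Φ₁ ⟨x, hx⟩).choose
  obtain ⟨f', h1, h2⟩ := A.exists_linear_comp_eq hp (B.Φ.comp f) (B.Φ₁.comp (f.restrict hfil))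
    (fun s m h => by
      have e : f.restrict hfil ⟨(s : S) • m, h⟩ = ⟨(s : S) • f m, B.smul_top_le
        (Submodule.smul_mem_smul s.2 trivial)⟩ := Subtype.ext (map_smul f _ _)
      rw [LinearMap.comp_apply, e, B.Φ₁_smul]
      rfl)
    (fun m => B.Φ_eq (f.restrict hfil m))
  refine ⟨f', fun m => ?_, fun x h => h2 x, h1⟩
  refine Window.eq_top_of_Φ_mem (U := LinearMap.eqLocus ((TensorProduct.mk S S' B.M 1) ∘ₗ f')
    ((g.restrictScalars S) ∘ₗ (TensorProduct.mk S S' A.M 1)))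
    (fun x => ?_) (fun x => ?_) m
  · change (1 : S') ⊗ₜ[S] f' (A.Φ₁ x) = g ((1 : S') ⊗ₜ[S] A.Φ₁ x)
    obtain ⟨h3, h4⟩ := hg₀.map_Φ₁ x
    rw [h2, h4]
    have h5 : (1 : S') ⊗ₜ[S] f x ∈ bcFil F' B := by rw [hf]; exact h3
    refine (one_tmul_Φ₁ hα B ⟨f x, hfil x x.2⟩ h5).trans ?_
    congr 2
    exact Subtype.ext (hf x)
  · change (1 : S') ⊗ₜ[S] f' (A.Φ x) = g ((1 : S') ⊗ₜ[S] A.Φ x)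
    rw [h1, hg₀.map_Φ, ← hf]
    exact one_tmul_Φ hα B (f x)

/-- The operator `U` on the set `X` of `S`-linear lifts of `g` has the desired homomorphism as a
fixed point. Two lifts differ by a map into `ker α • M`, and by contraction the iterates of `U` form
a Cauchy sequence. -/
theorem full_of_contracting (hp : p ≠ 0) (hC : α.Contracting) : (baseChangeAux α hα).Full where
  map_surjective {A B} g := by
    change bcObj α hα A ⟶ bcObj α hα B at g
    obtain ⟨g', hg₀, hg'⟩ : ∃ g' : S' ⊗[S] A.M →ₗ[S'] S' ⊗[S] B.M,
      IsBaseChangeHom hα g' ∧ g' = g.toLinearMap := ⟨_, isBaseChangeHom hα g, rfl⟩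
    obtain ⟨𝔪, 𝔟, N, hm, hsep, h0, hle, hstep, hN⟩ := hC.exists_ideals
    have := isAdicComplete_of_projective (M := B.M) 𝔪
    let X := {f : A.M →ₗ[S] B.M //
      ∀ m, (1 : S') ⊗ₜ[S] f m = g' ((1 : S') ⊗ₜ[S] m)}
    have hfil : ∀ (f : X), ∀ x ∈ A.Fil, f.1 x ∈ B.Fil := fun f x hx => by
      refine mem_fil_of_one_tmul_mem (α := α) hC hα ?_
      rw [f.2]
      exact (hg₀.map_Φ₁ ⟨x, hx⟩).choose
    have hU : ∀ f : X, ∃ f' : X,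
        (∀ (x : A.Fil) (h : f.1 x ∈ B.Fil), f'.1 (A.Φ₁ x) = B.Φ₁ ⟨f.1 x, h⟩) ∧
        ∀ x, f'.1 (A.Φ x) = B.Φ (f.1 x) := fun f => by
      obtain ⟨f', h1, h2⟩ := exists_frobenius_improvement hα hp hC hg₀ f.1 f.2
      exact ⟨⟨f', h1⟩, h2⟩
    choose U hU₁ hU₂ using hU
    obtain ⟨f₀, hf₀⟩ := exists_baseChange_eq g' (exists_map_one_tmul_eq hα hC hg₀)
    let s : ℕ → X := fun k => U^[k] ⟨f₀, fun m => by rw [← hf₀]; rfl⟩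
    have hs : ∀ k, s (k + 1) = U (s k) := fun k => Function.iterate_succ_apply' _ _ _
    have hd : ∀ k x, ((s (k + 1)).1 - (s k).1) x ∈ (𝔟 k • ⊤ : Submodule S B.M) := by
      intro k
      induction k with
      | zero =>
        intro x
        refine Submodule.smul_mono_left h0 ?_
        rw [hα]
        refine mem_ker_smul_top_of_one_tmul_eq_zero ?_
        rw [LinearMap.sub_apply, tmul_sub, (s 1).2, (s 0).2, sub_self]
      | succ k ih =>
        refine Window.forall_mem_smul_top_of_comp (hstep k) ih (fun x h => ?_) (fun x => ?_)
        · have e₁ := hU₁ (s (k + 1)) x (hfil _ x x.2)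
          have e₂ := hU₁ (s k) x (hfil _ x x.2)
          rw [← hs] at e₁ e₂
          rw [LinearMap.sub_apply, e₁, e₂, ← map_sub]
          rfl
        · have e₁ := hU₂ (s (k + 1)) x
          have e₂ := hU₂ (s k) x
          rw [← hs] at e₁ e₂
          rw [LinearMap.sub_apply, e₁, e₂, ← map_sub]
          rfl
    obtain ⟨f, hf⟩ := exists_limit_semilinear 𝔪 (fun k => (s k).1) fun k x =>
      Submodule.smul_mono_left (hle k) (hd k x)
    have hfX : ∀ m, (1 : S') ⊗ₜ[S] f m = g' ((1 : S') ⊗ₜ[S] m) := by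
      intro m
      obtain ⟨n, e, ℓ, hℓ⟩ := exists_dual_basis S B.M
      rw [← sub_eq_zero]
      refine (sum_coord_smul hℓ _).symm.trans (Finset.sum_eq_zero fun i _ => ?_)
      -- The limit is still a lift of `g`: coordinates of the discrepancy lie in `𝔪ᵏ S'` for all
      -- `k`, and these ideals have zero intersection.
      refine (congrArg (· • _) (hsep _ fun k => ?_)).trans (zero_smul _ _)
      rw [← (s k).2 m, ← tmul_sub, coord_one_tmul, ← hα]
      exact Ideal.mem_map_of_mem _ (apply_mem_of_mem_smul_top _ (hf k m))
    have hff := hfil ⟨f, hfX⟩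
    refine ⟨⟨f, hff, fun x => ?_, fun x => ?_⟩, ?_⟩
    · rw [← sub_eq_zero]
      refine eq_zero_of_forall_mem_pow_smul_top 𝔪 fun j => ?_
      -- Applying `Φ₁` may lose `N` steps of the `𝔪`-adic filtration, so `f` is compared with the
      -- iterate of index `N + j` to get closeness `𝔪ʲ`.
      obtain ⟨h1, h2⟩ := B.Φ₁_mem_smul_top (hN j) (hf (N + j) x)
      have e : f (A.Φ x) - B.Φ (f x) = (f (A.Φ x) - (s (N + j + 1)).1 (A.Φ x)) -
          B.Φ (f x - (s (N + j)).1 x) := by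
        rw [hs, hU₂, map_sub]; abel
      rw [e, B.Φ_eq ⟨_, h1⟩]
      exact sub_mem (Submodule.smul_mono_left (Ideal.pow_le_pow_right (by omega)) (hf _ _))
        (Submodule.smul_mem _ _ h2)
    · rw [← sub_eq_zero]
      refine eq_zero_of_forall_mem_pow_smul_top 𝔪 fun j => ?_
      obtain ⟨h1, h2⟩ := B.Φ₁_mem_smul_top (hN j) (hf (N + j) x)
      have e : f (A.Φ₁ x) - B.Φ₁ ⟨f x, hff x x.2⟩ =
          (f (A.Φ₁ x) - (s (N + j + 1)).1 (A.Φ₁ x)) - B.Φ₁ ⟨f x - (s (N + j)).1 x, h1⟩ := by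
        have e' : (⟨f x - (s (N + j)).1 x, h1⟩ : B.Fil) =
            ⟨f x, hff x x.2⟩ - ⟨(s (N + j)).1 x, hfil _ x x.2⟩ := rfl
        rw [e', hs, hU₁ _ x (hfil _ x x.2), map_sub]
        abel
      rw [e]
      exact sub_mem (Submodule.smul_mono_left (Ideal.pow_le_pow_right (by omega)) (hf _ _)) h2
    · exact Window.hom_ext _ _ ((linearMap_ext_one_tmul fun m => hfX m).trans hg')

end FrameHom

end Full

/-! ### Windows constructed from a normal decomposition -/

section Standard

variable {p : ℕ} {S : Type u} [CommRing S] (F : Frame p S)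

/-- The extension of a Frobenius-linear map `u` on `N` to a map `s • n ↦ φ₁ s • u n` on
`Fil¹ S • N`. -/
theorem exists_φ₁_extension {N P : Type u} [AddCommGroup N] [Module S N] [Module.Finite S N]
    [Module.Projective S N] [AddCommGroup P] [Module S P] (u : N →ₛₗ[F.φ] P) :
    ∃ v : (F.Fil • ⊤ : Submodule S N) →ₛₗ[F.φ] P,
      (∀ (s : F.Fil) (n : N) (h : (s : S) • n ∈ (F.Fil • ⊤ : Submodule S N)),
        v ⟨(s : S) • n, h⟩ = F.φ₁ s • u n) ∧
      ∀ y : (F.Fil • ⊤ : Submodule S N), u y = F.ϖ • v y := by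
  obtain ⟨n, e, ℓ, hℓ⟩ := exists_dual_basis S N
  let T : Fin n → ((F.Fil • ⊤ : Submodule S N) →ₛₗ[F.φ] P) := fun i =>
    (LinearMap.toSpanSingleton S _ (u (e i))).comp
      (F.φ₁.comp ((ℓ i).restrict (q := F.Fil) fun _ hx => apply_mem_of_mem_smul_top _ hx))
  have hT : ∀ i x, T i x = F.φ₁ ⟨ℓ i x, apply_mem_of_mem_smul_top _ x.2⟩ • u (e i) :=
    fun i x => rfl
  have hu : ∀ x, u x = ∑ i, F.φ (ℓ i x) • u (e i) := fun x => by
    conv_lhs => rw [← hℓ x]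
    simp only [map_sum, map_smulₛₗ]
  refine ⟨∑ i, T i, fun s n h => ?_, fun y => ?_⟩
  · rw [LinearMap.sum_apply, hu, Finset.smul_sum]
    refine Finset.sum_congr rfl fun i _ => ?_
    rw [hT, smul_smul, mul_comm, ← smul_eq_mul (F.φ _), ← map_smulₛₗ F.φ₁]
    congr 2
    refine Subtype.ext ?_
    simp [mul_comm]
  · rw [LinearMap.sum_apply, hu, Finset.smul_sum]
    refine Finset.sum_congr rfl fun i _ => ?_
    rw [hT, smul_smul, ← F.φ_eq]

/-- Windows with a given normal decomposition `L × N`: they correspond to Frobenius-linear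
automorphisms of `L × N`. -/
theorem exists_window_prod {L N : Type u} [AddCommGroup L] [Module S L] [Module.Finite S L]
    [Module.Projective S L] [AddCommGroup N] [Module S N] [Module.Finite S N]
    [Module.Projective S N] (Ψ : L × N →ₛₗ[F.φ] L × N)
    (hΨ : Submodule.span S (Set.range Ψ) = ⊤) :
    ∃ (Fil : Submodule S (L × N)) (Φ : L × N →ₛₗ[F.φ] L × N) (Φ₁ : Fil →ₛₗ[F.φ] L × N)
      (_ : ∃ L' N' : Submodule S (L × N), IsCompl L' N' ∧ Fil = L' ⊔ F.Fil • N')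
      (_ : ∀ (s : F.Fil) (m : L × N) (h : (s : S) • m ∈ Fil),
        Φ₁ ⟨(s : S) • m, h⟩ = F.φ₁ s • Φ m)
      (_ : ∀ m : Fil, Φ m = F.ϖ • Φ₁ m)
      (_ : Submodule.span S (Set.range Φ₁ ∪ Set.range Φ) = ⊤),
      (∀ x, x ∈ Fil ↔ x.2 ∈ (F.Fil • ⊤ : Submodule S N)) ∧
      (∀ l h, Φ₁ ⟨(l, 0), h⟩ = Ψ (l, 0)) ∧ ∀ n, Φ (0, n) = Ψ (0, n) := by
  obtain ⟨v, hv, hv'⟩ := exists_φ₁_extension F (Ψ.comp (LinearMap.inr S L N))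
  let Fil : Submodule S (L × N) := Submodule.comap (LinearMap.snd S L N) (F.Fil • ⊤)
  -- The values are forced: `Ψ` prescribes `Φ₁` on `L` and `Φ` on `N`, so `Φ = ϖ Ψ` on `L`, and `Φ₁`
  -- on `Fil S • N` is the extension `v`.
  let Φ : L × N →ₛₗ[F.φ] L × N := F.ϖ • Ψ.comp (LinearMap.inl S L N ∘ₗ LinearMap.fst S L N) +
    Ψ.comp (LinearMap.inr S L N ∘ₗ LinearMap.snd S L N)
  let Φ₁ : Fil →ₛₗ[F.φ] L × N :=
    Ψ.comp (LinearMap.inl S L N ∘ₗ LinearMap.fst S L N ∘ₗ Fil.subtype) +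
      v.comp ((LinearMap.snd S L N).restrict (p := Fil) fun _ h => h)
  have hΦ : ∀ x, Φ x = F.ϖ • Ψ (x.1, 0) + Ψ (0, x.2) := fun x => rfl
  have hΦ₁ : ∀ x : Fil, Φ₁ x = Ψ (x.1.1, 0) + v ⟨x.1.2, x.2⟩ := fun x => rfl
  have hΦ0 : ∀ n, Φ (0, n) = Ψ (0, n) := fun n => by
    have : Ψ ((0 : L), (0 : N)) = 0 := map_zero Ψ
    simp [hΦ, this]
  have hΦ₁0 : ∀ l h, Φ₁ ⟨(l, 0), h⟩ = Ψ (l, 0) := fun l h => by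
    have : v ⟨0, zero_mem _⟩ = 0 := map_zero v
    simp [hΦ₁, this]
  refine ⟨Fil, Φ, Φ₁, ⟨LinearMap.range (LinearMap.inl S L N), LinearMap.range (LinearMap.inr S L N),
    LinearMap.isCompl_range_inl_inr, ?_⟩, ?_, ?_, ?_, fun x => Iff.rfl, hΦ₁0, hΦ0⟩
  · apply le_antisymm
    · rintro ⟨l, n⟩ h
      have e : ((l, n) : L × N) = (l, 0) + (0, n) := by simp
      rw [e]
      refine add_mem (Submodule.mem_sup_left ⟨l, rfl⟩) (Submodule.mem_sup_right ?_)
      have : F.Fil • LinearMap.range (LinearMap.inr S L N) =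
          Submodule.map (LinearMap.inr S L N) (F.Fil • ⊤) := by
        rw [Submodule.map_smul'', LinearMap.range_eq_map]
      rw [this]
      exact ⟨n, h, rfl⟩
    · refine sup_le ?_ (Submodule.smul_le.2 fun a ha m _ => ?_)
      · rintro _ ⟨l, rfl⟩
        exact zero_mem (F.Fil • ⊤ : Submodule S N)
      · exact Submodule.smul_mem_smul (N := (⊤ : Submodule S N)) ha trivial
  · rintro s ⟨l, n⟩ h
    rw [hΦ₁, hΦ]
    have e1 : Ψ ((s : S) • l, 0) = F.φ s • Ψ (l, 0) := by
      rw [← map_smulₛₗ]; simp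
    refine (congrArg (Ψ ((s : S) • l, 0) + ·) (hv s n h)).trans ?_
    rw [e1, F.φ_eq, smul_add, smul_smul, mul_comm]
    rfl
  · rintro ⟨⟨l, n⟩, h⟩
    rw [hΦ₁, hΦ, smul_add]
    congr 1
    exact hv' ⟨n, h⟩
  · rw [eq_top_iff, ← hΨ, Submodule.span_le]
    rintro _ ⟨⟨l, n⟩, rfl⟩
    have e : ((l, n) : L × N) = (l, 0) + (0, n) := by simp
    rw [e, map_add, ← hΦ0, ← hΦ₁0 l (zero_mem (F.Fil • ⊤ : Submodule S N))]
    exact add_mem (Submodule.subset_span (Or.inl ⟨_, rfl⟩))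
      (Submodule.subset_span (Or.inr ⟨_, rfl⟩))

end Standard

namespace Window

variable {p : ℕ} {S : Type u} [CommRing S] {F : Frame p S}

theorem nonempty_iso_of_bijective {A B : Window F} (f : A ⟶ B)
    (hf : Function.Bijective f.toLinearMap) (hfil : B.Fil ≤ A.Fil.map f.toLinearMap) :
    Nonempty (A ≅ B) := by
  let e := LinearEquiv.ofBijective f.toLinearMap hf
  have he : ∀ x, e.symm (f.toLinearMap x) = x := fun x => e.symm_apply_apply x
  have he' : ∀ y, f.toLinearMap (e.symm y) = y := fun y => e.apply_symm_apply y
  have hF : ∀ y ∈ B.Fil, e.symm y ∈ A.Fil := fun y hy => by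
    obtain ⟨x, hx, rfl⟩ := hfil hy
    rw [he]
    exact hx
  refine ⟨⟨f, ⟨e.symm.toLinearMap, hF, fun y => ?_, fun y => ?_⟩, ?_, ?_⟩⟩
  · apply hf.1
    change f.toLinearMap (e.symm _) = f.toLinearMap (A.Φ (e.symm y))
    rw [he', f.map_Φ, he']
  · apply hf.1
    change f.toLinearMap (e.symm _) = f.toLinearMap (A.Φ₁ ⟨e.symm y, _⟩)
    rw [he', f.map_Φ₁]
    congr 1
    exact Subtype.ext (he' y).symm
  · exact hom_ext _ _ (LinearMap.ext he)
  · exact hom_ext _ _ (LinearMap.ext he')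

/-- If `x = pᵏ z`, then `z` need not lie in `Fil M`. Its `L`-component does, and there `Φ₁` is
Frobenius-linear; for the `N`-component the hypothesis on `φ₁` is applied to coordinates. -/
theorem Φ₁_mem_of_mem_pow (W : Window F)
    (h : ∀ k, ∀ b : F.Fil, (b : S) ∈ Ideal.span {(p : S)} ^ k →
      F.φ₁ b ∈ Ideal.span {(p : S)} ^ k) {k : ℕ} (x : W.Fil)
    (hx : (x : W.M) ∈ (Ideal.span {(p : S)} ^ k • ⊤ : Submodule S W.M)) :
    W.Φ₁ x ∈ (Ideal.span {(p : S)} ^ k • ⊤ : Submodule S W.M) := by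
  obtain ⟨L, N, hc, hF⟩ := W.normal
  obtain ⟨n, e, ℓ, hℓ⟩ := exists_dual_basis S W.M
  have hLF : L ≤ W.Fil := hF ▸ le_sup_left
  let πL : W.M →ₗ[S] W.M := L.projection N hc
  let πN : W.M →ₗ[S] W.M := N.projection L hc.symm
  have hπL : ∀ m, πL m ∈ W.Fil := fun m => hLF (Submodule.projection_apply_mem hc m)
  have hsum : ∀ m, πL m + πN m = m := fun m => Submodule.projection_add_projection_eq_self hc m
  have hπN : πN x ∈ (F.Fil • ⊤ : Submodule S W.M) := by
    obtain ⟨l, hl, y, hy, h1⟩ := Submodule.mem_sup.1 (hF.le x.2)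
    have h0 : πN l = 0 := (Submodule.projection_apply_eq_zero_iff hc.symm).2 hl
    rw [← h1, map_add, h0, zero_add]
    exact map_mem_smul_top πN (fun _ h => h) (Submodule.smul_mono le_rfl le_top hy)
  have hℓF : ∀ i, ℓ i (πN x) ∈ F.Fil := fun i => apply_mem_of_mem_smul_top _ hπN
  have hx' : x = ⟨πL x, hπL x⟩ + ∑ i, ⟨ℓ i (πN x) • e i, W.smul_top_le
      (Submodule.smul_mem_smul (hℓF i) trivial)⟩ := by
    refine Subtype.ext ?_
    simp [hℓ, hsum]
  rw [hx', map_add, map_sum]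
  refine add_mem ?_ (sum_mem fun i _ => ?_)
  · obtain ⟨z, hz⟩ := mem_span_pow_smul_top_iff.1 hx
    have : (⟨πL x, hπL x⟩ : W.Fil) = (p : S) ^ k • ⟨πL z, hπL z⟩ :=
      Subtype.ext (by simp [hz])
    rw [this, map_smulₛₗ, map_pow, map_natCast]
    exact mem_span_pow_smul_top_iff.2 ⟨_, rfl⟩
  · rw [W.Φ₁_smul ⟨_, hℓF i⟩]
    refine Submodule.smul_mem_smul (h k _ ?_) trivial
    exact apply_mem_of_mem_smul_top _ (map_mem_smul_top πN (fun _ h => h) hx)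

end Window

/-! ### The operator `theta` of the descent equation `theta T = T Ψ` -/

section Theta

variable {p : ℕ} {S S' : Type u} [CommRing S] [CommRing S'] {F : Frame p S} {F' : Frame p S'}
  [Algebra S S'] {α : FrameHom F F'} (hα : α.toRingHom = algebraMap S S')
  {W : Window F'} {L N : Type u} [AddCommGroup L] [Module S L] [AddCommGroup N] [Module S N]

namespace FrameHom

theorem semilinear_apply_eq (T : L × N →ₛₗ[algebraMap S S'] W.M) (x : L × N) :
    T x = T (x.1, 0) + T (0, x.2) := by
  rw [← map_add]; simp

/-- The Frobenius-linear map `(l, n) ↦ c⁻¹ Φ₁ (T l) + Φ (T n)`. -/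
noncomputable def theta (T : L × N →ₛₗ[algebraMap S S'] W.M) (hT : ∀ l, T (l, 0) ∈ W.Fil) :
    L × N →ₛₗ[(algebraMap S S').comp F.φ] W.M where
  toFun x := (↑α.c⁻¹ : S') • W.Φ₁ ⟨T (x.1, 0), hT x.1⟩ + W.Φ (T (0, x.2))
  map_add' x y := by
    have e1 : (⟨T ((x + y).1, 0), hT _⟩ : W.Fil) = ⟨T (x.1, 0), hT _⟩ + ⟨T (y.1, 0), hT _⟩ :=
      Subtype.ext (by
        change _ = T (x.1, 0) + T (y.1, 0)
        rw [← map_add]; simp)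
    have e2 : T (0, (x + y).2) = T (0, x.2) + T (0, y.2) := by rw [← map_add]; simp
    rw [e1, e2, map_add, map_add, smul_add]
    abel
  map_smul' r x := by
    have e1 : (⟨T ((r • x).1, 0), hT _⟩ : W.Fil) = algebraMap S S' r • ⟨T (x.1, 0), hT _⟩ :=
      Subtype.ext (by
        change _ = algebraMap S S' r • T (x.1, 0)
        rw [← map_smulₛₗ]; simp)
    have e2 : T (0, (r • x).2) = algebraMap S S' r • T (0, x.2) := by
      rw [← map_smulₛₗ]; simp
    rw [e1, e2, map_smulₛₗ, map_smulₛₗ, map_φ' α hα, smul_comm, ← smul_add]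
    rfl

theorem theta_apply (T : L × N →ₛₗ[algebraMap S S'] W.M) (hT : ∀ l, T (l, 0) ∈ W.Fil)
    (x : L × N) : theta hα T hT x =
      (↑α.c⁻¹ : S') • W.Φ₁ ⟨T (x.1, 0), hT x.1⟩ + W.Φ (T (0, x.2)) := rfl

theorem theta_add_smul (T τ : L × N →ₛₗ[algebraMap S S'] W.M) (hT : ∀ l, T (l, 0) ∈ W.Fil)
    (hτ : ∀ l, τ (l, 0) ∈ W.Fil) (a : S') (h : ∀ l, (T + a • τ) (l, 0) ∈ W.Fil) (x : L × N) :
    theta hα (T + a • τ) h x = theta hα T hT x + F'.φ a • theta hα τ hτ x := by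
  have e1 : (⟨(T + a • τ) (x.1, 0), h _⟩ : W.Fil) = ⟨T (x.1, 0), hT _⟩ + a • ⟨τ (x.1, 0), hτ _⟩ :=
    rfl
  have e2 : (T + a • τ) (0, x.2) = T (0, x.2) + a • τ (0, x.2) := rfl
  rw [theta_apply, theta_apply, theta_apply, e1, e2, map_add, map_add, map_smulₛₗ, map_smulₛₗ,
    smul_add, smul_add, smul_comm]
  abel

/-- This is the gain of a factor `p`: on `K • W` one has `Φ = ϖ Φ₁`, and `Φ₁` maps it into `p W`.
Corrections of `T` with values in `K` thus change `theta T` only modulo `p`. -/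
theorem theta_mem_of_divKer (τ : L × N →ₛₗ[algebraMap S S'] W.M) (hτ : ∀ l, τ (l, 0) ∈ W.Fil)
    (h : ∀ x, τ x ∈ (F'.divKer • ⊤ : Submodule S' W.M)) (x : L × N) :
    theta hα τ hτ x ∈ (Ideal.span {(p : S')} • ⊤ : Submodule S' W.M) := by
  have hK : ∀ x ∈ F'.divKer, ∃ h : x ∈ F'.Fil, F'.φ₁ ⟨x, h⟩ ∈ Ideal.span {(p : S')} :=
    fun x hx => hx
  obtain ⟨h1, h2⟩ := W.Φ₁_mem_smul_top hK (h (x.1, 0))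
  obtain ⟨h3, h4⟩ := W.Φ₁_mem_smul_top hK (h (0, x.2))
  rw [theta_apply, W.Φ_eq ⟨_, h3⟩]
  exact add_mem (Submodule.smul_mem _ _ h2) (Submodule.smul_mem _ _ h4)

/-- Continuity of `theta` in the `p`-adic topology, needed to pass to the limit in the descent
equation. -/
theorem theta_sub_mem (hC : α.Contracting) (T T' : L × N →ₛₗ[algebraMap S S'] W.M)
    (hT : ∀ l, T (l, 0) ∈ W.Fil) (hT' : ∀ l, T' (l, 0) ∈ W.Fil) {k : ℕ}
    (h : ∀ x, T x - T' x ∈ (Ideal.span {(p : S')} ^ k • ⊤ : Submodule S' W.M)) (x : L × N) :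
    theta hα T hT x - theta hα T' hT' x ∈
      (Ideal.span {(p : S')} ^ k • ⊤ : Submodule S' W.M) := by
  have e : theta hα T hT x - theta hα T' hT' x =
      (↑α.c⁻¹ : S') • W.Φ₁ (⟨T (x.1, 0), hT x.1⟩ - ⟨T' (x.1, 0), hT' x.1⟩) +
        W.Φ (T (0, x.2) - T' (0, x.2)) := by
    rw [theta_apply, theta_apply, map_sub, map_sub, smul_sub]
    abel
  rw [e]
  refine add_mem (Submodule.smul_mem _ _ ?_) ?_
  · exact W.Φ₁_mem_of_mem_pow hC.φ₁_mem _ (h (x.1, 0))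
  · refine map_mem_smul_top W.Φ (fun y hy => ?_) (h (0, x.2))
    rw [Ideal.span_singleton_pow, Ideal.mem_span_singleton] at hy ⊢
    obtain ⟨z, rfl⟩ := hy
    rw [map_mul, map_pow, map_natCast]
    exact dvd_mul_right _ _

/-- The image contains `Φ₁ (T l)` up to the unit `c`, and `Φ (T n)`. Then `Φ (T l) = ϖ Φ₁ (T l)`
gives all values of `Φ`, and the hypothesis on `W.Fil` gives all values of `Φ₁`, which together
generate `W`. -/
theorem span_range_theta (T : L × N →ₛₗ[algebraMap S S'] W.M) (hT : ∀ l, T (l, 0) ∈ W.Fil)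
    (hs : Function.Surjective (linearExt T))
    (hFil : W.Fil ≤ Submodule.span S' (Set.range fun l => T (l, 0)) ⊔ F'.Fil • ⊤) :
    Submodule.span S' (Set.range (theta hα T hT)) = ⊤ := by
  set U := Submodule.span S' (Set.range (theta hα T hT))
  have hL : ∀ l, W.Φ₁ ⟨T (l, 0), hT l⟩ ∈ U := fun l => by
    have h1 : theta hα T hT (l, 0) = (↑α.c⁻¹ : S') • W.Φ₁ ⟨T (l, 0), hT l⟩ := by
      have : T ((0 : L), (0 : N)) = 0 := map_zero T
      simp [theta_apply, this]
    have h2 : W.Φ₁ ⟨T (l, 0), hT l⟩ = (α.c : S') • theta hα T hT (l, 0) := by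
      rw [h1, smul_smul, Units.mul_inv, one_smul]
    rw [h2]
    exact U.smul_mem _ (Submodule.subset_span ⟨_, rfl⟩)
  have hN : ∀ n, W.Φ (T (0, n)) ∈ U := fun n => by
    have h1 : theta hα T hT (0, n) = W.Φ (T (0, n)) := by
      have h0 : (⟨T ((0 : L), (0 : N)), hT 0⟩ : W.Fil) = 0 := Subtype.ext (map_zero T)
      simp [theta_apply, h0]
    rw [← h1]
    exact Submodule.subset_span ⟨_, rfl⟩
  have hΦ : ∀ w, W.Φ w ∈ U := by
    intro w
    obtain ⟨y, rfl⟩ := hs w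
    induction y with
    | zero => rw [map_zero, map_zero]; exact zero_mem _
    | add x y hx hy => rw [map_add, map_add]; exact add_mem hx hy
    | tmul s x =>
      rw [linearExt_tmul, map_smulₛₗ, semilinear_apply_eq, map_add, W.Φ_eq ⟨_, hT x.1⟩]
      exact U.smul_mem _ (add_mem (U.smul_mem _ (hL _)) (hN _))
  have hΦ₁ : ∀ w ∈ Submodule.span S' (Set.range fun l => T (l, 0)) ⊔ F'.Fil • ⊤,
      ∃ h : w ∈ W.Fil, W.Φ₁ ⟨w, h⟩ ∈ U := by
    intro w hw
    obtain ⟨a, ha, b, hb, rfl⟩ := Submodule.mem_sup.1 hw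
    clear hw
    have h1 : ∃ h : a ∈ W.Fil, W.Φ₁ ⟨a, h⟩ ∈ U := by
      induction ha using Submodule.span_induction with
      | mem x hx => obtain ⟨l, rfl⟩ := hx; exact ⟨hT l, hL l⟩
      | zero =>
        have : W.Φ₁ ⟨0, zero_mem _⟩ = 0 := map_zero W.Φ₁
        exact ⟨zero_mem _, by rw [this]; exact zero_mem _⟩
      | add x y hx hy ihx ihy =>
        obtain ⟨h1, h2⟩ := ihx
        obtain ⟨h3, h4⟩ := ihy
        refine ⟨add_mem h1 h3, ?_⟩
        have := add_mem h2 h4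
        rwa [← map_add] at this
      | smul r x hx ih =>
        obtain ⟨h1, h2⟩ := ih
        refine ⟨W.Fil.smul_mem _ h1, ?_⟩
        have := U.smul_mem (F'.φ r) h2
        rwa [← map_smulₛₗ] at this
    have h2 : ∃ h : b ∈ W.Fil, W.Φ₁ ⟨b, h⟩ ∈ U := by
      induction hb using Submodule.smul_induction_on' with
      | smul r hr n _ =>
        refine ⟨W.smul_top_le (Submodule.smul_mem_smul hr trivial), ?_⟩
        rw [W.Φ₁_smul ⟨r, hr⟩]
        exact U.smul_mem _ (hΦ n)
      | add x hx y hy ihx ihy =>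
        obtain ⟨h1, h2⟩ := ihx
        obtain ⟨h3, h4⟩ := ihy
        refine ⟨add_mem h1 h3, ?_⟩
        have := add_mem h2 h4
        rwa [← map_add] at this
    obtain ⟨h1, h1'⟩ := h1
    obtain ⟨h2, h2'⟩ := h2
    refine ⟨add_mem h1 h2, ?_⟩
    have := add_mem h1' h2'
    rwa [← map_add] at this
  exact eq_top_iff.2 fun x _ => Window.eq_top_of_Φ_mem (U := U)
    (fun x => (hΦ₁ x (hFil x.2)).choose_spec) hΦ x

end FrameHom

end Theta

/-! ### Solving `theta T = T Ψ` by successive approximation -/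

section Descent

theorem span_range_eq_top_of_sub_mem {S M X : Type*} [CommRing S] [AddCommGroup M] [Module S M]
    [Module.Finite S M] {J : Ideal S} (hJ : J ≤ (⊥ : Ideal S).jacobson) {f g : X → M}
    (hf : Submodule.span S (Set.range f) = ⊤)
    (h : ∀ x, g x - f x ∈ (J • ⊤ : Submodule S M)) : Submodule.span S (Set.range g) = ⊤ := by
  rw [eq_top_iff]
  refine Submodule.le_of_le_smul_of_le_jacobson_bot Module.Finite.fg_top hJ ?_
  conv_lhs => rw [← hf]
  rw [Submodule.span_le]
  rintro _ ⟨x, rfl⟩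
  rw [← sub_sub_cancel (g x) (f x)]
  exact sub_mem (Submodule.mem_sup_left (Submodule.subset_span ⟨x, rfl⟩))
    (Submodule.mem_sup_right (h x))

variable {p : ℕ} {S S' : Type u} [CommRing S] [CommRing S'] {F : Frame p S} {F' : Frame p S'}
  [Algebra S S']

section

variable {M W : Type u} [AddCommGroup M] [Module S M] [AddCommGroup W] [Module S' W]

theorem exists_sub_apply_mem {K : Ideal S'} (hK : ∀ b, ∃ a, b - algebraMap S S' a ∈ K)
    (T : M →ₛₗ[algebraMap S S'] W) (hT : Function.Surjective (linearExt T)) (w : W) :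
    ∃ y, w - T y ∈ (K • ⊤ : Submodule S' W) := by
  obtain ⟨z, rfl⟩ := hT w
  obtain ⟨y, hy⟩ := exists_sub_one_tmul_mem hK z
  refine ⟨y, ?_⟩
  have := map_mem_smul_top (linearExt T) (fun _ h => h) hy
  rwa [map_sub, linearExt_tmul, one_smul] at this

variable [Module.Finite S M] [Module.Projective S M]

/-- Each value of `ε` at a dual basis vector is divided by `pᵏ` and split along `W = T(M) + K W`;
both parts extend Frobenius-linearly by coordinates. -/
theorem exists_semilinear_decomposition {K : Ideal S'}
    (hK : ∀ b, ∃ a, b - algebraMap S S' a ∈ K) (T : M →ₛₗ[algebraMap S S'] W)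
    (hT : Function.Surjective (linearExt T)) {φ : S →+* S} (k : ℕ)
    (ε : M →ₛₗ[(algebraMap S S').comp φ] W)
    (hε : ∀ m, ε m ∈ (Ideal.span {(p : S')} ^ k • ⊤ : Submodule S' W)) :
    ∃ (ψ : M →ₛₗ[φ] M) (ζ : M →ₛₗ[(algebraMap S S').comp φ] W),
      (∀ m, ζ m ∈ (K • ⊤ : Submodule S' W)) ∧ ∀ m, ε m = (p : S') ^ k • (T (ψ m) + ζ m) := by
  obtain ⟨n, e, ℓ, hℓ⟩ := exists_dual_basis S M
  choose w hw using fun i => mem_span_pow_smul_top_iff.1 (hε (e i))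
  choose y hy using fun i => exists_sub_apply_mem hK T hT (w i)
  refine ⟨{ toFun := fun m => ∑ i, φ (ℓ i m) • y i
            map_add' := fun a b => by simp [add_smul, Finset.sum_add_distrib]
            map_smul' := fun r a => by simp [mul_smul, Finset.smul_sum] },
    { toFun := fun m => ∑ i, algebraMap S S' (φ (ℓ i m)) • (w i - T (y i))
      map_add' := fun a b => by simp [add_smul, Finset.sum_add_distrib]
      map_smul' := fun r a => by simp [mul_smul, Finset.smul_sum] },
    fun m => ?_, fun m => ?_⟩
  · change ∑ i, algebraMap S S' (φ (ℓ i m)) • (w i - T (y i)) ∈ _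
    exact sum_mem fun i _ => Submodule.smul_mem _ _ (hy i)
  have h1 : ε m = ∑ i, algebraMap S S' (φ (ℓ i m)) • ε (e i) := by
    conv_lhs => rw [← hℓ m]
    simp only [map_sum, map_smulₛₗ, RingHom.comp_apply]
  simp only [LinearMap.coe_mk, AddHom.coe_mk, map_sum, map_smulₛₗ]
  rw [h1, ← Finset.sum_add_distrib, Finset.smul_sum]
  refine Finset.sum_congr rfl fun i _ => ?_
  rw [← smul_add, add_sub_cancel, hw, smul_comm]

/-- The extension theorem along `Ψ` is applied with target the submodule `K • W` itself, so that the
solution takes values there. -/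
theorem exists_correction (hp : p ≠ 0) (K : Ideal S') {Ψ : M →ₛₗ[F.φ] M}
    (hΨ : Submodule.span S (Set.range Ψ) = ⊤) (ζ : M →ₛₗ[(algebraMap S S').comp F.φ] W)
    (hζ : ∀ m, ζ m ∈ (K • ⊤ : Submodule S' W)) :
    ∃ τ : M →ₛₗ[algebraMap S S'] W,
      (∀ m, τ m ∈ (K • ⊤ : Submodule S' W)) ∧ ∀ m, τ (Ψ m) = ζ m := by
  obtain ⟨τ, hτ⟩ := exists_semilinear_comp_eq F hp (σ := algebraMap S S') Ψ hΨ
    (ζ.codRestrict (K • ⊤ : Submodule S' W) hζ)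
  exact ⟨(K • ⊤ : Submodule S' W).subtype.comp τ, fun m => (τ m).2,
    fun m => congrArg Subtype.val (hτ m)⟩

/-- Modulo `J`, the module `W` is `M` modulo `I` and `Θ` becomes `Ψ`. Hence the image of `Ψ`
generates `M` modulo `I`, and Nakayama applies. -/
theorem span_range_eq_top_of_theta {I : Ideal S} {J : Ideal S'}
    (hI : I ≤ (⊥ : Ideal S).jacobson) (h1 : ∀ a, algebraMap S S' a ∈ J → a ∈ I)
    (h2 : ∀ b, ∃ a, b - algebraMap S S' a ∈ J) (T : M →ₛₗ[algebraMap S S'] W)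
    (hT : Function.Bijective (linearExt T)) {Θ : M → W}
    (hΘ : Submodule.span S' (Set.range Θ) = ⊤) {Ψ : M → M}
    (h : ∀ x, Θ x - T (Ψ x) ∈ (J • ⊤ : Submodule S' W)) :
    Submodule.span S (Set.range Ψ) = ⊤ := by
  set U := Submodule.span S (Set.range Ψ)
  have hV : ∀ w : W, ∃ u ∈ U, w - T u ∈ (J • ⊤ : Submodule S' W) := by
    intro w
    have hw : w ∈ Submodule.span S' (Set.range Θ) := hΘ ▸ Submodule.mem_top
    induction hw using Submodule.span_induction with
    | mem x hx => obtain ⟨x, rfl⟩ := hx; exact ⟨_, Submodule.subset_span ⟨x, rfl⟩, h x⟩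
    | zero => exact ⟨0, zero_mem _, by rw [map_zero, sub_zero]; exact zero_mem _⟩
    | add x y _ _ hx hy =>
      obtain ⟨u, hu, hu'⟩ := hx
      obtain ⟨v, hv, hv'⟩ := hy
      refine ⟨u + v, add_mem hu hv, ?_⟩
      rw [map_add, add_sub_add_comm]
      exact add_mem hu' hv'
    | smul b x _ hx =>
      obtain ⟨u, hu, hu'⟩ := hx
      obtain ⟨a, ha⟩ := h2 b
      refine ⟨a • u, U.smul_mem _ hu, ?_⟩
      have e : b • x - T (a • u) = (b - algebraMap S S' a) • x + algebraMap S S' a • (x - T u) := by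
        rw [map_smulₛₗ, sub_smul, smul_sub]; abel
      rw [e]
      exact add_mem (Submodule.smul_mem_smul ha trivial) (Submodule.smul_mem _ _ hu')
  rw [eq_top_iff]
  refine Submodule.le_of_le_smul_of_le_jacobson_bot Module.Finite.fg_top hI fun m _ => ?_
  obtain ⟨u, hu, hu'⟩ := hV (T m)
  have h3 : (1 : S') ⊗ₜ[S] (m - u) ∈ (J • ⊤ : Submodule S' (S' ⊗[S] M)) := by
    rw [← map_sub] at hu'
    have h4 : Submodule.map (linearExt T) (J • ⊤) = J • ⊤ := by
      rw [Submodule.map_smul'', Submodule.map_top, LinearMap.range_eq_top.2 hT.2]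
    rw [← h4] at hu'
    obtain ⟨x, hx, hx'⟩ := hu'
    have : x = (1 : S') ⊗ₜ[S] (m - u) := hT.1 (by rw [hx', linearExt_tmul, one_smul])
    exact this ▸ hx
  obtain ⟨n, e, ℓ, hℓ⟩ := exists_dual_basis S M
  rw [← add_sub_cancel u m]
  refine add_mem (Submodule.mem_sup_left hu) (Submodule.mem_sup_right ?_)
  rw [← hℓ (m - u)]
  refine sum_mem fun i _ => Submodule.smul_mem_smul (h1 _ ?_) trivial
  rw [← coord_one_tmul]
  exact apply_mem_of_mem_smul_top _ h3

end

namespace FrameHom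

variable {α : FrameHom F F'} (hα : α.toRingHom = algebraMap S S') {W : Window F'}
  {L N : Type u} [AddCommGroup L] [Module S L] [Module.Finite S L] [Module.Projective S L]
  [AddCommGroup N] [Module S N] [Module.Finite S N] [Module.Projective S N]

/-- An error `pᵏ (T ψ + ζ)`, with `ζ` valued in `K`, is removed by adding `pᵏ ψ` to `Ψ` and `pᵏ τ`
to `T`, where `τ Ψ = ζ`. The new error is a multiple of `pᵏ⁺¹`: `theta τ` is divisible by `p`, and
the cross term `τ ψ` carries `p²ᵏ`. -/
theorem exists_descent (hp : p ≠ 0) (hC : α.Contracting) (T₀ : L × N →ₛₗ[algebraMap S S'] W.M)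
    (hT₀ : ∀ l, T₀ (l, 0) ∈ W.Fil) (hb : Function.Bijective (linearExt T₀))
    (hFil : W.Fil ≤ Submodule.span S' (Set.range fun l => T₀ (l, 0)) ⊔ F'.Fil • ⊤) :
    ∃ (T : L × N →ₛₗ[algebraMap S S'] W.M) (hT : ∀ l, T (l, 0) ∈ W.Fil)
      (Ψ : L × N →ₛₗ[F.φ] L × N), (∀ x, T x - T₀ x ∈ (F'.Fil • ⊤ : Submodule S' W.M)) ∧
      Submodule.span S (Set.range Ψ) = ⊤ ∧ ∀ x, theta hα T hT x = T (Ψ x) := by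
  have hK := hC.exists_sub_mem' hα
  have hJjac : F'.Fil ≤ (⊥ : Ideal S').jacobson := le_sup_left.trans F'.le_jacobson
  have hpjac : Ideal.span {(p : S)} ≤ (⊥ : Ideal S).jacobson := le_sup_right.trans F.le_jacobson
  have := hC.complete_source
  have := hC.complete_target
  have := isAdicComplete_of_projective (M := W.M) (Ideal.span {(p : S')})
  have := isAdicComplete_of_projective (M := L × N) (Ideal.span {(p : S)})
  have hKJ : (F'.divKer • ⊤ : Submodule S' W.M) ≤ F'.Fil • ⊤ :=
    Submodule.smul_mono_left F'.divKer_le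
  have hfil : ∀ T : L × N →ₛₗ[algebraMap S S'] W.M,
      (∀ x, T x - T₀ x ∈ (F'.Fil • ⊤ : Submodule S' W.M)) → ∀ l, T (l, 0) ∈ W.Fil := by
    intro T hT l
    have := add_mem (W.smul_top_le (hT (l, 0))) (hT₀ l)
    rwa [sub_add_cancel] at this
  have hsurj : ∀ T : L × N →ₛₗ[algebraMap S S'] W.M,
      (∀ x, T x - T₀ x ∈ (F'.Fil • ⊤ : Submodule S' W.M)) →
        Function.Surjective (linearExt T) := by
    intro T hT
    refine surjective_of_sub_mem_smul_top hJjac hb.2 fun x => ?_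
    rw [← LinearMap.sub_apply]
    refine forall_mem_of_forall_one_tmul (fun m => ?_) x
    rw [LinearMap.sub_apply, linearExt_tmul, linearExt_tmul, one_smul, one_smul]
    exact hT m
  -- Approximate solutions with error in `pᵏ W`. The congruence with `T₀` modulo `K` preserves `T L
  -- ⊆ Fil W` and the surjectivity of `linearExt T`.
  let X : ℕ → Type u := fun k =>
    {P : (L × N →ₛₗ[algebraMap S S'] W.M) × (L × N →ₛₗ[F.φ] L × N) //
      (∀ x, P.1 x - T₀ x ∈ (F'.divKer • ⊤ : Submodule S' W.M)) ∧
      Submodule.span S (Set.range P.2) = ⊤ ∧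
      ∀ h x, theta hα P.1 h x - P.1 (P.2 x) ∈
        (Ideal.span {(p : S')} ^ k • ⊤ : Submodule S' W.M)}
  -- At precision `p⁰` the cross term `τ ψ` would not be small, so the initial step takes all of `ψ`
  -- as `Ψ` and only corrects `T₀` by `τ`. The recursion therefore starts at `k = 1`.
  have start : Nonempty (X 1) := by
    obtain ⟨ψ, ζ, hζ, h⟩ := exists_semilinear_decomposition (p := p) hK T₀ hb.2 0
      (theta hα T₀ hT₀) (fun m => by simp)
    simp only [pow_zero, one_smul] at h
    have hψ : Submodule.span S (Set.range ψ) = ⊤ := by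
      refine span_range_eq_top_of_theta (le_sup_left.trans F.le_jacobson)
        (fun a ha => hC.mem_fil a (hα ▸ ha))
        (fun b => (hK b).imp fun a ha => F'.divKer_le ha) T₀ hb
        (span_range_theta hα T₀ hT₀ hb.2 hFil) (fun x => ?_)
      rw [h, add_sub_cancel_left]
      exact hKJ (hζ x)
    obtain ⟨τ, hτ, hτ'⟩ := exists_correction hp F'.divKer hψ ζ hζ
    have hτF : ∀ l, τ (l, 0) ∈ W.Fil := fun l => W.smul_top_le (hKJ (hτ _))
    refine ⟨⟨(T₀ + (1 : S') • τ, ψ), fun x => ?_, hψ, fun h' x => ?_⟩⟩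
    · simpa using hτ x
    · rw [theta_add_smul hα T₀ τ hT₀ hτF, map_one, one_smul, h x, ← hτ' x, pow_one]
      have := theta_mem_of_divKer hα τ hτF hτ x
      simpa using this
  have step : ∀ k (P : X (k + 1)), ∃ P' : X (k + 2),
      (∀ x, P'.1.1 x - P.1.1 x ∈ (Ideal.span {(p : S')} ^ (k + 1) • ⊤ : Submodule S' W.M)) ∧
      ∀ x, P'.1.2 x - P.1.2 x ∈
        (Ideal.span {(p : S)} ^ (k + 1) • ⊤ : Submodule S (L × N)) := by
    rintro k ⟨⟨T, Ψ⟩, hT, hΨ, hε⟩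
    have hTF := hfil T fun x => hKJ (hT x)
    have : RingHomCompTriple F.φ (algebraMap S S') ((algebraMap S S').comp F.φ) := ⟨rfl⟩
    obtain ⟨ψ, ζ, hζ, h⟩ := exists_semilinear_decomposition hK T
      (hsurj T fun x => hKJ (hT x)) (k + 1) (theta hα T hTF - T.comp Ψ) (hε hTF)
    obtain ⟨τ, hτ, hτ'⟩ := exists_correction hp F'.divKer hΨ ζ hζ
    have hτF : ∀ l, τ (l, 0) ∈ W.Fil := fun l => W.smul_top_le (hKJ (hτ _))
    have hΨ' : ∀ x, (Ψ + (p : S) ^ (k + 1) • ψ) x - Ψ x ∈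
        (Ideal.span {(p : S)} ^ (k + 1) • ⊤ : Submodule S (L × N)) := fun x =>
      mem_span_pow_smul_top_iff.2 ⟨ψ x, by simp⟩
    refine ⟨⟨(T + (p : S') ^ (k + 1) • τ, Ψ + (p : S) ^ (k + 1) • ψ), fun x => ?_, ?_,
      fun h' x => ?_⟩, fun x => mem_span_pow_smul_top_iff.2 ⟨τ x, by simp⟩, hΨ'⟩
    · have := add_mem (hT x) (Submodule.smul_mem _ ((p : S') ^ (k + 1)) (hτ x))
      convert this using 1
      simp only [LinearMap.add_apply, LinearMap.smul_apply]
      abel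
    · refine span_range_eq_top_of_sub_mem hpjac hΨ fun x => ?_
      refine Submodule.smul_mono_left ?_ (hΨ' x)
      exact Ideal.pow_le_self k.succ_ne_zero
    · have h3 := theta_mem_of_divKer hα τ hτF hτ x
      rw [← pow_one (Ideal.span _)] at h3
      obtain ⟨z, hz⟩ := mem_span_pow_smul_top_iff.1 h3
      have h4 : theta hα T hTF x = T (Ψ x) + (p : S') ^ (k + 1) • (T (ψ x) + τ (Ψ x)) := by
        rw [hτ', ← h x, LinearMap.sub_apply, LinearMap.comp_apply, add_sub_cancel]
      rw [theta_add_smul hα T τ hTF hτF, h4, hz]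
      -- Here `p z = theta τ x`, and the cross term `p^(2k+2) τ ψ` equals `pᵏ⁺² · pᵏ τ ψ`.
      refine mem_span_pow_smul_top_iff.2 ⟨z - (p : S') ^ k • τ (ψ x), ?_⟩
      simp only [LinearMap.add_apply, LinearMap.smul_apply, map_add, map_smulₛₗ, map_pow,
        map_natCast, smul_add, smul_sub, smul_smul, pow_one]
      have e1 : (p : S') ^ (k + 2) = p ^ (k + 1) * p := pow_succ _ _
      have e2 : (p : S') ^ (k + 2) * p ^ k = p ^ (k + 1) * p ^ (k + 1) := by ring
      rw [e2, e1]
      abel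
  choose next hnext₁ hnext₂ using step
  obtain ⟨P₁⟩ := start
  let s : ∀ k, X (k + 1) := fun k => Nat.rec (motive := fun k => X (k + 1)) P₁ next k
  have hs : ∀ k, s (k + 1) = next k (s k) := fun k => rfl
  have mono : ∀ {A V : Type u} [CommRing A] [AddCommGroup V] [Module A V] (I : Ideal A) (k : ℕ),
      (I ^ (k + 1) • ⊤ : Submodule A V) ≤ I ^ k • ⊤ := fun I k =>
    Submodule.smul_mono_left (Ideal.pow_le_pow_right k.le_succ)
  obtain ⟨T, hT⟩ := exists_limit_semilinear (Ideal.span {(p : S')}) (fun k => (s k).1.1)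
    fun k x => mono _ k (hnext₁ k (s k) x)
  obtain ⟨Ψ, hΨ⟩ := exists_limit_semilinear (Ideal.span {(p : S)}) (fun k => (s k).1.2)
    fun k x => mono _ k (hnext₂ k (s k) x)
  have hTJ : ∀ x, T x - T₀ x ∈ (F'.Fil • ⊤ : Submodule S' W.M) := by
    intro x
    obtain ⟨n, e, ℓ, hℓ⟩ := exists_dual_basis S' W.M
    rw [← hℓ (T x - T₀ x)]
    -- The approximations agree with `T₀` modulo `Fil S'`, and so does their limit, because `Fil S'`
    -- is `p`-adically closed.
    refine sum_mem fun i _ => Submodule.smul_mem_smul (hC.fil_closed _ fun k => ?_) trivial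
    have e1 : ℓ i (T x - T₀ x) = ℓ i ((s k).1.1 x - T₀ x) + ℓ i (T x - (s k).1.1 x) := by
      rw [← map_add]; congr 1; abel
    rw [e1]
    exact add_mem (Submodule.mem_sup_left (apply_mem_of_mem_smul_top _ (hKJ ((s k).2.1 x))))
      (Submodule.mem_sup_right (apply_mem_of_mem_smul_top _ (hT k x)))
  have hTF := hfil T hTJ
  refine ⟨T, hTF, Ψ, hTJ, ?_, fun x => ?_⟩
  · refine span_range_eq_top_of_sub_mem hpjac (s 1).2.2.1 fun x => ?_
    have := hΨ 1 x
    rwa [pow_one] at this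
  · rw [← sub_eq_zero]
    refine eq_zero_of_forall_mem_pow_smul_top (Ideal.span {(p : S')}) fun k => ?_
    have hF := hfil (s k).1.1 fun x => hKJ ((s k).2.1 x)
    have h1 := theta_sub_mem hα hC T (s k).1.1 hTF hF (hT k) x
    have h2 := mono _ k ((s k).2.2.2 hF x)
    have h3 : (s k).1.1 ((s k).1.2 x - Ψ x) ∈
        (Ideal.span {(p : S')} ^ k • ⊤ : Submodule S' W.M) := by
      refine map_mem_smul_top (I := Ideal.span {(p : S)} ^ k) _ (fun y hy => ?_) ?_
      · rw [Ideal.span_singleton_pow, Ideal.mem_span_singleton] at hy ⊢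
        obtain ⟨z, rfl⟩ := hy
        rw [map_mul, map_pow, map_natCast]
        exact dvd_mul_right _ _
      · rw [← neg_sub]
        exact neg_mem (hΨ k x)
    have h4 := hT k (Ψ x)
    have e : theta hα T hTF x - T (Ψ x) =
        (theta hα T hTF x - theta hα (s k).1.1 hF x) +
        (theta hα (s k).1.1 hF x - (s k).1.1 ((s k).1.2 x)) +
        (s k).1.1 ((s k).1.2 x - Ψ x) - (T (Ψ x) - (s k).1.1 (Ψ x)) := by
      rw [map_sub]; abel
    rw [e]
    exact sub_mem (add_mem (add_mem h1 h2) h3) h4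

end FrameHom

end Descent

/-! ### Essential surjectivity, and the criterion for being crystalline -/

section EssSurj

variable {p : ℕ} {S S' : Type u} [CommRing S] [CommRing S'] {F : Frame p S} {F' : Frame p S'}
  [Algebra S S']

namespace FrameHom

variable (α : FrameHom F F') (hα : α.toRingHom = algebraMap S S')

theorem exists_hom_of_semilinear {V : Window F} {W : Window F'} (T : V.M →ₛₗ[algebraMap S S'] W.M)
    (hfil : ∀ x ∈ V.Fil, T x ∈ W.Fil) (hΦ : ∀ m, W.Φ (T m) = T (V.Φ m))
    (hΦ₁ : ∀ x : V.Fil, W.Φ₁ ⟨T x, hfil x x.2⟩ = (α.c : S') • T (V.Φ₁ x)) :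
    ∃ f : bcObj α hα V ⟶ W, f.toLinearMap = linearExt T := by
  have hfil' : ∀ x ∈ bcFil F' V, linearExt T x ∈ W.Fil := by
    have hle : bcFil F' V ≤ W.Fil.comap (linearExt T) := by
      refine Submodule.span_le.2 ?_
      rintro y (⟨a, ha, m, rfl⟩ | ⟨x, hx, rfl⟩)
      · simp only [Submodule.comap_coe, Set.mem_preimage, map_smul]
        exact W.smul_top_le (Submodule.smul_mem_smul ha trivial)
      · simp only [Submodule.comap_coe, Set.mem_preimage, linearExt_tmul, one_smul]
        exact hfil x hx
    exact fun x hx => hle hx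
  have hΦ' : ∀ x, linearExt T (bcΦ α hα V x) = W.Φ (linearExt T x) := by
    refine semilinear_ext_one_tmul (f := (linearExt T).comp (bcΦ α hα V))
      (g := W.Φ.comp (linearExt T)) fun m => ?_
    simp [bcΦ, hΦ]
  refine ⟨⟨linearExt T, hfil', hΦ', fun x => ?_⟩, rfl⟩
  refine bcFil_hom_ext (f := (linearExt T).comp (bcΦ₁ α hα V))
    (g := W.Φ₁.comp ((linearExt T).restrict hfil')) (fun a m h => ?_) (fun x h => ?_) x
  · have e : (linearExt T).restrict hfil' ⟨(a : S') • m, h⟩ =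
        ⟨(a : S') • linearExt T m, W.smul_top_le (Submodule.smul_mem_smul a.2 trivial)⟩ :=
      Subtype.ext (map_smul (linearExt T) (a : S') m)
    rw [LinearMap.comp_apply, LinearMap.comp_apply, e, bcΦ₁_smul, W.Φ₁_smul, map_smul, hΦ']
  · have e : (linearExt T).restrict hfil' ⟨(1 : S') ⊗ₜ[S] (x : V.M), h⟩ =
        ⟨T x, hfil x x.2⟩ := Subtype.ext (one_smul _ _)
    rw [LinearMap.comp_apply, LinearMap.comp_apply, e, bcΦ₁_one_tmul, linearExt_tmul, hΦ₁]

/-- On `Fil S • V` the compatibility with `Φ₁` follows from that with `Φ`, by `Φ₁ (s m) = φ₁ s • Φ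
m` and `φ₁' α = c α φ₁`. Only `L` remains to be checked. -/
theorem map_Φ₁_of_fil_eq (hα : α.toRingHom = algebraMap S S') {V : Window F} {W : Window F'} (T : V.M →ₛₗ[algebraMap S S'] W.M)
    (hfil : ∀ x ∈ V.Fil, T x ∈ W.Fil) (hΦ : ∀ m, W.Φ (T m) = T (V.Φ m)) {L : Submodule S V.M}
    (hL : V.Fil = L ⊔ F.Fil • ⊤)
    (h : ∀ x : V.Fil, (x : V.M) ∈ L → W.Φ₁ ⟨T x, hfil x x.2⟩ = (α.c : S') • T (V.Φ₁ x))
    (x : V.Fil) : W.Φ₁ ⟨T x, hfil x x.2⟩ = (α.c : S') • T (V.Φ₁ x) := by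
  have : RingHomCompTriple F.φ (algebraMap S S') ((algebraMap S S').comp F.φ) := ⟨rfl⟩
  have : RingHomCompTriple (algebraMap S S') F'.φ ((algebraMap S S').comp F.φ) :=
    ⟨RingHom.ext (map_φ' α hα)⟩
  let f : V.Fil →ₛₗ[(algebraMap S S').comp F.φ] W.M :=
    W.Φ₁.comp ((T.domRestrict V.Fil).codRestrict W.Fil fun x => hfil x x.2)
  let g : V.Fil →ₛₗ[(algebraMap S S').comp F.φ] W.M := (α.c : S') • T.comp V.Φ₁
  have hfg : f = g := by
    refine V.fil_hom_ext hL (fun l hl hl' => h ⟨l, hl⟩ hl') (fun s hs n _ hsn => ?_)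
    have e : f ⟨s • n, hsn⟩ = W.Φ₁ ⟨algebraMap S S' s • T n, W.smul_top_le
        (Submodule.smul_mem_smul (hα ▸ α.map_fil s hs) trivial)⟩ :=
      congrArg W.Φ₁ (Subtype.ext (map_smulₛₗ T s n))
    have e' : F'.φ₁ ⟨algebraMap S S' s, hα ▸ α.map_fil s hs⟩ =
        α.c * algebraMap S S' (F.φ₁ ⟨s, hs⟩) := by
      have := α.map_φ₁ ⟨s, hs⟩
      simp only [hα] at this
      exact this
    rw [e, W.Φ₁_smul ⟨_, hα ▸ α.map_fil s hs⟩, e', hΦ]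
    change _ = (α.c : S') • T (V.Φ₁ ⟨s • n, hsn⟩)
    rw [V.Φ₁_smul ⟨s, hs⟩, map_smulₛₗ, mul_smul]
  exact congrArg (fun f => f x) hfg

/-- `Ψ` defines a window on `L × N`, and the equation `theta T = T Ψ` says that `T` is compatible
with `Φ` on `N` and with `Φ₁`, up to `c`, on `L`. The induced homomorphism from the base change is
bijective and strict for the filtrations. -/
theorem nonempty_iso_of_theta {W : Window F'} {L N : Type u} [AddCommGroup L] [Module S L]
    [Module.Finite S L] [Module.Projective S L] [AddCommGroup N] [Module S N] [Module.Finite S N]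
    [Module.Projective S N] (T : L × N →ₛₗ[algebraMap S S'] W.M)
    (hT : ∀ l, T (l, 0) ∈ W.Fil) (hb : Function.Bijective (linearExt T))
    (hFil : W.Fil ≤ Submodule.span S' (Set.range fun l => T (l, 0)) ⊔ F'.Fil • ⊤)
    (Ψ : L × N →ₛₗ[F.φ] L × N) (hΨ : Submodule.span S (Set.range Ψ) = ⊤)
    (h : ∀ x, theta hα T hT x = T (Ψ x)) : ∃ V : Window F, Nonempty (bcObj α hα V ≅ W) := by
  obtain ⟨Fil, Φ, Φ₁, h1, h2, h3, h4, hmem, hΦ₁, hΦ⟩ := exists_window_prod F Ψ hΨ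
  let V : Window F := ⟨L × N, Fil, Φ, Φ₁, h1, h2, h3, h4⟩
  have hsplit : ∀ x : L × N, x = (x.1, 0) + (0, x.2) := fun x => by simp
  have hT0 : T ((0 : L), (0 : N)) = 0 := map_zero T
  have hL0 : ∀ l : L, (l, (0 : N)) ∈ Fil := fun l => (hmem _).2 (zero_mem _)
  have hTL : ∀ l, W.Φ₁ ⟨T (l, 0), hT l⟩ = (α.c : S') • T (Ψ (l, 0)) := fun l => by
    rw [← h, theta_apply]
    simp [hT0, smul_smul]
  have hTN : ∀ n, W.Φ (T (0, n)) = T (Ψ (0, n)) := fun n => by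
    have h0 : (⟨T ((0 : L), (0 : N)), hT 0⟩ : W.Fil) = 0 := Subtype.ext hT0
    rw [← h, theta_apply]
    simp [h0]
  have hVL : Fil = LinearMap.range (LinearMap.inl S L N) ⊔ F.Fil • ⊤ := by
    refine le_antisymm (fun x hx => ?_) (sup_le ?_ (Submodule.smul_le.2 fun a ha m _ => ?_))
    · rw [hsplit x]
      refine add_mem (Submodule.mem_sup_left ⟨x.1, rfl⟩) (Submodule.mem_sup_right ?_)
      exact map_mem_smul_top (LinearMap.inr S L N) (fun _ h => h) ((hmem x).1 hx)
    · rintro _ ⟨l, rfl⟩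
      exact hL0 l
    · exact (hmem _).2 (Submodule.smul_mem_smul (N := (⊤ : Submodule S N)) ha trivial)
  have hsmul : ∀ x ∈ (F.Fil • ⊤ : Submodule S (L × N)), T x ∈ (F'.Fil • ⊤ : Submodule S' W.M) :=
    fun x hx => map_mem_smul_top T (fun a ha => hα ▸ α.map_fil a ha) hx
  have hfil : ∀ x ∈ Fil, T x ∈ W.Fil := by
    intro x hx
    obtain ⟨_, ⟨l, rfl⟩, y, hy, rfl⟩ := Submodule.mem_sup.1 (hVL.le hx)
    rw [map_add]
    exact add_mem (hT l) (W.smul_top_le (hsmul y hy))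
  have hΦ' : ∀ m, W.Φ (T m) = T (Φ m) := by
    intro m
    have h5 : algebraMap S S' F.ϖ = F'.ϖ * α.c := by rw [← hα, mul_comm]; exact α.map_ϖ
    conv_lhs => rw [hsplit m]
    conv_rhs => rw [hsplit m]
    rw [map_add, map_add, map_add, map_add, hTN, hΦ, W.Φ_eq ⟨_, hT m.1⟩, hTL,
      h3 ⟨_, hL0 m.1⟩, hΦ₁, map_smulₛₗ, h5, mul_smul]
  have hΦ₁' := map_Φ₁_of_fil_eq (V := V) α hα T hfil hΦ' hVL (by
    rintro ⟨_, hx⟩ ⟨l, rfl⟩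
    refine (hTL l).trans ?_
    rw [← hΦ₁ l hx]
    rfl)
  obtain ⟨f, hf⟩ := exists_hom_of_semilinear (V := V) α hα T hfil hΦ' hΦ₁'
  refine ⟨V, Window.nonempty_iso_of_bijective f (hf ▸ hb) (hFil.trans (sup_le ?_ ?_))⟩
  · rw [Submodule.span_le]
    rintro _ ⟨l, rfl⟩
    refine ⟨(1 : S') ⊗ₜ[S] ((l, 0) : L × N), one_tmul_mem_bcFil V (hL0 l), ?_⟩
    rw [hf]
    exact one_smul _ _
  · refine Submodule.smul_le.2 fun a ha m _ => ?_
    obtain ⟨y, rfl⟩ := hb.2 m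
    refine ⟨a • y, smul_mem_bcFil V ha y, ?_⟩
    rw [hf]
    exact map_smul (linearExt T) a y

/-- The two summands of a normal decomposition of `W` are descended separately, along the
isomorphism `S / Fil S = S' / Fil S'`. Nothing is required about Frobenius at this stage. -/
theorem exists_prod_descent (hα : α.toRingHom = algebraMap S S') (hC : α.Contracting) (W : Window F') :
    ∃ (L N : Type u) (_ : AddCommGroup L) (_ : Module S L) (_ : Module.Finite S L)
      (_ : Module.Projective S L) (_ : AddCommGroup N) (_ : Module S N) (_ : Module.Finite S N)
      (_ : Module.Projective S N) (T : L × N →ₛₗ[algebraMap S S'] W.M),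
      (∀ l, T (l, 0) ∈ W.Fil) ∧ Function.Bijective (linearExt T) ∧
      W.Fil ≤ Submodule.span S' (Set.range fun l => T (l, 0)) ⊔ F'.Fil • ⊤ := by
  obtain ⟨L', N', hc, hF⟩ := W.normal
  have hfin : ∀ {A B : Submodule S' W.M}, IsCompl A B →
      Module.Finite S' A ∧ Module.Projective S' A := by
    intro A B h
    have hs : (A.projectionOnto B h) ∘ₗ A.subtype = LinearMap.id :=
      Submodule.projectionOnto_comp_subtype h
    exact ⟨Module.Finite.of_surjective (A.projectionOnto B h) fun x =>
      ⟨x, congrArg (fun f => f x) hs⟩, Module.Projective.of_split _ _ hs⟩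
  have := (hfin hc).1
  have := (hfin hc).2
  have := (hfin hc.symm).1
  have := (hfin hc.symm).2
  have := hC.complete_fil
  have hJ : F'.Fil ≤ (⊥ : Ideal S').jacobson := le_sup_left.trans F'.le_jacobson
  have h1 : ∀ a, algebraMap S S' a ∈ F'.Fil → a ∈ F.Fil := fun a ha => hC.mem_fil a (hα ▸ ha)
  have h1' : ∀ a ∈ F.Fil, algebraMap S S' a ∈ F'.Fil := fun a ha => hα ▸ α.map_fil a ha
  have h2 : ∀ b, ∃ a, b - algebraMap S S' a ∈ F'.Fil := fun b =>
    (hC.exists_sub_mem' hα b).imp fun a ha => F'.divKer_le ha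
  obtain ⟨L, _, _, _, _, TL, hTL⟩ := exists_projective_descent (W := L') hJ h1 h1' h2
  obtain ⟨N, _, _, _, _, TN, hTN⟩ := exists_projective_descent (W := N') hJ h1 h1' h2
  let T : L × N →ₛₗ[algebraMap S S'] W.M :=
    { toFun := fun x => (TL x.1 : W.M) + TN x.2
      map_add' := fun x y => by
        simp only [Prod.fst_add, Prod.snd_add, map_add, Submodule.coe_add]
        abel
      map_smul' := fun r x => by simp }
  have hTl : ∀ l, T (l, 0) = TL l := fun l => by
    change (TL l : W.M) + (TN 0 : W.M) = _
    simp
  refine ⟨L, N, inferInstance, inferInstance, inferInstance, inferInstance, inferInstance,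
    inferInstance, inferInstance, inferInstance, T, fun l => ?_, ?_, ?_⟩
  · rw [hTl, hF]
    exact Submodule.mem_sup_left (TL l).2
  · let e := (TensorProduct.prodRight S S' S' L N).trans
      (((LinearEquiv.ofBijective _ hTL).prodCongr (LinearEquiv.ofBijective _ hTN)).trans
        (Submodule.prodEquivOfIsCompl L' N' hc))
    have he : linearExt T = e.toLinearMap := by
      refine linearMap_ext_one_tmul fun m => ?_
      rw [linearExt_tmul, one_smul]
      simp [e, T]
    rw [he]
    exact e.bijective
  · rw [hF]
    refine sup_le (fun x hx => Submodule.mem_sup_left ?_)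
      (le_sup_of_le_right (Submodule.smul_mono le_rfl le_top))
    obtain ⟨y, hy⟩ := hTL.2 ⟨x, hx⟩
    rw [show x = L'.subtype (linearExt TL y) from congrArg Subtype.val hy.symm]
    refine forall_mem_of_forall_one_tmul (f := L'.subtype ∘ₗ linearExt TL) (fun m => ?_) y
    rw [LinearMap.comp_apply, linearExt_tmul, one_smul]
    exact Submodule.subset_span ⟨m, hTl m⟩

theorem essSurj_of_contracting (hp : p ≠ 0) (hC : α.Contracting) :
    (baseChangeAux α hα).EssSurj where
  mem_essImage W := by
    obtain ⟨L, N, _, _, _, _, _, _, _, _, T₀, hT₀, hb, hFil⟩ := exists_prod_descent α hα hC W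
    have hJ : F'.Fil ≤ (⊥ : Ideal S').jacobson := le_sup_left.trans F'.le_jacobson
    obtain ⟨T, hT, Ψ, hTT₀, hΨ, h⟩ := exists_descent hα hp hC T₀ hT₀ hb hFil
    have hb' : Function.Bijective (linearExt T) := by
      refine bijective_of_sub_mem_smul_top hJ hb fun x => ?_
      rw [← LinearMap.sub_apply]
      refine forall_mem_of_forall_one_tmul (fun m => ?_) x
      rw [LinearMap.sub_apply, linearExt_tmul, linearExt_tmul, one_smul, one_smul]
      exact hTT₀ m
    have hFil' : W.Fil ≤ Submodule.span S' (Set.range fun l => T (l, 0)) ⊔ F'.Fil • ⊤ := by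
      refine hFil.trans (sup_le ?_ le_sup_right)
      rw [Submodule.span_le]
      rintro _ ⟨l, rfl⟩
      change T₀ (l, 0) ∈ _
      rw [← sub_sub_cancel (T (l, 0)) (T₀ (l, 0))]
      exact sub_mem (Submodule.mem_sup_left (Submodule.subset_span ⟨l, rfl⟩))
        (Submodule.mem_sup_right (hTT₀ _))
    obtain ⟨V, hV⟩ := nonempty_iso_of_theta α hα T hT hb' hFil' Ψ hΨ h
    exact ⟨V, hV⟩

end FrameHom

end EssSurj

theorem FrameHom.isCrystalline_of_contracting {p : ℕ} {S S' : Type u} [CommRing S] [CommRing S']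
    {F : Frame p S} {F' : Frame p S'} (α : FrameHom F F') (hp : p ≠ 0) (hC : α.Contracting) :
    α.IsCrystalline := by
  let _ : Algebra S S' := α.toRingHom.toAlgebra
  have := faithful_of_contracting α rfl hC
  have := full_of_contracting (α := α) rfl hp hC
  have := essSurj_of_contracting α rfl hp hC
  have h : (baseChangeAux α rfl).IsEquivalence := { }
  exact h

/-! ### Adic completeness for principal ideals and quotients -/

section Adic

variable {T : Type u} [CommRing T]

/-- An `x`-adic Cauchy sequence `f` has an `I`-adic limit `L`. Regularity of `x` makes the quotients
`(f n - f (n + m)) / xⁿ` an `I`-adic Cauchy sequence in `m`, and their limit shows that `xⁿ` divides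
`f n - L`. -/
theorem isAdicComplete_span_singleton {I : Ideal T} [IsAdicComplete I T] {x : T} (hx : x ∈ I)
    (hreg : ∀ y z, x * y = x * z → y = z) : IsAdicComplete (Ideal.span {x}) T := by
  have hreg' : ∀ n y z, x ^ n * y = x ^ n * z → y = z := by
    intro n
    induction n with
    | zero => intro y z h; simpa using h
    | succ n ih =>
      intro y z h
      exact ih _ _ (hreg _ _ (by rw [← mul_assoc, ← mul_assoc, ← pow_succ', h]))
  have hI : ∀ {n : ℕ} {a b : T}, x ^ n ∣ a - b → a ≡ b [SMOD (I ^ n • ⊤ : Submodule T T)] := by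
    rintro n a b ⟨c, hc⟩
    rw [SModEq.sub_mem, hc, smul_eq_mul, Ideal.mul_top]
    exact Ideal.mul_mem_right _ _ (Ideal.pow_mem_pow hx n)
  refine { haus' := fun y hy => ?_, prec' := fun f hf => ?_ }
  · refine IsHausdorff.haus (I := I) inferInstance y fun n => hI ?_
    exact smodEq_span_singleton_iff.1 (hy n)
  · have hf' : ∀ {m n}, m ≤ n → x ^ m ∣ f m - f n := fun h => smodEq_span_singleton_iff.1 (hf h)
    obtain ⟨L, hL⟩ := IsPrecomplete.prec (I := I) (M := T) inferInstance (f := f)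
      fun h => hI (hf' h)
    refine ⟨L, fun n => smodEq_span_singleton_iff.2 ?_⟩
    choose g hg using fun m => hf' (Nat.le_add_right n m)
    obtain ⟨G, hG⟩ := IsPrecomplete.prec (I := I) (M := T) inferInstance (f := g) (by
      intro m k hmk
      refine hI ?_
      obtain ⟨z, hz⟩ := hf' (Nat.add_le_add_left hmk n)
      refine ⟨-z, hreg' n _ _ ?_⟩
      rw [mul_sub, ← hg, ← hg, ← mul_assoc, ← pow_add, mul_neg, ← hz]
      ring)
    refine ⟨G, ?_⟩
    rw [← sub_eq_zero]
    refine IsHausdorff.haus (I := I) inferInstance _ fun m => ?_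
    have h1 : f (n + m) ≡ L [SMOD (I ^ m • ⊤ : Submodule T T)] :=
      (hL (n + m)).mono (Submodule.smul_mono_left (Ideal.pow_le_pow_right (Nat.le_add_left m n)))
    have h2 := hG m
    rw [SModEq.sub_mem] at h1 h2 ⊢
    have : f n - L - x ^ n * G - 0 = (f (n + m) - L) + x ^ n • (g m - G) := by
      rw [smul_eq_mul, mul_sub, ← hg]; ring
    rw [this]
    exact add_mem h1 (Submodule.smul_mem _ _ h2)

/-- The hypothesis says that `y` stays regular modulo every `xⁿ`, so the ideal generated by `y` is
closed and the quotient is separated. Limits are obtained by lifting the successive differences of a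
Cauchy sequence. -/
theorem isAdicComplete_quotient_span_singleton {x y : T} [IsAdicComplete (Ideal.span {x}) T]
    (hreg : ∀ n z, x ^ n ∣ y * z → x ^ n ∣ z) :
    IsAdicComplete (Ideal.span {Ideal.Quotient.mk (Ideal.span {y}) x}) (T ⧸ Ideal.span {y}) := by
  refine { haus' := fun a ha => ?_, prec' := ?_ }
  · obtain ⟨a, rfl⟩ := Ideal.Quotient.mk_surjective a
    have h1 : ∀ n, ∃ z, x ^ n ∣ a - y * z := by
      intro n
      obtain ⟨b, hb⟩ := smodEq_span_singleton_iff.1 (ha n)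
      obtain ⟨b, rfl⟩ := Ideal.Quotient.mk_surjective b
      rw [sub_zero, ← map_pow, ← map_mul, Ideal.Quotient.eq, Ideal.mem_span_singleton] at hb
      obtain ⟨z, hz⟩ := hb
      exact ⟨z, b, by rw [← hz]; ring⟩
    choose z hz using h1
    obtain ⟨Z, hZ⟩ := IsPrecomplete.prec (I := Ideal.span {x}) (M := T) inferInstance
      (f := z) (by
        intro m n hmn
        refine smodEq_span_singleton_iff.2 (hreg m _ ?_)
        have : y * (z m - z n) = (a - y * z n) - (a - y * z m) := by ring
        rw [this]
        exact dvd_sub ((pow_dvd_pow _ hmn).trans (hz n)) (hz m))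
    rw [Ideal.Quotient.eq_zero_iff_mem, Ideal.mem_span_singleton]
    refine ⟨Z, ?_⟩
    rw [← sub_eq_zero]
    refine IsHausdorff.haus (I := Ideal.span {x}) inferInstance _ fun n =>
      smodEq_span_singleton_iff.2 ?_
    have : a - y * Z - 0 = (a - y * z n) + y * (z n - Z) := by ring
    rw [this]
    exact dvd_add (hz n) (Dvd.dvd.mul_left (smodEq_span_singleton_iff.1 (hZ n)) _)
  · intro f hf
    have hf' : ∀ n, ∃ b : T, f (n + 1) - f n = Ideal.Quotient.mk _ (x ^ n * b) := by
      intro n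
      obtain ⟨b, hb⟩ := smodEq_span_singleton_iff.1 (hf n.le_succ)
      obtain ⟨b, rfl⟩ := Ideal.Quotient.mk_surjective b
      refine ⟨-b, ?_⟩
      rw [map_mul, map_pow, map_neg, mul_neg, ← hb]
      ring
    choose b hb using hf'
    obtain ⟨a, ha⟩ := Ideal.Quotient.mk_surjective (f 0)
    let g : ℕ → T := fun n => a + ∑ i ∈ Finset.range n, x ^ i * b i
    have hg : ∀ n, Ideal.Quotient.mk _ (g n) = f n := by
      intro n
      induction n with
      | zero => simpa [g] using ha
      | succ n ih =>
        have : g (n + 1) = g n + x ^ n * b n := by simp [g, Finset.sum_range_succ, add_assoc]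
        rw [this, map_add, ih, ← hb]
        ring
    obtain ⟨L, hL⟩ := IsPrecomplete.prec (I := Ideal.span {x}) (M := T) inferInstance
      (f := g) (by
        intro m n hmn
        refine smodEq_span_singleton_iff.2 ?_
        induction n, hmn using Nat.le_induction with
        | base => simp
        | succ n hmn ih =>
          have : g m - g (n + 1) = (g m - g n) - x ^ n * b n := by
            simp only [g, Finset.sum_range_succ]; ring
          rw [this]
          exact dvd_sub ih (Dvd.dvd.mul_right (pow_dvd_pow _ hmn) _))
    refine ⟨Ideal.Quotient.mk _ L, fun n => smodEq_span_singleton_iff.2 ?_⟩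
    obtain ⟨z, hz⟩ := smodEq_span_singleton_iff.1 (hL n)
    refine ⟨Ideal.Quotient.mk _ z, ?_⟩
    rw [← hg, ← map_sub, hz, map_mul, map_pow]

theorem isAdicComplete_of_pow_eq_bot {I : Ideal T} {n : ℕ} (h : I ^ n = ⊥) :
    IsAdicComplete I T where
  haus' x hx := by
    have := hx n
    rwa [SModEq.sub_mem, h, Submodule.bot_smul, Submodule.mem_bot, sub_zero] at this
  prec' f hf := by
    refine ⟨f n, fun m => ?_⟩
    rcases le_total m n with hmn | hmn
    · exact hf hmn
    · have := hf hmn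
      rw [SModEq.sub_mem, h, Submodule.bot_smul, Submodule.mem_bot, sub_eq_zero] at this
      rw [this]

/-- Monomials of degree `n + 1` either contain a factor from `I` or are pure in `J`. -/
theorem sup_pow_succ_le (I J : Ideal T) (n : ℕ) :
    (I ⊔ J) ^ (n + 1) ≤ I * (I ⊔ J) ^ n ⊔ J ^ (n + 1) := by
  induction n with
  | zero => simp
  | succ n ih =>
    have h1 : J * (I ⊔ J) ^ (n + 1) ≤ I * (I ⊔ J) ^ (n + 1) ⊔ J ^ (n + 2) := by
      refine (Ideal.mul_mono_right ih).trans ?_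
      rw [Ideal.mul_sup, ← pow_succ']
      refine sup_le_sup_right ?_ _
      rw [mul_left_comm, pow_succ' (I ⊔ J)]
      exact Ideal.mul_mono_right (Ideal.mul_mono_left le_sup_right)
    rw [pow_succ' _ (n + 1), Ideal.sup_mul]
    exact sup_le le_sup_left h1

/-- Since `S / Fil S` has no `p`-torsion, an element of `Fil S` divisible by `pᵏ` is `pᵏ` times an
element of `Fil S`. -/
theorem Frame.φ₁_mem_of_torsionFree {p : ℕ} (F : Frame p T)
    (htf : ∀ x : T, (p : T) * x ∈ F.Fil → x ∈ F.Fil) (k : ℕ) (b : F.Fil)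
    (hb : (b : T) ∈ Ideal.span {(p : T)} ^ k) : F.φ₁ b ∈ Ideal.span {(p : T)} ^ k := by
  rw [Ideal.span_singleton_pow, Ideal.mem_span_singleton] at hb ⊢
  obtain ⟨z, hz⟩ := hb
  have hzF : z ∈ F.Fil := mem_of_pow_mul_mem htf k z (hz ▸ b.2)
  have e : b = ((p : T) ^ k) • (⟨z, hzF⟩ : F.Fil) := Subtype.ext hz
  rw [e, map_smulₛₗ, map_pow, map_natCast, smul_eq_mul]
  exact dvd_mul_right _ _

theorem Frame.mul_mem_divKer {p : ℕ} (F : Frame p T) {f : T} (hf : f ∈ F.Fil) :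
    (p : T) * f ∈ F.divKer := by
  refine ⟨Ideal.mul_mem_left _ _ hf, ?_⟩
  have e : (⟨p * f, Ideal.mul_mem_left _ _ hf⟩ : F.Fil) = (p : T) • ⟨f, hf⟩ := rfl
  rw [e, map_smulₛₗ, map_natCast, smul_eq_mul]
  exact Ideal.mul_mem_right _ _ (Ideal.mem_span_singleton_self _)

end Adic

/-! ### The regular sequence `(p, E)` in `𝔖` -/

namespace BreuilKisinDatum

section Source

variable {p : ℕ} {𝔖 : Type u} [CommRing 𝔖] (A : BreuilKisinDatum p 𝔖)

theorem span_pair_eq_sup : Ideal.span {(p : 𝔖), A.E} = Ideal.span {(p : 𝔖)} ⊔ Ideal.span {A.E} :=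
  Ideal.span_insert _ _

theorem p_mem_span_pair : (p : 𝔖) ∈ Ideal.span {(p : 𝔖), A.E} := Ideal.subset_span (by simp)

theorem E_mem_span_pair : A.E ∈ Ideal.span {(p : 𝔖), A.E} := Ideal.subset_span (by simp)

theorem eq_zero_of_forall_mem_pow {x : 𝔖} (h : ∀ n, x ∈ Ideal.span {(p : 𝔖), A.E} ^ n) :
    x = 0 := by
  have := A.complete
  refine IsHausdorff.haus (I := Ideal.span {(p : 𝔖), A.E}) inferInstance x fun n => ?_
  rw [SModEq.sub_mem, sub_zero, smul_eq_mul, Ideal.mul_top]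
  exact h n

theorem isAdicComplete_E : IsAdicComplete (Ideal.span {A.E}) 𝔖 := by
  have := A.complete
  exact isAdicComplete_span_singleton A.E_mem_span_pair fun _ _ => A.E_regular

/-- The order of the regular sequence is reversed: from `pⁿ x = Eᵐ y` one gets `pⁿ ∣ y`, and `pⁿ`
can be cancelled. -/
theorem E_pow_dvd (n m : ℕ) {x : 𝔖} (h : A.E ^ m ∣ (p : 𝔖) ^ n * x) : A.E ^ m ∣ x := by
  obtain ⟨y, hy⟩ := h
  obtain ⟨z, rfl⟩ := A.p_pow_dvd_pow n m ⟨x, hy.symm⟩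
  exact ⟨z, A.p_pow_regular n (by rw [hy]; ring)⟩

theorem isAdicComplete_E_mod (n : ℕ) :
    IsAdicComplete (Ideal.span {Ideal.Quotient.mk (Ideal.span {(p : 𝔖) ^ n}) A.E})
      (𝔖 ⧸ Ideal.span {(p : 𝔖) ^ n}) := by
  have := A.isAdicComplete_E
  exact isAdicComplete_quotient_span_singleton fun m _ => A.E_pow_dvd n m

/-- Multiplication by `p` is injective on the graded ring of `(p, E)`. Concretely, `p x = p y + Eⁿ⁺¹
z` with `y ∈ (p, E)ⁿ` forces `p ∣ z`, and `p` can be cancelled. -/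
theorem mem_pow_of_p_mul_mem {n : ℕ} {x : 𝔖}
    (h : (p : 𝔖) * x ∈ Ideal.span {(p : 𝔖), A.E} ^ (n + 1)) :
    x ∈ Ideal.span {(p : 𝔖), A.E} ^ n := by
  rw [A.span_pair_eq_sup] at h
  obtain ⟨a, ha, b, hb, hab⟩ := Submodule.mem_sup.1 (sup_pow_succ_le _ _ _ h)
  obtain ⟨y, hy, rfl⟩ := Ideal.mem_span_singleton_mul.1 ha
  rw [Ideal.span_singleton_pow, Ideal.mem_span_singleton] at hb
  obtain ⟨z, rfl⟩ := hb
  have hd : (p : 𝔖) ^ 1 ∣ A.E ^ (n + 1) * z := by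
    rw [pow_one]
    exact ⟨x - y, by linear_combination hab⟩
  obtain ⟨w, rfl⟩ := A.p_pow_dvd_pow 1 (n + 1) hd
  have hx : x = y + A.E ^ n * (A.E * w) := A.p_regular (by linear_combination -hab)
  rw [hx, A.span_pair_eq_sup]
  refine add_mem hy (Ideal.mul_mem_right _ _ (Ideal.pow_mem_pow ?_ n))
  exact Ideal.mem_sup_right (Ideal.mem_span_singleton_self _)

theorem mem_pow_of_p_pow_mul_mem (k : ℕ) {n : ℕ} {x : 𝔖}
    (h : (p : 𝔖) ^ k * x ∈ Ideal.span {(p : 𝔖), A.E} ^ (n + k)) :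
    x ∈ Ideal.span {(p : 𝔖), A.E} ^ n := by
  induction k with
  | zero => simpa using h
  | succ k ih => exact ih (A.mem_pow_of_p_mul_mem (by rwa [← mul_assoc, ← pow_succ']))

theorem span_pair_pow_le (n k : ℕ) :
    Ideal.span {(p : 𝔖), A.E} ^ (n + k) ≤ Ideal.span {(p : 𝔖) ^ n} ⊔ Ideal.span {A.E ^ k} := by
  rw [A.span_pair_eq_sup, ← Ideal.span_singleton_pow, ← Ideal.span_singleton_pow]
  exact Ideal.sup_pow_add_le_pow_sup_pow

end Source

/-! ### Comparison of the `p`-adic topology of `S` with the `(p, E)`-adic one of `𝔖` -/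

section Envelope

variable {p : ℕ} [hp : Fact p.Prime] {𝔖 : Type u} [CommRing 𝔖] (A : BreuilKisinDatum p 𝔖)

/-- If `v` is the valuation of `n!`, then `pᴺ Eⁿ/n!` is a unit times `pᴺ⁻ᵛ Eⁿ`, of degree `N - v + n
≥ N` since `v ≤ n`. -/
theorem exists_p_pow_mul_dp {n N : ℕ} (h : n ≤ N) :
    ∃ z ∈ Ideal.span {(p : 𝔖), A.E} ^ N, (p : A.L) ^ N * A.dp n = algebraMap 𝔖 A.L z := by
  obtain ⟨v, hv, hnv⟩ := A.exists_natCast_eq n.factorial_ne_zero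
  have hle : padicValNat p n.factorial ≤ n := by
    rcases eq_or_ne n 0 with rfl | hn
    · simp
    · exact (padicValNat_factorial_lt_of_ne_zero p hn).le
  obtain ⟨k, hk⟩ := Nat.exists_eq_add_of_le (hle.trans h)
  obtain ⟨w, hw⟩ := hv.exists_right_inv
  refine ⟨p ^ k * A.E ^ n * w, Ideal.mul_mem_right _ _ ?_, A.factorial_cancel (n := n) ?_⟩
  · have : p ^ k * A.E ^ n ∈ Ideal.span {(p : 𝔖), A.E} ^ (k + n) := by
      rw [pow_add]
      exact Ideal.mul_mem_mul (Ideal.pow_mem_pow A.p_mem_span_pair _)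
        (Ideal.pow_mem_pow A.E_mem_span_pair _)
    exact Ideal.pow_le_pow_right (by omega) this
  · rw [mul_left_comm, factorial_mul_dp, ← map_natCast (algebraMap 𝔖 A.L) p,
      ← map_natCast (algebraMap 𝔖 A.L) n.factorial, ← map_pow, ← map_pow, ← map_mul, ← map_mul, hnv]
    refine congrArg _ ?_
    conv_lhs => rw [hk]
    linear_combination (-(p : 𝔖) ^ (padicValNat p n.factorial + k) * A.E ^ n) * hw

/-- If `x = pᵐ d`, write `d` as a combination of finitely many `Eⁿ/n!` with `n < N`. Multiplying by
`pᴺ` clears denominators and gives `pᴺ x ∈ (p, E)ᵐ⁺ᴺ`, and `pᴺ` can be removed by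
`mem_pow_of_p_pow_mul_mem`. -/
theorem mem_pow_of_dvd_D {m : ℕ} {x : 𝔖} (h : (p : A.D) ^ m ∣ algebraMap 𝔖 A.D x) :
    x ∈ Ideal.span {(p : 𝔖), A.E} ^ m := by
  obtain ⟨d, hd⟩ := h
  obtain ⟨a, ha⟩ := A.mem_D_iff.1 d.2
  obtain ⟨N, hN⟩ := a.support.exists_nat_subset_range
  have hz : ∀ i, ∃ z : 𝔖, i ∈ Finset.range N →
      z ∈ Ideal.span {(p : 𝔖), A.E} ^ N ∧ (p : A.L) ^ N * A.dp i = algebraMap 𝔖 A.L z := by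
    intro i
    by_cases hi : i ∈ Finset.range N
    · obtain ⟨z, hz, hz'⟩ := A.exists_p_pow_mul_dp (Finset.mem_range.1 hi).le
      exact ⟨z, fun _ => ⟨hz, hz'⟩⟩
    · exact ⟨0, fun h => absurd h hi⟩
  choose z hz using hz
  have hd' : algebraMap 𝔖 A.L x = p ^ m * (d : A.L) := by
    have := congrArg (fun y : A.D => (y : A.L)) hd
    push_cast at this
    exact this
  have key : (p : 𝔖) ^ N * x = p ^ m * ∑ i ∈ Finset.range N, a i * z i := by
    refine A.algebraMap_L_injective ?_
    rw [map_mul, map_mul, hd', ← ha, Finsupp.linearCombination_apply,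
      Finsupp.sum_of_support_subset _ hN _ (by simp), map_sum, map_pow, map_pow, map_natCast,
      mul_left_comm, Finset.mul_sum]
    congr 1
    refine Finset.sum_congr rfl fun i hi => ?_
    rw [map_mul, ← (hz i hi).2, Algebra.smul_def]
    ring
  refine A.mem_pow_of_p_pow_mul_mem N ?_
  rw [key, pow_add]
  exact Ideal.mul_mem_mul (Ideal.pow_mem_pow A.p_mem_span_pair _)
    (sum_mem fun i hi => Ideal.mul_mem_left _ _ (hz i hi).1)

/-- Completion does not change the quotient by `pᵐ`. -/
theorem dvd_D_of_dvd_S {m : ℕ} {d : A.D} (h : (p : A.S) ^ m ∣ algebraMap A.D A.S d) :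
    (p : A.D) ^ m ∣ d := by
  obtain ⟨s, hs⟩ := h
  have h1 := congrArg (AdicCompletion.evalₐ (Ideal.span {(p : A.D)}) m) hs
  rw [AlgHom.commutes, map_mul, map_pow, map_natCast,
    ← map_natCast (Ideal.Quotient.mk _), ← map_pow,
    Ideal.Quotient.eq_zero_iff_mem.2 (Ideal.pow_mem_pow (Ideal.mem_span_singleton_self _) m),
    zero_mul] at h1
  have h2 := Ideal.Quotient.eq_zero_iff_mem.1 h1
  rwa [Ideal.span_singleton_pow, Ideal.mem_span_singleton] at h2

theorem mem_pow_of_dvd_S {m : ℕ} {x : 𝔖} (h : (p : A.S) ^ m ∣ algebraMap 𝔖 A.S x) :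
    x ∈ Ideal.span {(p : 𝔖), A.E} ^ m :=
  A.mem_pow_of_dvd_D (A.dvd_D_of_dvd_S h)

theorem algebraMap_S_injective : Function.Injective (algebraMap 𝔖 A.S) := by
  refine (injective_iff_map_eq_zero _).2 fun x hx => A.eq_zero_of_forall_mem_pow fun n => ?_
  exact A.mem_pow_of_dvd_S (hx ▸ dvd_zero _)

theorem p_dvd_E_pow : (p : A.S) ∣ algebraMap 𝔖 A.S A.E ^ p := by
  obtain ⟨z, hz⟩ := A.p_dvd_pow_of_mem_J (A.dpD_mem_J one_ne_zero)
  rw [dpD_one] at hz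
  refine ⟨algebraMap A.D A.S z, ?_⟩
  rw [algebraMap_S, ← map_pow, hz, map_mul, map_natCast]

/-- In degree `1 + p` every monomial in `p` and `E` contains `p` or `Eᵖ`, and `Eᵖ = p! · Eᵖ/p!` is
divisible by `p` in `S`. -/
theorem dvd_S_of_mem_pow {k : ℕ} {x : 𝔖} (h : x ∈ Ideal.span {(p : 𝔖), A.E} ^ ((1 + p) * k)) :
    (p : A.S) ^ k ∣ algebraMap 𝔖 A.S x := by
  have h1 : Ideal.span {(p : 𝔖), A.E} ^ (1 + p) ≤
      (Ideal.span {(p : A.S)}).comap (algebraMap 𝔖 A.S) := by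
    refine (A.span_pair_pow_le 1 p).trans (sup_le ?_ ?_)
    · rw [Ideal.span_le, Set.singleton_subset_iff, SetLike.mem_coe, Ideal.mem_comap, map_pow,
        map_natCast, pow_one]
      exact Ideal.mem_span_singleton_self _
    · rw [Ideal.span_le, Set.singleton_subset_iff, SetLike.mem_coe, Ideal.mem_comap, map_pow]
      exact Ideal.mem_span_singleton.2 A.p_dvd_E_pow
  rw [pow_mul] at h
  have h3 := Ideal.mem_map_of_mem (algebraMap 𝔖 A.S) (Ideal.pow_right_mono h1 k h)
  rw [Ideal.map_pow] at h3
  have h4 := Ideal.pow_right_mono (Ideal.map_comap_le (f := algebraMap 𝔖 A.S)) k h3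
  rwa [Ideal.span_singleton_pow, Ideal.mem_span_singleton] at h4

end Envelope

end BreuilKisinDatum

/-! ### Reduction of frames modulo `pⁿ` -/

section Reduction

theorem span_natCast_pow_eq_bot {T : Type u} [CommRing T] (q n : ℕ) :
    Ideal.span {(q : T ⧸ Ideal.span {(q : T) ^ n})} ^ n = ⊥ := by
  rw [Ideal.span_singleton_pow, ← map_natCast (Ideal.Quotient.mk _), ← map_pow,
    Ideal.Quotient.eq_zero_iff_mem.2 (Ideal.mem_span_singleton_self _), Ideal.span_singleton_eq_bot]

/-- The reduced frame may have torsion, so the property is inherited from `F`: for `k < n` a lift in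
`Fil` is again divisible by `pᵏ`, and for `k ≥ n` the element is zero. -/
theorem Frame.mod_φ₁_mem_of_torsionFree {T : Type u} [CommRing T] {p : ℕ} (F : Frame p T)
    (htf : ∀ x : T, (p : T) * x ∈ F.Fil → x ∈ F.Fil) (n k : ℕ) (b : (F.mod htf n).Fil)
    (hb : (b : T ⧸ Ideal.span {(p : T) ^ n}) ∈ Ideal.span {(p : T ⧸ Ideal.span {(p : T) ^ n})} ^ k) :
    (F.mod htf n).φ₁ b ∈ Ideal.span {(p : T ⧸ Ideal.span {(p : T) ^ n})} ^ k := by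
  rcases le_or_gt n k with hnk | hnk
  · have h0 : b = 0 := by
      refine Subtype.ext ?_
      have := Ideal.pow_le_pow_right hnk hb
      rwa [span_natCast_pow_eq_bot] at this
    rw [h0, map_zero]
    exact zero_mem _
  · obtain ⟨b, hb'⟩ := b
    obtain ⟨x, hx⟩ := F.exists_lift_fil _ ⟨b, hb'⟩
    have hx' : Ideal.Quotient.mk (Ideal.span {(p : T) ^ n}) (x : T) = b := hx
    subst hx'
    rw [F.mod_φ₁_mk htf n x]
    rw [Ideal.span_singleton_pow, Ideal.mem_span_singleton] at hb
    obtain ⟨z, hz⟩ := hb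
    obtain ⟨z, rfl⟩ := Ideal.Quotient.mk_surjective z
    rw [← map_natCast (Ideal.Quotient.mk _), ← map_pow, ← map_mul, Ideal.Quotient.eq,
      Ideal.mem_span_singleton] at hz
    have hd : (x : T) ∈ Ideal.span {(p : T)} ^ k := by
      rw [Ideal.span_singleton_pow, Ideal.mem_span_singleton]
      exact (dvd_sub_left (dvd_mul_right _ _)).1 ((pow_dvd_pow _ hnk.le).trans hz)
    have h1 := F.φ₁_mem_of_torsionFree htf k x hd
    rw [Ideal.span_singleton_pow, Ideal.mem_span_singleton] at h1 ⊢
    obtain ⟨w, hw⟩ := h1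
    refine ⟨Ideal.Quotient.mk _ w, ?_⟩
    rw [hw, map_mul, map_pow, map_natCast]

theorem Frame.mk_mem_divKer {T : Type u} [CommRing T] {p : ℕ} (F : Frame p T)
    (htf : ∀ x : T, (p : T) * x ∈ F.Fil → x ∈ F.Fil) {n : ℕ} {x : T} (hx : x ∈ F.divKer) :
    Ideal.Quotient.mk _ x ∈ (F.mod htf n).divKer := by
  obtain ⟨h1, h2⟩ := hx
  have h : Ideal.Quotient.mk _ x ∈ (F.mod htf n).Fil := Ideal.mem_map_of_mem _ h1
  refine ⟨h, ?_⟩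
  rw [F.mod_φ₁_mk htf n ⟨x, h1⟩ h]
  rw [Ideal.mem_span_singleton] at h2 ⊢
  obtain ⟨z, hz⟩ := h2
  refine ⟨Ideal.Quotient.mk _ z, ?_⟩
  rw [hz, map_mul, map_natCast]

end Reduction

/-! ### The homomorphism `λ` is contracting for `p ≥ 3` -/

namespace BreuilKisinDatum

variable {p : ℕ} [hp : Fact p.Prime] {𝔖 : Type u} [CommRing 𝔖] (A : BreuilKisinDatum p 𝔖)

/-- For `p ≥ 3` and `n ≥ 2`, the number `pⁿ / n!` lies in `p² 𝔖`. -/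
theorem exists_p_pow_eq_sq (A : BreuilKisinDatum p 𝔖) (h3 : 3 ≤ p) {n : ℕ} (hn : 2 ≤ n) :
    ∃ r : 𝔖, (p : 𝔖) ^ n = (n.factorial : 𝔖) * (p ^ 2 * r) := by
  obtain ⟨v, hv, hnv⟩ := A.exists_natCast_eq n.factorial_ne_zero
  have hlt := sub_one_mul_padicValNat_factorial_lt_of_ne_zero p (n := n) (by omega)
  -- Legendre's bound `(p - 1) v(n!) < n` gives `2 v(n!) < n` when `p ≥ 3`. For `p = 2` the claim
  -- already fails at `n = 2`.
  have hle : padicValNat p n.factorial + 2 ≤ n := by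
    have : 2 * padicValNat p n.factorial ≤ (p - 1) * padicValNat p n.factorial :=
      Nat.mul_le_mul_right _ (by omega)
    omega
  obtain ⟨k, hk⟩ := Nat.exists_eq_add_of_le hle
  obtain ⟨w, hw⟩ := hv.exists_right_inv
  refine ⟨p ^ k * w, ?_⟩
  rw [hnv]
  conv_lhs => rw [hk]
  linear_combination (-(p : 𝔖) ^ (padicValNat p n.factorial + 2 + k)) * hw

/-- With `φ E = p c` one has `φ(Eⁿ/n!) = (pⁿ/n!) cⁿ`. -/
theorem exists_φD_dpD_eq_sq (h3 : 3 ≤ p) {n : ℕ} (hn : 2 ≤ n) :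
    ∃ z : A.D, A.φD (A.dpD n) = p ^ 2 * z := by
  obtain ⟨c, hc⟩ := A.exists_φL_E
  obtain ⟨r, hr⟩ := A.exists_p_pow_eq_sq h3 hn
  refine ⟨algebraMap 𝔖 A.D r * c ^ n, Subtype.ext (A.factorial_cancel (n := n) ?_)⟩
  have h1 := congrArg A.φL (A.factorial_mul_dp n)
  have h2 := congrArg (algebraMap 𝔖 A.L) hr
  simp only [map_mul, map_pow, map_natCast] at h1 h2
  have h4 : ((p ^ 2 * (algebraMap 𝔖 A.D r * c ^ n) : A.D) : A.L) =
      p ^ 2 * (algebraMap 𝔖 A.L r * (c : A.L) ^ n) := by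
    push_cast
    rfl
  refine h1.trans ?_
  rw [hc, mul_pow, h2, h4]
  ring

theorem algebraMap_dpD_mem_divKer (h3 : 3 ≤ p) {n : ℕ} (hn : 2 ≤ n) :
    algebraMap A.D A.S (A.dpD n) ∈ A.frameS.divKer := by
  have hF : algebraMap A.D A.S (A.dpD n) ∈ A.frameS.Fil :=
    (A.πS_algebraMap_D _).trans (A.πD_of_mem_J (A.dpD_mem_J (by omega)))
  refine ⟨hF, Ideal.mem_span_singleton.2 ?_⟩
  obtain ⟨z, hz⟩ := A.exists_φD_dpD_eq_sq h3 hn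
  refine ⟨algebraMap A.D A.S z, A.p_regular_S ?_⟩
  refine (A.frameS.φ_eq ⟨_, hF⟩).symm.trans ((A.φS_algebraMap_D _).trans ?_)
  rw [hz, map_mul, map_pow, map_natCast]
  ring

/-- Modulo `divKer` only the generators `1` and `E` of the envelope survive, and they come from `𝔖`.
-/
theorem exists_sub_mem_divKer_D (h3 : 3 ≤ p) (d : A.D) :
    ∃ a : 𝔖, algebraMap A.D A.S d - algebraMap 𝔖 A.S a ∈ A.frameS.divKer := by
  have hg : ∀ n, ∃ g : 𝔖, algebraMap A.D A.S (A.dpD n) - algebraMap 𝔖 A.S g ∈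
      A.frameS.divKer := by
    intro n
    rcases Nat.lt_or_ge n 2 with hn | hn
    · interval_cases n
      · refine ⟨1, ?_⟩
        rw [dpD_zero, map_one, map_one, sub_self]
        exact zero_mem _
      · refine ⟨A.E, ?_⟩
        rw [dpD_one, ← algebraMap_S, sub_self]
        exact zero_mem _
    · exact ⟨0, by rw [map_zero, sub_zero]; exact A.algebraMap_dpD_mem_divKer h3 hn⟩
  choose g hg using hg
  obtain ⟨a, ha⟩ := A.mem_D_iff.1 d.2
  have hd : d = ∑ i ∈ a.support, algebraMap 𝔖 A.D (a i) * A.dpD i := by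
    refine Subtype.ext ?_
    rw [← ha, Finsupp.linearCombination_apply, Finsupp.sum, AddSubmonoidClass.coe_finsetSum]
    refine Finset.sum_congr rfl fun i _ => ?_
    rw [Algebra.smul_def]
    rfl
  refine ⟨∑ i ∈ a.support, a i * g i, ?_⟩
  have e : algebraMap A.D A.S d - algebraMap 𝔖 A.S (∑ i ∈ a.support, a i * g i) =
      ∑ i ∈ a.support, algebraMap 𝔖 A.S (a i) *
        (algebraMap A.D A.S (A.dpD i) - algebraMap 𝔖 A.S (g i)) := by
    rw [hd, map_sum, map_sum, ← Finset.sum_sub_distrib]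
    refine Finset.sum_congr rfl fun i _ => ?_
    rw [map_mul, map_mul, algebraMap_S]
    ring
  rw [e]
  exact sum_mem fun i _ => Ideal.mul_mem_left _ _ (hg i)

theorem exists_sub_mem_FilS (s : A.S) : ∃ a : 𝔖, s - algebraMap 𝔖 A.S a ∈ A.frameS.Fil := by
  obtain ⟨a, ha⟩ := Ideal.Quotient.mk_surjective (A.πS s)
  refine ⟨a, ?_⟩
  change A.πS _ = 0
  rw [map_sub, πS_algebraMap, ha, sub_self]

/-- An element of `S` is an element of the envelope plus `p s`. Modulo `Fil S` the element `s` comes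
from `𝔖`, and `p Fil S` is contained in `divKer`. -/
theorem exists_sub_mem_divKer (h3 : 3 ≤ p) (b : A.S) :
    ∃ a : 𝔖, b - algebraMap 𝔖 A.S a ∈ A.frameS.divKer := by
  obtain ⟨d, s, rfl⟩ := exists_eq_algebraMap_add b
  obtain ⟨a, ha⟩ := A.exists_sub_mem_divKer_D h3 d
  obtain ⟨a', ha'⟩ := A.exists_sub_mem_FilS s
  refine ⟨a + p * a', ?_⟩
  have e : algebraMap A.D A.S d + p * s - algebraMap 𝔖 A.S (a + p * a') =
      (algebraMap A.D A.S d - algebraMap 𝔖 A.S a) + p * (s - algebraMap 𝔖 A.S a') := by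
    rw [map_add, map_mul, map_natCast]
    ring
  rw [e]
  exact add_mem ha (A.frameS.mul_mem_divKer ha')

theorem mem_fil_of_algebraMap_mem {a : 𝔖} (h : algebraMap 𝔖 A.S a ∈ A.frameS.Fil) :
    a ∈ A.frame.Fil := by
  change A.πS _ = 0 at h
  rw [πS_algebraMap] at h
  exact Ideal.Quotient.eq_zero_iff_mem.1 h

/-- Approximations that converge `p`-adically in `S` are `(p, E)`-adically Cauchy in `𝔖` by
`mem_pow_of_dvd_S`; by `dvd_S_of_mem_pow` their limit in `𝔖` maps to the limit in `S`. -/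
theorem exists_eq_algebraMap_of_forall {b : A.S}
    (h : ∀ k, ∃ a : 𝔖, b - algebraMap 𝔖 A.S a ∈ Ideal.span {(p : A.S)} ^ k) :
    ∃ a : 𝔖, b = algebraMap 𝔖 A.S a := by
  have h𝔖 := A.complete
  have hS : IsAdicComplete (Ideal.span {(p : A.S)}) A.S := isAdicComplete_completion
  simp only [Ideal.span_singleton_pow, Ideal.mem_span_singleton] at h
  choose a ha using h
  obtain ⟨l, hl⟩ := IsPrecomplete.prec (I := Ideal.span {(p : 𝔖), A.E}) (M := 𝔖) inferInstance
    (f := a) (by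
      intro m n hmn
      rw [SModEq.sub_mem, smul_eq_mul, Ideal.mul_top]
      refine A.mem_pow_of_dvd_S ?_
      have e : algebraMap 𝔖 A.S (a m - a n) =
          (b - algebraMap 𝔖 A.S (a n)) - (b - algebraMap 𝔖 A.S (a m)) := by
        rw [map_sub]; ring
      rw [e]
      exact dvd_sub ((pow_dvd_pow _ hmn).trans (ha n)) (ha m))
  refine ⟨l, sub_eq_zero.1 ?_⟩
  refine IsHausdorff.haus (I := Ideal.span {(p : A.S)}) inferInstance _ fun k =>
    smodEq_span_singleton_iff.2 ?_
  -- The index `(1 + p) k` is what `dvd_S_of_mem_pow` needs to obtain divisibility by `pᵏ` in `S`.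
  have h1 := hl ((1 + p) * k)
  rw [SModEq.sub_mem, smul_eq_mul, Ideal.mul_top] at h1
  have e : b - algebraMap 𝔖 A.S l - 0 = (b - algebraMap 𝔖 A.S (a ((1 + p) * k))) +
      algebraMap 𝔖 A.S (a ((1 + p) * k) - l) := by
    rw [map_sub]; ring
  rw [e]
  exact dvd_add ((pow_dvd_pow _ (Nat.le_mul_of_pos_left k (by omega))).trans (ha _))
    (A.dvd_S_of_mem_pow h1)

/-- `Fil S` is the kernel of `S → R`, and `R` is `p`-adically separated. -/
theorem mem_FilS_of_forall {b : A.S}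
    (h : ∀ k, b ∈ A.frameS.Fil ⊔ Ideal.span {(p : A.S)} ^ k) : b ∈ A.frameS.Fil := by
  have hR := A.isAdicComplete_R
  change A.πS b = 0
  refine IsHausdorff.haus (I := Ideal.span {(p : A.R)}) inferInstance _ fun k =>
    smodEq_span_singleton_iff.2 ?_
  obtain ⟨x, hx, y, hy, rfl⟩ := Submodule.mem_sup.1 (h k)
  rw [Ideal.span_singleton_pow, Ideal.mem_span_singleton] at hy
  obtain ⟨z, rfl⟩ := hy
  have hx' : A.πS x = 0 := hx
  rw [sub_zero, map_add, hx', zero_add, map_mul, map_pow, map_natCast]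
  exact dvd_mul_right _ _

theorem contracting_frameHom (h3 : 3 ≤ p) (hc : IsUnit A.c) : (A.frameHom hc).Contracting where
  mem_fil _ := A.mem_fil_of_algebraMap_mem
  exists_sub_mem := A.exists_sub_mem_divKer h3
  complete_fil := A.isAdicComplete_E
  complete_source := A.isAdicComplete_p
  complete_target := isAdicComplete_completion
  closed _ := A.exists_eq_algebraMap_of_forall
  fil_closed _ := A.mem_FilS_of_forall
  φ₁_mem := A.frameS.φ₁_mem_of_torsionFree A.frameS_torsionFree
  exists_ideals := by
    have hφ : ∀ x ∈ (⊥ : Ideal 𝔖), ∃ h : x ∈ A.frame.Fil, A.frame.φ₁ ⟨x, h⟩ ∈ (⊥ : Ideal 𝔖) := by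
      rintro x rfl
      exact ⟨zero_mem _, (map_zero A.frame.φ₁ : A.frame.φ₁ ⟨0, zero_mem _⟩ = 0)⟩
    -- As `λ` is injective, all ideals can be taken to be zero. The shift must be `1`, because the
    -- zeroth power of the zero ideal is the whole ring.
    refine ⟨⊥, fun _ => ⊥, 1, inferInstance, fun b hb => ?_, fun x hx => ?_, fun _ => bot_le,
      fun _ => hφ, fun j x hx => ?_⟩
    · have := hb 1
      rwa [pow_one, Ideal.map_bot] at this
    · exact A.algebraMap_S_injective ((RingHom.mem_ker.1 hx).trans (map_zero _).symm)
    · rw [add_comm, pow_succ, Ideal.mul_bot] at hx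
      obtain ⟨h1, h2⟩ := hφ x hx
      exact ⟨h1, bot_le (a := (⊥ : Ideal 𝔖) ^ j) h2⟩

/-! ### The reductions `λₙ` are contracting for `p ≥ 3` -/

section Reduction

variable (n : ℕ)

/-- A lift `a` of the element lies in `Fil S` up to `pⁿ z`. Since `z` agrees modulo `Fil S` with an
element `a'` of `𝔖`, the lift can be changed to `a + pⁿ a'`, which lies in the preimage of `Fil S`.
-/
theorem mod_mem_fil (hc : IsUnit A.c) (a : 𝔖 ⧸ Ideal.span {(p : 𝔖) ^ n})
    (h : (A.frameHomMod hc n).toRingHom a ∈ (A.frameS.mod A.frameS_torsionFree n).Fil) :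
    a ∈ (A.frame.mod A.frame_torsionFree n).Fil := by
  obtain ⟨a, rfl⟩ := Ideal.Quotient.mk_surjective a
  obtain ⟨x, hx⟩ := A.frameS.exists_lift_fil _ ⟨_, h⟩
  have hx' : Ideal.Quotient.mk (Ideal.span {(p : A.S) ^ n}) (x : A.S) =
    Ideal.Quotient.mk _ (algebraMap 𝔖 A.S a) := hx
  rw [Ideal.Quotient.eq, Ideal.mem_span_singleton] at hx'
  obtain ⟨z, hz⟩ := hx'
  obtain ⟨a', ha'⟩ := A.exists_sub_mem_FilS z
  have h1 : a + p ^ n * a' ∈ A.frame.Fil := by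
    refine A.mem_fil_of_algebraMap_mem ?_
    have e : algebraMap 𝔖 A.S (a + p ^ n * a') =
        x - p ^ n * (z - algebraMap 𝔖 A.S a') := by
      rw [map_add, map_mul, map_pow, map_natCast]
      linear_combination -hz
    rw [e]
    exact sub_mem x.2 (Ideal.mul_mem_left _ _ ha')
  have h2 : Ideal.Quotient.mk (Ideal.span {(p : 𝔖) ^ n}) a =
      Ideal.Quotient.mk _ (a + p ^ n * a') := by
    rw [map_add, map_mul, Ideal.Quotient.eq_zero_iff_mem.2 (Ideal.mem_span_singleton_self _),
      zero_mul, add_zero]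
  rw [h2]
  exact Ideal.mem_map_of_mem _ h1

/-- This expresses the nilpotence of `φ₁` on the kernels of the `λₙ`: up to multiples of `pᵐ`, it
carries `𝔖 ∩ pᵐ S` into `𝔖 ∩ pᵐ⁺¹ S`. With `x = pᵐ s` and `a ∈ 𝔖` congruent to `s` modulo `Fil S`,
the element `pᵐ (s - a)` is some `E i` in `𝔖`. Now `s - a` is an element of `E 𝔖` plus one of
`divKer`, whose `φ₁` is divisible by `p`; comparing the two values of `φ₁` and cancelling the unit
`c` gives the claim. -/
theorem exists_dvd_φ_sub (h3 : 3 ≤ p) (hc : IsUnit A.c) {m : ℕ} {x : 𝔖}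
    (hx : (p : A.S) ^ m ∣ algebraMap 𝔖 A.S x) :
    ∃ i a b, x = A.E * i + p ^ m * a ∧ (p : A.S) ^ (m + 1) ∣
        algebraMap 𝔖 A.S (A.φ i - p ^ m * b) := by
  obtain ⟨s, hs⟩ := hx
  obtain ⟨a, ha⟩ := A.exists_sub_mem_FilS s
  have h1 : x - p ^ m * a ∈ A.frame.Fil := by
    refine A.mem_fil_of_algebraMap_mem ?_
    rw [map_sub, map_mul, map_pow, map_natCast, hs, ← mul_sub]
    exact Ideal.mul_mem_left _ _ ha
  obtain ⟨i, hi⟩ := Ideal.mem_span_singleton.1 h1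
  obtain ⟨b, hb⟩ := A.exists_sub_mem_divKer h3 (s - algebraMap 𝔖 A.S a)
  obtain ⟨hbF, hb'⟩ := hb
  have hbF' : b ∈ A.frame.Fil := A.mem_fil_of_algebraMap_mem (by
    have := sub_mem ha hbF
    rwa [sub_sub_cancel] at this)
  obtain ⟨w, hw⟩ := Ideal.mem_span_singleton.1 hb'
  obtain ⟨v, hv⟩ := hc.exists_right_inv
  refine ⟨i, a, A.frame.φ₁ ⟨b, hbF'⟩, by rw [← hi]; ring, v * w, ?_⟩
  set f : A.frameS.Fil := ⟨s - algebraMap 𝔖 A.S a, ha⟩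
  have e1 : A.frameS.φ₁ f = A.c * algebraMap 𝔖 A.S (A.frame.φ₁ ⟨b, hbF'⟩) + p * w := by
    have h5 := (A.frameHom hc).map_φ₁ ⟨b, hbF'⟩
    have h6 : f = ⟨algebraMap 𝔖 A.S b, (A.frameHom hc).map_fil b hbF'⟩ + ⟨_, hbF⟩ :=
      Subtype.ext (by simp [f])
    rw [h6, map_add, hw]
    exact congrArg (· + _) h5
  have hEi : A.E * i ∈ A.frame.Fil := Ideal.mul_mem_right _ _ (Ideal.mem_span_singleton_self _)
  have e2 : (p : A.S) ^ m * A.frameS.φ₁ f = A.c * algebraMap 𝔖 A.S (A.φ i) := by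
    have h5 := (A.frameHom hc).map_φ₁ ⟨A.E * i, hEi⟩
    rw [A.frame_φ₁] at h5
    have h6 : (⟨algebraMap 𝔖 A.S (A.E * i), (A.frameHom hc).map_fil _ hEi⟩ : A.frameS.Fil) =
        (p : A.S) ^ m • f := Subtype.ext (by
      change algebraMap 𝔖 A.S (A.E * i) = p ^ m * (s - algebraMap 𝔖 A.S a)
      rw [← hi, map_sub, map_mul, map_pow, map_natCast, hs]
      ring)
    have h7 := congrArg A.frameS.φ₁ h6
    rw [map_smulₛₗ, map_pow, map_natCast, smul_eq_mul] at h7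
    exact h7.symm.trans h5
  rw [e1] at e2
  rw [map_sub, map_mul, map_pow, map_natCast]
  linear_combination (-v) * e2 -
    (algebraMap 𝔖 A.S (A.φ i) - p ^ m * algebraMap 𝔖 A.S (A.frame.φ₁ ⟨b, hbF'⟩)) * hv

theorem φ_E_mem : A.φ A.E ∈ Ideal.span {(p : 𝔖), A.E} := by
  rw [← sub_add_cancel (A.φ A.E) (A.E ^ p)]
  refine add_mem (Ideal.span_mono (by simp) (A.φ_frob A.E)) ?_
  exact Ideal.pow_mem_of_mem _ A.E_mem_span_pair _ hp.out.pos

theorem mk_mem_span_E_pow {k : ℕ} {x : 𝔖} (hx : x ∈ Ideal.span {(p : 𝔖), A.E} ^ (n + k)) :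
    Ideal.Quotient.mk (Ideal.span {(p : 𝔖) ^ n}) x ∈
      Ideal.span {Ideal.Quotient.mk (Ideal.span {(p : 𝔖) ^ n}) A.E} ^ k := by
  obtain ⟨a, ha, b, hb, rfl⟩ := Submodule.mem_sup.1 (A.span_pair_pow_le n k hx)
  rw [map_add, Ideal.Quotient.eq_zero_iff_mem.2 ha, zero_add, Ideal.span_singleton_pow,
    Ideal.mem_span_singleton, ← map_pow]
  exact map_dvd _ (Ideal.mem_span_singleton.1 hb)

theorem mod_φ₁_mk_E_mul (y : 𝔖) :
    ∃ h : Ideal.Quotient.mk (Ideal.span {(p : 𝔖) ^ n}) (A.E * y) ∈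
        (A.frame.mod A.frame_torsionFree n).Fil,
      (A.frame.mod A.frame_torsionFree n).φ₁ ⟨_, h⟩ = Ideal.Quotient.mk _ (A.φ y) := by
  have hF : A.E * y ∈ A.frame.Fil := Ideal.mul_mem_right _ _ (Ideal.mem_span_singleton_self _)
  have h : Ideal.Quotient.mk (Ideal.span {(p : 𝔖) ^ n}) (A.E * y) ∈
      (A.frame.mod A.frame_torsionFree n).Fil := Ideal.mem_map_of_mem _ hF
  refine ⟨h, ?_⟩
  rw [A.frame.mod_φ₁_mk A.frame_torsionFree n ⟨A.E * y, hF⟩ h, A.frame_φ₁]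

/-- Conditions involving `p`-adic limits are trivial because `pⁿ = 0`, and the others are inherited
from `λ`. The substance lies in the choice of ideals for the kernel. -/
theorem contracting_frameHomMod (h3 : 3 ≤ p) (hc : IsUnit A.c) :
    (A.frameHomMod hc n).Contracting where
  mem_fil := A.mod_mem_fil n hc
  exists_sub_mem b := by
    obtain ⟨b, rfl⟩ := Ideal.Quotient.mk_surjective b
    obtain ⟨a, ha⟩ := A.exists_sub_mem_divKer h3 b
    exact ⟨Ideal.Quotient.mk _ a, A.frameS.mk_mem_divKer A.frameS_torsionFree ha⟩
  complete_fil := by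
    have h : (A.frame.mod A.frame_torsionFree n).Fil =
        Ideal.span {Ideal.Quotient.mk (Ideal.span {(p : 𝔖) ^ n}) A.E} := by
      refine (Ideal.map_span _ _).trans ?_
      rw [Set.image_singleton]
    rw [h]
    exact A.isAdicComplete_E_mod n
  complete_source := isAdicComplete_of_pow_eq_bot (span_natCast_pow_eq_bot p n)
  complete_target := isAdicComplete_of_pow_eq_bot (span_natCast_pow_eq_bot p n)
  closed b h := by
    obtain ⟨a, ha⟩ := h n
    rw [span_natCast_pow_eq_bot] at ha
    exact ⟨a, sub_eq_zero.1 ha⟩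
  fil_closed b h := by
    have := h n
    rwa [span_natCast_pow_eq_bot, sup_bot_eq] at this
  φ₁_mem := A.frameS.mod_φ₁_mem_of_torsionFree A.frameS_torsionFree n
  exists_ideals := by
    -- `𝔪` is generated by `E`, and `𝔟 k` is the image of `𝔖 ∩ pⁿ⁺ᵏ S`, which contains the kernel
    -- for `k = 0` and lies in `(p, E)ⁿ⁺ᵏ`, hence in `𝔪ᵏ` modulo `pⁿ`. The shift `n + 1` counts one
    -- factor `E` removed by `φ₁` and `n` factors lost because `φ E` lies only in `(p, E)`.
    refine ⟨Ideal.span {Ideal.Quotient.mk (Ideal.span {(p : 𝔖) ^ n}) A.E},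
      fun k => ((Ideal.span {(p : A.S) ^ (n + k)}).comap (algebraMap 𝔖 A.S)).map
        (Ideal.Quotient.mk _), n + 1, A.isAdicComplete_E_mod n, fun b hb => ?_, fun x hx => ?_,
      fun k => ?_, fun k x hx => ?_, fun j x hx => ?_⟩
    · have h := hb ((1 + p) * n)
      rw [Ideal.span_singleton_pow, Ideal.map_span, Set.image_singleton, Ideal.mem_span_singleton,
        ← map_pow] at h
      have h0 : (A.frameHomMod hc n).toRingHom (Ideal.Quotient.mk _ (A.E ^ ((1 + p) * n))) = 0 :=
        Ideal.Quotient.eq_zero_iff_mem.2 (Ideal.mem_span_singleton.2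
          (A.dvd_S_of_mem_pow (Ideal.pow_mem_pow A.E_mem_span_pair _)))
      rw [h0] at h
      exact zero_dvd_iff.1 h
    · obtain ⟨x, rfl⟩ := Ideal.Quotient.mk_surjective x
      have h : Ideal.Quotient.mk (Ideal.span {(p : A.S) ^ n}) (algebraMap 𝔖 A.S x) = 0 :=
        RingHom.mem_ker.1 hx
      have h' : x ∈ (Ideal.span {(p : A.S) ^ n}).comap (algebraMap 𝔖 A.S) :=
        Ideal.mem_comap.2 (Ideal.Quotient.eq_zero_iff_mem.1 h)
      exact Ideal.mem_map_of_mem _ h'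
    · refine Ideal.map_le_iff_le_comap.2 fun x hx => A.mk_mem_span_E_pow n ?_
      exact A.mem_pow_of_dvd_S (Ideal.mem_span_singleton.1 hx)
    · obtain ⟨x, hx', rfl⟩ :=
        (Ideal.mem_map_iff_of_surjective _ Ideal.Quotient.mk_surjective).1 hx
      obtain ⟨i, a, b, hxi, hi⟩ :=
        A.exists_dvd_φ_sub h3 hc (Ideal.mem_span_singleton.1 hx')
      have h0 : ∀ y : 𝔖, Ideal.Quotient.mk (Ideal.span {(p : 𝔖) ^ n}) (p ^ (n + k) * y) = 0 :=
        fun y => Ideal.Quotient.eq_zero_iff_mem.2 (Ideal.mem_span_singleton.2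
          ((pow_dvd_pow _ (Nat.le_add_right n k)).trans (dvd_mul_right _ _)))
      rw [hxi, map_add, h0, add_zero]
      obtain ⟨h1, h2⟩ := A.mod_φ₁_mk_E_mul n i
      refine ⟨h1, ?_⟩
      rw [h2, ← sub_zero (Ideal.Quotient.mk _ (A.φ i)), ← h0 b, ← map_sub]
      exact Ideal.mem_map_of_mem _ (Ideal.mem_span_singleton.2 hi)
    · rw [Ideal.span_singleton_pow, Ideal.mem_span_singleton] at hx
      obtain ⟨y, rfl⟩ := hx
      obtain ⟨y, rfl⟩ := Ideal.Quotient.mk_surjective y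
      have e : Ideal.Quotient.mk (Ideal.span {(p : 𝔖) ^ n}) A.E ^ (n + 1 + j) *
          Ideal.Quotient.mk _ y = Ideal.Quotient.mk _ (A.E * (A.E ^ (n + j) * y)) := by
        rw [← map_pow, ← map_mul]
        ring_nf
      rw [e]
      obtain ⟨h1, h2⟩ := A.mod_φ₁_mk_E_mul n (A.E ^ (n + j) * y)
      refine ⟨h1, ?_⟩
      rw [h2, map_mul A.φ, map_pow A.φ]
      exact A.mk_mem_span_E_pow n (Ideal.mul_mem_right _ _ (Ideal.pow_mem_pow A.φ_E_mem _))

end Reduction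

end BreuilKisinDatum

end WindowTheory

theorem mainTheorem6 (p : ℕ) [Fact p.Prime] (hp : 3 ≤ p) (𝔖 : Type u) [CommRing 𝔖]
    (A : WindowTheory.BreuilKisinDatum p 𝔖) (hc : IsUnit A.c) :
    (A.frameHom hc).IsCrystalline ∧ ∀ n : ℕ, 1 ≤ n → (A.frameHomMod hc n).IsCrystalline := by
  have hp0 : p ≠ 0 := by omega
  exact ⟨(A.frameHom hc).isCrystalline_of_contracting hp0 (A.contracting_frameHom hp hc),
    fun n _ => (A.frameHomMod hc n).isCrystalline_of_contracting hp0
      (A.contracting_frameHomMod n hp hc)⟩
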